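/- **Setting.** Let $G$ be a finite graph with $n$ vertices and maximum degree $\Delta$, with an arbitrary fixed linear order on $V(G)$. Let $\Omega=[k]^{V(G)}$ be the set of all (not necessarily proper) $k$-colorings. For $\varphi\in\Omega$, a vertex $u$ and a color $c$, let $S_\varphi(u,c)$ be the set of vertices reachable from $u$ along edges whose endpoints have exactly the colors $\varphi(u)$ and $c$ (along monochromatic edges, if $c=\varphi(u)$); this is a Kempe component, considered together with its unordered pair of colors. Let $\mathcal K_\varphi$ be the family of all Kempe components, and for $S\in\mathcal K_\varphi$ let $\varphi_S$ be obtained by exchanging the two colors of $S$ on $S$; put $\varphi_\emptyset=\varphi$. *Flip dynamics* with parameters $p$ moves from $\varphi$ by choosing $(u,c)\in V(G)\times[k]$ uniformly and flipping $S=S_\varphi(u,c)$ with probability $p_{|S|}/|S|$ (otherwise the move is $\emptyset$). Let $\mathbb P_\varphi$ be the law of the move in $\mathcal K_\varphi\cup\{\emptyset\}$. Use $$p^*=\left(1,\tfrac{185}{616},\tfrac16,\tfrac{47}{462},\tfrac{9}{154},\tfrac{2}{77},0,0,\dots\right),\qquad p^*_0=0 .$$ **Metric.** Let $\Gamma$ be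 the graph on $\Omega$ in which $\sigma,\tau$ are adjacent iff they differ at exactly one vertex, always called $v$. For a color $c$ let $W_c=\{w_1<\dots<w_r\}$ be the set of neighbors of $v$ of color $c$, let $a_i=|S_\tau(w_i,\sigma(v))|$ and $b_i=|S_\sigma(w_i,\tau(v))|$, except that if a component contains several vertices of $W_c$, then its size is recorded only at the first of them and $0$ at the others. Call $(a_1,\dots,a_r;b_1,\dots,b_r)$ the configuration for $c$. The configurations $(2;1),(1;2)$ are the extremal $1$-configurations and $(3,3;1,1),(1,1;3,3)$ are the extremal $2$-configurations. Let $\beta_{\sigma,\tau}(v)=(|B^1|+2|B^2|)/\Delta$, where $B^i$ is the set of colors with an extremal $i$-configuration. Put $\omega(\sigma,\tau)=1-\gamma(1-\beta_{\sigma,\tau}(v))$ with $\gamma=\frac{\varepsilon\Delta}{53k}$, $\varepsilon=\frac{11}{6}-\frac{161}{88}=\frac1{264}$, and let $d(\sigma',\tau')$ be the minimum total $\omega$-weight of a path in $\Gamma$ from $\sigma'$ to $\tau'$. Let $d_H$ be the Hamming metric and $d_B=d_H-d$. **Coupling.** Let $\sigma,\tau$ be adjacent in $\Gamma$. For a color $c$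 put $\mathcal A_\sigma(c)=\{S_\sigma(v,c)\}\cup\{S_\sigma(w,\tau(v)):w\in W_c\text{ in }\sigma\}$ and $\mathcal A_\tau(c)=\{S_\tau(v,c)\}\cup\{S_\tau(w,\sigma(v)):w\in W_c\text{ in }\tau\}$. Vigoda's coupling is a coupling $\mathbb P_{\sigma\tau}$ of $\mathbb P_\sigma$ and $\mathbb P_\tau$ in which $kn\,\mathbb P_{\sigma\tau}$ gives the following masses. * Each $S\in\mathcal K_\sigma\setminus\bigcup_c\mathcal A_\sigma(c)$ (which is the same family for $\tau$) is coupled with itself, with mass $p_{|S|}$. * For $c\notin\{\sigma(v),\tau(v)\}$ with $r=0$, the pair $(S_\sigma(v,c),S_\tau(v,c))$ has mass $p_1$. * For $c\notin\{\sigma(v),\tau(v)\}$ with $r\ge1$, put $a=1+\sum a_i$, $b=1+\sum b_i$, let $i_a,i_b$ be any indices of a maximal $a_i$ and of a maximal $b_i$, let $q_{i_a}=p_{a_{i_a}}-p_a$ and $q_i=p_{a_i}$ otherwise, and define $q'_i$ in the same way from the $b_i$ and $i_b$. Then $(S_\sigma(v,c),S_\tau(w_{i_a},\sigma(v)))$ has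 mass $p_a$, $(S_\sigma(w_{i_b},\tau(v)),S_\tau(v,c))$ has mass $p_b$, and for each $i$ the pairs $(S_\sigma(w_i,\tau(v)),S_\tau(w_i,\sigma(v)))$, $(\emptyset,S_\tau(w_i,\sigma(v)))$, $(S_\sigma(w_i,\tau(v)),\emptyset)$ have masses $\min(q_i,q'_i)$, $q_i-\min(q_i,q'_i)$, $q'_i-\min(q_i,q'_i)$. (Masses given to the same pair are added.) * All other pairs have mass $0$, except that the components in $\mathcal A_\sigma(\sigma(v))\cup\mathcal A_\sigma(\tau(v))\cup\{\emptyset\}$ and those in $\mathcal A_\tau(\sigma(v))\cup\mathcal A_\tau(\tau(v))\cup\{\emptyset\}$ may be coupled with each other in any way that makes the marginals correct. Let $(Y,Z)=(\sigma_S,\tau_{S'})$ with $(S,S')$ distributed according to $\mathbb P_{\sigma\tau}$, and let $$\nabla_H=kn\,\mathbb E[d_H(Y,Z)-d_H(\sigma,\tau)],\qquad \nabla_B=-kn\,\mathbb E[d_B(Y,Z)-d_B(\sigma,\tau)],$$ $$\nabla(\sigma,\tau)=\nabla_H+\nabla_B=kn\,\mathbb E[d(Y,Z)-d(\sigma,\tau)].$$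 **Theorem.** There is an absolute constant $\Delta_0$ such that the following holds for flip dynamics with flip parameters $p^*$. If $\Delta\ge\Delta_0$ and $k\ge\left(\frac{11}{6}-\eta\right)\Delta$ with $\eta=\frac1{84000}$, then for every pair of colorings $\sigma,\tau\in\Omega$ that differ at exactly one vertex (and all choices of the indices $i_a,i_b$) a coupling as described exists, and every such coupling satisfies $$\nabla(\sigma,\tau)\le-1 .$$ -/

import Mathlib

namespace FlipDynamics

/-! Flip dynamics on all (not necessarily proper) colorings `V → Fin k` of a finite graph `G`. -/

section Kempe

variable {V : Type*} [Fintype V] {k : ℕ}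

/-- The spanning subgraph of `G` formed by the edges whose two endpoints carry exactly the two
colors of `e` (for `e = s(c, c)`: the monochromatic edges of color `c`).  Its walks through
vertices with colors in `e` are the `(c₁, c₂)`-alternating walks. -/
def kempeGraph (G : SimpleGraph V) (φ : V → Fin k) (e : Sym2 (Fin k)) : SimpleGraph V where
  Adj x y := G.Adj x y ∧ s(φ x, φ y) = e
  symm := ⟨fun _ _ h => ⟨h.1.symm, by rw [Sym2.eq_swap]; exact h.2⟩⟩
  loopless := ⟨fun x h => G.loopless.irrefl x h.1⟩

open Classical in
/-- The vertex set `S_φ(u, c)` of the Kempe component of `φ` that contains `u`, for the colors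
`φ u` and `c`. -/
noncomputable def kempeSet (G : SimpleGraph V) (φ : V → Fin k) (u : V) (c : Fin k) : Finset V :=
  Finset.univ.filter fun x => (kempeGraph G φ s(φ u, c)).Reachable u x

/-- Kempe components are recorded with their unordered pair of colors.  The same vertex set with
different pairs of colors counts several times, which accounts for multiplicities. -/
abbrev Comp (V : Type*) (k : ℕ) := Sym2 (Fin k) × Finset V

/-- The Kempe component `S_φ(u, c)` together with its colors. -/
noncomputable def kempe (G : SimpleGraph V) (φ : V → Fin k) (u : V) (c : Fin k) : Comp V k :=
  (s(φ u, c), kempeSet G φ u c)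

open Classical in
/-- The multiset `𝒦_φ` of all Kempe components of `φ`. -/
noncomputable def comps (G : SimpleGraph V) (φ : V → Fin k) : Finset (Comp V k) :=
  (Finset.univ : Finset (V × Fin k)).image fun x => kempe G φ x.1 x.2

/-- `𝒦_φ ∪ {∅}`; the empty move is `none`. -/
noncomputable def moves (G : SimpleGraph V) (φ : V → Fin k) : Finset (Option (Comp V k)) :=
  Finset.insertNone (comps G φ)

open Classical in
/-- The coloring `φ_S` obtained by exchanging the two colors of a component on its vertex set. -/
noncomputable def flipComp (φ : V → Fin k) (K : Comp V k) : V → Fin k := fun x =>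
  if x ∈ K.2 then Sym2.lift ⟨fun a b => Equiv.swap a b, Equiv.swap_comm⟩ K.1 (φ x) else φ x

/-- The coloring after a move; the empty move does nothing. -/
noncomputable def applyMove (φ : V → Fin k) : Option (Comp V k) → V → Fin k
  | none => φ
  | some K => flipComp φ K

open Classical in
/-- The law `ℙ_φ` of the move made by one step of flip dynamics with flip parameters `p`:
choose a vertex `u` and a color `c` uniformly at random and let `S = S_φ(u, c)`; the move is `S`
with probability `p_{|S|} / |S|`, and the empty move otherwise. -/
noncomputable def moveProb (G : SimpleGraph V) (p : ℕ → ℝ) (φ : V → Fin k) :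
    Option (Comp V k) → ℝ
  | none => ∑ u : V, ∑ c : Fin k, (1 / ((Fintype.card V : ℝ) * k)) *
      (1 - p (kempeSet G φ u c).card / (kempeSet G φ u c).card)
  | some K => ∑ u : V, ∑ c : Fin k, if kempe G φ u c = K then
      (1 / ((Fintype.card V : ℝ) * k)) * (p K.2.card / K.2.card) else 0

end Kempe

section Metric

variable {V : Type*} [Fintype V] [LinearOrder V] {k : ℕ}

/-- The graph `Γ` on all colorings; two are adjacent if they differ at exactly one vertex. -/
def colorGraph (V : Type*) [Fintype V] (k : ℕ) : SimpleGraph (V → Fin k) where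
  Adj σ τ := hammingDist σ τ = 1
  symm := ⟨fun σ τ h => by rw [hammingDist_comm]; exact h⟩
  loopless := ⟨fun σ h => by simp at h⟩

open Classical in
/-- The neighbors of `v` of color `c`. -/
noncomputable def colorNbrs (G : SimpleGraph V) (φ : V → Fin k) (v : V) (c : Fin k) : Finset V :=
  Finset.univ.filter fun w => G.Adj v w ∧ φ w = c

open Classical in
/-- The entry of a configuration at `w ∈ W`: the size of `S_φ(w, d)`, where a component that
contains several vertices of `W` is counted only at the first of them (and `0` is recorded at
the others). -/
noncomputable def entry (G : SimpleGraph V) (φ : V → Fin k) (d : Fin k) (W : Finset V) (w : V) :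
    ℕ :=
  if ∃ w' ∈ W, w' < w ∧ w' ∈ kempeSet G φ w d then 0 else (kempeSet G φ w d).card

/-- The numbers `a_i` of the configuration of `(σ, τ)` at `v` for `c`, indexed by the vertices
`w_i`. -/
noncomputable def aEntry (G : SimpleGraph V) (σ τ : V → Fin k) (v : V) (c : Fin k) (w : V) : ℕ :=
  entry G τ (σ v) (colorNbrs G σ v c) w

/-- The numbers `b_i` of the configuration of `(σ, τ)` at `v` for `c`. -/
noncomputable def bEntry (G : SimpleGraph V) (σ τ : V → Fin k) (v : V) (c : Fin k) (w : V) : ℕ :=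
  entry G σ (τ v) (colorNbrs G σ v c) w

/-- The configuration `(a_1, …, a_r; b_1, …, b_r)` of `(σ, τ)` at `v` for `c`. -/
noncomputable def configuration (G : SimpleGraph V) (σ τ : V → Fin k) (v : V) (c : Fin k) :
    List ℕ × List ℕ :=
  (((colorNbrs G σ v c).sort (· ≤ ·)).map (aEntry G σ τ v c),
   ((colorNbrs G σ v c).sort (· ≤ ·)).map (bEntry G σ τ v c))

/-- The colors with an extremal `1`-configuration, `(2; 1)` or `(1; 2)`. -/
noncomputable def extremalOne (G : SimpleGraph V) (σ τ : V → Fin k) (v : V) : Finset (Fin k) :=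
  Finset.univ.filter fun c =>
    configuration G σ τ v c = ([2], [1]) ∨ configuration G σ τ v c = ([1], [2])

/-- The colors with an extremal `2`-configuration, `(3, 3; 1, 1)` or `(1, 1; 3, 3)`. -/
noncomputable def extremalTwo (G : SimpleGraph V) (σ τ : V → Fin k) (v : V) : Finset (Fin k) :=
  Finset.univ.filter fun c =>
    configuration G σ τ v c = ([3, 3], [1, 1]) ∨ configuration G σ τ v c = ([1, 1], [3, 3])

/-- `β_{σ,τ}(v)`, with `Δ` the maximum degree of `G`. -/
noncomputable def beta (G : SimpleGraph V) [DecidableRel G.Adj] (σ τ : V → Fin k) (v : V) : ℝ :=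
  (((extremalOne G σ τ v).card : ℝ) + 2 * (extremalTwo G σ τ v).card) / G.maxDegree

/-- The weight `ω(σ, τ) = 1 - γ (1 - β_{σ,τ}(v))` of an edge of `Γ`, where `v` is the only vertex
with `σ v ≠ τ v` (so the sum has exactly one term). -/
noncomputable def edgeWeight (G : SimpleGraph V) [DecidableRel G.Adj] (γ : ℝ)
    (σ τ : V → Fin k) : ℝ :=
  ∑ v ∈ Finset.univ.filter (fun v => σ v ≠ τ v), (1 - γ * (1 - beta G σ τ v))

/-- The extremal metric `d`: the minimum weight of a path of `Γ` between two colorings. -/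
noncomputable def extDist (G : SimpleGraph V) [DecidableRel G.Adj] (γ : ℝ)
    (σ τ : V → Fin k) : ℝ :=
  ⨅ P : (colorGraph V k).Path σ τ,
    (P.1.darts.map fun e => edgeWeight G γ e.fst e.snd).sum

/-- `d_B = d_H - d`. -/
noncomputable def distB (G : SimpleGraph V) [DecidableRel G.Adj] (γ : ℝ)
    (σ τ : V → Fin k) : ℝ :=
  (hammingDist σ τ : ℝ) - extDist G γ σ τ

end Metric

section Coupling

variable {V : Type*} [Fintype V] [LinearOrder V] {k : ℕ}

open Classical in
/-- The set `𝒜_φ(c)`, where `d` is the color of `v` in the other coloring. -/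
noncomputable def affectedBy (G : SimpleGraph V) (φ : V → Fin k) (v : V) (d c : Fin k) :
    Finset (Comp V k) :=
  insert (kempe G φ v c) ((colorNbrs G φ v c).image fun w => kempe G φ w d)

open Classical in
/-- The multiset `𝒜_φ`, the union of all `𝒜_φ(c)`. -/
noncomputable def affected (G : SimpleGraph V) (φ : V → Fin k) (v : V) (d : Fin k) :
    Finset (Comp V k) :=
  Finset.univ.biUnion fun c => affectedBy G φ v d c

open Classical in
/-- The empty move and the members of `𝒜_φ(c)` for the two colors `c` of `v`. -/
noncomputable def specialMoves (G : SimpleGraph V) (φ : V → Fin k) (v : V) (d : Fin k) :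
    Finset (Option (Comp V k)) :=
  Finset.insertNone (affectedBy G φ v d (φ v) ∪ affectedBy G φ v d d)

/-- `w` is an index in `W` at which `f` is maximal. -/
def IsArgmax (W : Finset V) (f : V → ℕ) (w : V) : Prop :=
  w ∈ W ∧ ∀ w' ∈ W, f w' ≤ f w

/-- The numbers `q_i` (for `f i = a_i`) and `q'_i` (for `f i = b_i`), where `j` is the chosen
index of a maximal entry. -/
noncomputable def qWeight (p : ℕ → ℝ) (W : Finset V) (f : V → ℕ) (j w : V) : ℝ :=
  if w = j then p (f j) - p (1 + ∑ x ∈ W, f x) else p (f w)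

open Classical in
/-- `kn` times the mass that the coupling gives to a pair of moves on account of a color `c`
other than `σ v` and `τ v`; `ia`, `ib` are the chosen indices of maximal entries. -/
noncomputable def colorMass (G : SimpleGraph V) (p : ℕ → ℝ) (σ τ : V → Fin k) (v : V)
    (c : Fin k) (ia ib : V) (X Y : Option (Comp V k)) : ℝ :=
  let W := colorNbrs G σ v c
  let a := aEntry G σ τ v c
  let b := bEntry G σ τ v c
  let q := qWeight p W a ia
  let q' := qWeight p W b ib
  if W = ∅ then
    if X = some (kempe G σ v c) ∧ Y = some (kempe G τ v c) then p 1 else 0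
  else
    (if X = some (kempe G σ v c) ∧ Y = some (kempe G τ ia (σ v)) then
        p (1 + ∑ w ∈ W, a w) else 0)
    + (if X = some (kempe G σ ib (τ v)) ∧ Y = some (kempe G τ v c) then
        p (1 + ∑ w ∈ W, b w) else 0)
    + ∑ w ∈ W,
        ((if X = some (kempe G σ w (τ v)) ∧ Y = some (kempe G τ w (σ v)) then
            min (q w) (q' w) else 0)
        + (if X = none ∧ Y = some (kempe G τ w (σ v)) then q w - min (q w) (q' w) else 0)
        + (if X = some (kempe G σ w (τ v)) ∧ Y = none then q' w - min (q w) (q' w) else 0))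

open Classical in
/-- `kn` times the mass that the coupling gives to a pair of moves, outside the special colors
`σ v`, `τ v`: the contributions of the other colors, and the identity coupling on the components
that do not belong to `𝒜_σ`. -/
noncomputable def regularMass (G : SimpleGraph V) (p : ℕ → ℝ) (σ τ : V → Fin k) (v : V)
    (ia ib : Fin k → V) (X Y : Option (Comp V k)) : ℝ :=
  (∑ c ∈ Finset.univ.filter (fun c => c ≠ σ v ∧ c ≠ τ v),
      colorMass G p σ τ v c (ia c) (ib c) X Y)
  + ∑ S ∈ comps G σ \ affected G σ v (τ v),
      if X = some S ∧ Y = some S then p S.2.card else 0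

/-- `P` is the joint law `ℙ_{στ}` of Vigoda's coupling of one step of flip dynamics from `σ` and
from `τ`, which differ only at `v`.  The marginals are the laws of the moves of the two chains,
and all masses are prescribed, except among the components that belong to the two colors `σ v`
and `τ v` (and the empty move), where any coupling is allowed. -/
structure IsVigodaCoupling (G : SimpleGraph V) (p : ℕ → ℝ) (σ τ : V → Fin k) (v : V)
    (ia ib : Fin k → V) (P : Option (Comp V k) → Option (Comp V k) → ℝ) : Prop where
  nonneg : ∀ X ∈ moves G σ, ∀ Y ∈ moves G τ, 0 ≤ P X Y
  fst_law : ∀ X ∈ moves G σ, ∑ Y ∈ moves G τ, P X Y = moveProb G p σ X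
  snd_law : ∀ Y ∈ moves G τ, ∑ X ∈ moves G σ, P X Y = moveProb G p τ Y
  regular : ∀ X ∈ moves G σ, ∀ Y ∈ moves G τ,
    ¬ (X ∈ specialMoves G σ v (τ v) ∧ Y ∈ specialMoves G τ v (σ v)) →
    P X Y = regularMass G p σ τ v ia ib X Y / (k * Fintype.card V)

/-- `∇_H(σ, τ)`, for a coupling `P` of one step of the two chains. -/
noncomputable def nablaH (G : SimpleGraph V) (σ τ : V → Fin k)
    (P : Option (Comp V k) → Option (Comp V k) → ℝ) : ℝ :=
  k * Fintype.card V * ∑ X ∈ moves G σ, ∑ Y ∈ moves G τ,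
    P X Y * ((hammingDist (applyMove σ X) (applyMove τ Y) : ℝ) - hammingDist σ τ)

/-- `∇_B(σ, τ)`. -/
noncomputable def nablaB (G : SimpleGraph V) [DecidableRel G.Adj] (γ : ℝ) (σ τ : V → Fin k)
    (P : Option (Comp V k) → Option (Comp V k) → ℝ) : ℝ :=
  -(k * Fintype.card V * ∑ X ∈ moves G σ, ∑ Y ∈ moves G τ,
    P X Y * (distB G γ (applyMove σ X) (applyMove τ Y) - distB G γ σ τ))

/-- `∇(σ, τ) = ∇_H(σ, τ) + ∇_B(σ, τ)`. -/
noncomputable def nabla (G : SimpleGraph V) [DecidableRel G.Adj] (γ : ℝ) (σ τ : V → Fin k)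
    (P : Option (Comp V k) → Option (Comp V k) → ℝ) : ℝ :=
  nablaH G σ τ P + nablaB G γ σ τ P

/-- `∇` is `kn` times the expected one-step change of the extremal metric. -/
theorem nabla_eq (G : SimpleGraph V) [DecidableRel G.Adj] (γ : ℝ) (σ τ : V → Fin k)
    (P : Option (Comp V k) → Option (Comp V k) → ℝ) :
    nabla G γ σ τ P = k * Fintype.card V * ∑ X ∈ moves G σ, ∑ Y ∈ moves G τ,
      P X Y * (extDist G γ (applyMove σ X) (applyMove τ Y) - extDist G γ σ τ) := by
  unfold nabla nablaH nablaB distB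
  rw [← sub_eq_add_neg, ← mul_sub, ← Finset.sum_sub_distrib]
  congr 1
  refine Finset.sum_congr rfl fun X _ => ?_
  rw [← Finset.sum_sub_distrib]
  refine Finset.sum_congr rfl fun Y _ => ?_
  ring

end Coupling

/-- The flip parameters `p*`, with the convention `p*_0 = 0`. -/
noncomputable def pStar : ℕ → ℝ
  | 1 => 1
  | 2 => 185 / 616
  | 3 => 1 / 6
  | 4 => 47 / 462
  | 5 => 9 / 154
  | 6 => 2 / 77
  | _ => 0

/-- The constant `γ = ε Δ / (53 k)` of the metric, with `ε = 11/6 - 161/88 = 1/264`. -/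
noncomputable def gammaConst (Δ k : ℕ) : ℝ :=
  (11 / 6 - 161 / 88) * Δ / (53 * k)

end FlipDynamics

namespace FlipDynamics

set_option linter.unusedSectionVars false

/-! ### Kempe components and the law of one move -/

section KempeBasics

variable {V : Type*} [Fintype V] {k : ℕ} {G : SimpleGraph V} {φ : V → Fin k}

/-! Colorings that differ only at `v` have distance `1 - δ` with `δ = γ (1 - β)`, and `d` never
exceeds the Hamming distance. So a pair of moves changes `d` by at most the change of the Hamming
distance plus `δ`. A component outside `𝒜_σ` is flipped in both chains and leaves `v` as their only
difference; there `d` changes by exactly `γ` times the change of `β`. The proof balances these two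
effects.

Hamming part: a color other than those of `v`, with `r` neighbors, contributes at most `-1 + 161/88
r`, except that an extremal configuration only allows `-1 + 11/6 r` (`hVal_le`). Let `E = β Δ` be
the number of neighbors of `v` with an extremal color. Up to constants the sum over all colors is
`-k + 161/88 Δ + ε E`, and the surcharge `δ` is paid on a mass of at most `k + 2 Δ`. The two colors
of `v`, where the coupling is arbitrary, add only a constant and at most `1` per neighbor, up to the
surcharge.

Drift part: extremal configurations are fragile. Recoloring one suitable vertex by any of about `k -
Δ` free colors destroys one (`sum_destroy_ge`), while a neighbor that is not extremal becomes so
with total mass at most `18 k + 17 Δ` (`sum_create_le`). Hence `β` is driven down when it is near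
`1` (`drift_le`).

The resulting bound `nabla_le` is affine in `β`. At `β = 0` the saving `ε Δ` outweighs all terms
with `γ`, thanks to the factor `53` in `γ`. At `β = 1` the surcharge vanishes and the drift gains
about `γ (k - Δ)`, which is more than the `Δ / 84000` that `k` may fall short of `11/6 Δ`. The
constants are absorbed by a large `Δ`.

A coupling exists because the prescribed masses never exceed the marginals (`restMass_nonneg`); a
product coupling fills the remainder. -/

theorem mem_kempeSet {u x : V} {c : Fin k} :
    x ∈ kempeSet G φ u c ↔ (kempeGraph G φ s(φ u, c)).Reachable u x := by
  simp [kempeSet]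

theorem self_mem_kempeSet (u : V) (c : Fin k) : u ∈ kempeSet G φ u c :=
  mem_kempeSet.2 (SimpleGraph.Reachable.refl _)

theorem one_le_card_kempeSet (u : V) (c : Fin k) : 1 ≤ (kempeSet G φ u c).card :=
  Finset.card_pos.2 ⟨u, self_mem_kempeSet u c⟩

theorem mem_kempeSet_of_adj {u x y : V} {c : Fin k} (hx : x ∈ kempeSet G φ u c)
    (h : G.Adj x y) (he : s(φ x, φ y) = s(φ u, c)) : y ∈ kempeSet G φ u c :=
  mem_kempeSet.2 ((mem_kempeSet.1 hx).trans
    (SimpleGraph.Adj.reachable (G := kempeGraph G φ s(φ u, c)) ⟨h, he⟩))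

/-- Induction along a Kempe component. -/
theorem kempeSet_induction {u : V} {c : Fin k} {p : V → Prop} (h0 : p u)
    (h : ∀ x y, x ∈ kempeSet G φ u c → p x → G.Adj x y → s(φ x, φ y) = s(φ u, c) → p y) :
    ∀ x ∈ kempeSet G φ u c, p x := by
  intro x hx
  have hr := (SimpleGraph.reachable_iff_reflTransGen _ _).1 (mem_kempeSet.1 hx)
  induction hr with
  | refl => exact h0
  | tail h1 h2 ih =>
    have hm := mem_kempeSet.2 ((SimpleGraph.reachable_iff_reflTransGen _ _).2 h1)
    exact h _ _ hm (ih hm) h2.1 h2.2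

theorem color_mem_of_mem_kempeSet {u x : V} {c : Fin k} (hx : x ∈ kempeSet G φ u c) :
    φ x ∈ s(φ u, c) := by
  refine kempeSet_induction (G := G) (φ := φ) (u := u) (c := c) (p := fun x => φ x ∈ s(φ u, c))
    (by simp) ?_ x hx
  intro x y _ _ _ he
  rw [← he]; simp

theorem color_eq_or_of_mem_kempeSet {u x : V} {c : Fin k} (hx : x ∈ kempeSet G φ u c) :
    φ x = φ u ∨ φ x = c := by
  simpa using color_mem_of_mem_kempeSet hx

theorem exists_pair_of_mem_kempeSet {u x : V} {c : Fin k} (hx : x ∈ kempeSet G φ u c) :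
    ∃ d, s(φ x, d) = s(φ u, c) := by
  obtain ⟨d, hd⟩ := color_mem_of_mem_kempeSet hx
  exact ⟨d, hd.symm⟩

theorem kempe_eq_of_mem {u x : V} {c d : Fin k} (hx : x ∈ kempeSet G φ u c)
    (h : s(φ x, d) = s(φ u, c)) : kempe G φ x d = kempe G φ u c := by
  unfold kempe
  rw [h]
  congr 1
  ext y
  rw [mem_kempeSet, mem_kempeSet, h]
  exact ⟨fun hy => (mem_kempeSet.1 hx).trans hy, fun hy => (mem_kempeSet.1 hx).symm.trans hy⟩

theorem kempe_eq_iff {u x : V} {c d : Fin k} :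
    kempe G φ x d = kempe G φ u c ↔ x ∈ kempeSet G φ u c ∧ s(φ x, d) = s(φ u, c) := by
  constructor
  · intro h
    have h1 := congrArg Prod.fst h
    have h2 := congrArg Prod.snd h
    simp only [kempe] at h1 h2
    exact ⟨h2 ▸ self_mem_kempeSet x d, h1⟩
  · exact fun h => kempe_eq_of_mem h.1 h.2

@[simp] theorem kempe_fst (u : V) (c : Fin k) : (kempe G φ u c).1 = s(φ u, c) := rfl
@[simp] theorem kempe_snd (u : V) (c : Fin k) : (kempe G φ u c).2 = kempeSet G φ u c := rfl

theorem mem_comps {K : Comp V k} : K ∈ comps G φ ↔ ∃ u c, kempe G φ u c = K := by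
  simp [comps]

theorem kempe_mem_comps (u : V) (c : Fin k) : kempe G φ u c ∈ comps G φ :=
  mem_comps.2 ⟨u, c, rfl⟩

theorem exists_kempe_eq_of_mem {K : Comp V k} (hK : K ∈ comps G φ) {x : V} (hx : x ∈ K.2) :
    ∃ d, kempe G φ x d = K := by
  obtain ⟨u, c, rfl⟩ := mem_comps.1 hK
  obtain ⟨d, hd⟩ := exists_pair_of_mem_kempeSet hx
  exact ⟨d, kempe_eq_of_mem hx hd⟩

theorem comp_nonempty {K : Comp V k} (hK : K ∈ comps G φ) : 1 ≤ K.2.card := by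
  obtain ⟨u, c, rfl⟩ := mem_comps.1 hK
  exact one_le_card_kempeSet u c

theorem flipComp_of_notMem {K : Comp V k} {x : V} (h : x ∉ K.2) : flipComp φ K x = φ x := by
  simp [flipComp, h]

theorem flipComp_kempe_of_mem {u x : V} {c : Fin k} (h : x ∈ kempeSet G φ u c) :
    flipComp φ (kempe G φ u c) x = Equiv.swap (φ u) c (φ x) := by
  simp [flipComp, h]

theorem flipComp_kempe_self (u : V) (c : Fin k) : flipComp φ (kempe G φ u c) u = c := by
  rw [flipComp_kempe_of_mem (self_mem_kempeSet u c)]; simp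

/-- A flipped vertex determines the component: it is the one for its old and its new color. -/
theorem kempe_flipComp {K : Comp V k} (hK : K ∈ comps G φ) {x : V} (hx : x ∈ K.2) :
    kempe G φ x (flipComp φ K x) = K := by
  obtain ⟨d, rfl⟩ := exists_kempe_eq_of_mem hK hx
  rw [flipComp_kempe_self]

/-- The set reached from `u` depends only on the colors near it: if the edges of the Kempe graph of
`φ` inside the component are also present for `ψ`, the component can only grow. -/
theorem kempeSet_subset_of_agree {ψ : V → Fin k} {u : V} {c : Fin k}
    (h : ∀ x ∈ kempeSet G φ u c, φ x = ψ x) : kempeSet G φ u c ⊆ kempeSet G ψ u c := by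
  intro x hx
  have hu := h u (self_mem_kempeSet u c)
  refine kempeSet_induction (G := G) (φ := φ) (u := u) (c := c)
    (p := fun x => x ∈ kempeSet G ψ u c) (self_mem_kempeSet u c) ?_ x hx
  intro x y hx hxp ha he
  have hy := mem_kempeSet_of_adj hx ha he
  exact mem_kempeSet_of_adj hxp ha (by rw [← h x hx, ← h y hy, he, hu])

-- Each vertex of `K` produces `K` for exactly one color, and other vertices never do. This count
-- cancels the factor `1 / |S|` in the flip probability.
open Classical in
theorem sum_ite_kempe_eq {K : Comp V k} (hK : K ∈ comps G φ) :
    ∑ u : V, ∑ c : Fin k, (if kempe G φ u c = K then (1 : ℝ) else 0) = K.2.card := by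
  have : ∀ u : V, ∑ c : Fin k, (if kempe G φ u c = K then (1 : ℝ) else 0)
      = if u ∈ K.2 then 1 else 0 := by
    intro u
    split_ifs with hu
    · obtain ⟨d, hd⟩ := exists_kempe_eq_of_mem hK hu
      rw [Finset.sum_eq_single d]
      · simp [hd]
      · intro c _ hc
        rw [if_neg]
        intro h
        have := congrArg Prod.fst (h.trans hd.symm)
        simp only [kempe_fst, Sym2.congr_right] at this
        exact hc this
      · simp
    · refine Finset.sum_eq_zero fun c _ => if_neg ?_
      rintro rfl
      exact hu (self_mem_kempeSet u c)
  rw [Finset.sum_congr rfl fun u _ => this u]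
  simp

/-- A component is flipped with probability `p_{|S|} / (k n)`. -/
theorem moveProb_some (p : ℕ → ℝ) {K : Comp V k} (hK : K ∈ comps G φ) :
    moveProb G p φ (some K) = p K.2.card / (k * Fintype.card V) := by
  classical
  have h1 : (K.2.card : ℝ) ≠ 0 := by
    have := comp_nonempty hK
    positivity
  have h := sum_ite_kempe_eq hK
  unfold moveProb
  simp only
  have : ∀ u : V, ∀ c : Fin k, (if kempe G φ u c = K then
      (1 / ((Fintype.card V : ℝ) * k)) * (p K.2.card / K.2.card) else 0)
      = (if kempe G φ u c = K then (1 : ℝ) else 0) *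
        ((1 / ((Fintype.card V : ℝ) * k)) * (p K.2.card / K.2.card)) := by
    intro u c; split_ifs <;> simp
  rw [Finset.sum_congr rfl fun u _ => Finset.sum_congr rfl fun c _ => this u c]
  simp_rw [← Finset.sum_mul]
  rw [h]
  field_simp

theorem sum_moveProb (p : ℕ → ℝ) (hn : 0 < Fintype.card V) (hk : 0 < k) :
    ∑ X ∈ moves G φ, moveProb G p φ X = 1 := by
  classical
  unfold moves
  rw [Finset.sum_insertNone]
  unfold moveProb
  simp only
  have h1 : (∑ K ∈ comps G φ, ∑ u : V, ∑ c : Fin k, if kempe G φ u c = K then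
      (1 / ((Fintype.card V : ℝ) * k)) * (p K.2.card / K.2.card) else 0)
      = ∑ u : V, ∑ c : Fin k, (1 / ((Fintype.card V : ℝ) * k)) *
        (p (kempeSet G φ u c).card / (kempeSet G φ u c).card) := by
    rw [Finset.sum_comm]
    refine Finset.sum_congr rfl fun u _ => ?_
    rw [Finset.sum_comm]
    refine Finset.sum_congr rfl fun c _ => ?_
    rw [Finset.sum_ite_eq, if_pos (kempe_mem_comps u c)]
    simp only [kempe_snd]
  rw [h1]
  simp_rw [← Finset.sum_add_distrib, ← mul_add, sub_add_cancel]
  simp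
  field_simp

theorem kempe_moveProb_none (p : ℕ → ℝ) (hn : 0 < Fintype.card V) (hk : 0 < k) :
    k * Fintype.card V * moveProb G p φ none =
      ∑ u : V, ∑ c : Fin k, (1 - p (kempeSet G φ u c).card / (kempeSet G φ u c).card) := by
  unfold moveProb
  simp only
  simp_rw [← Finset.mul_sum]
  field_simp

end KempeBasics

/-! ### Components that depend on the color of `v` -/

section Affected

variable {V : Type*} [Fintype V] [LinearOrder V] {k : ℕ} {G : SimpleGraph V}
  {φ σ τ : V → Fin k} {v : V}

/-- `σ` and `τ` differ exactly at `v`. -/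
def DiffAt (σ τ : V → Fin k) (v : V) : Prop := σ v ≠ τ v ∧ ∀ x, x ≠ v → σ x = τ x

theorem DiffAt.symm (h : DiffAt σ τ v) : DiffAt τ σ v :=
  ⟨h.1.symm, fun x hx => (h.2 x hx).symm⟩

theorem DiffAt.of_hammingDist (h : hammingDist σ τ = 1) (hv : σ v ≠ τ v) : DiffAt σ τ v := by
  refine ⟨hv, fun x hx => ?_⟩
  by_contra hne
  unfold hammingDist at h
  obtain ⟨y, hy⟩ := Finset.card_eq_one.1 h
  have h1 : v ∈ ({y} : Finset V) := hy ▸ by simp [hv]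
  have h2 : x ∈ ({y} : Finset V) := hy ▸ by simp [hne]
  simp only [Finset.mem_singleton] at h1 h2
  exact hx (h2.trans h1.symm)

theorem DiffAt.filter_eq (h : DiffAt σ τ v) :
    Finset.univ.filter (fun x => σ x ≠ τ x) = {v} := by
  ext x
  simp only [Finset.mem_filter, Finset.mem_univ, true_and, Finset.mem_singleton]
  exact ⟨fun hx => by_contra fun hne => hx (h.2 x hne), fun hx => hx ▸ h.1⟩

theorem DiffAt.hammingDist_eq (h : DiffAt σ τ v) : hammingDist σ τ = 1 := by
  unfold hammingDist
  rw [h.filter_eq]; simp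

theorem mem_colorNbrs {c : Fin k} {w : V} : w ∈ colorNbrs G φ v c ↔ G.Adj v w ∧ φ w = c := by
  simp [colorNbrs]

theorem colorNbrs_eq (h : DiffAt σ τ v) (c : Fin k) : colorNbrs G τ v c = colorNbrs G σ v c := by
  ext w
  simp only [mem_colorNbrs]
  exact and_congr_right fun hw => by rw [h.2 w hw.ne']

theorem mem_affectedBy {d c : Fin k} {K : Comp V k} :
    K ∈ affectedBy G φ v d c ↔
      K = kempe G φ v c ∨ ∃ w, G.Adj v w ∧ φ w = c ∧ kempe G φ w d = K := by
  simp only [affectedBy, Finset.mem_insert, Finset.mem_image, mem_colorNbrs, and_assoc]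

theorem mem_affected {d : Fin k} {K : Comp V k} :
    K ∈ affected G φ v d ↔ (∃ c, K = kempe G φ v c) ∨ ∃ w, G.Adj v w ∧ kempe G φ w d = K := by
  simp only [affected, Finset.mem_biUnion, Finset.mem_univ, true_and, mem_affectedBy]
  constructor
  · rintro ⟨c, h | ⟨w, h1, h2, h3⟩⟩
    · exact Or.inl ⟨c, h⟩
    · exact Or.inr ⟨w, h1, h3⟩
  · rintro (⟨c, h⟩ | ⟨w, h1, h3⟩)
    · exact ⟨c, Or.inl h⟩
    · exact ⟨φ w, Or.inr ⟨w, h1, rfl, h3⟩⟩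

theorem affectedBy_subset_affected (d c : Fin k) : affectedBy G φ v d c ⊆ affected G φ v d := by
  intro K hK
  simp only [affected, Finset.mem_biUnion, Finset.mem_univ, true_and]
  exact ⟨c, hK⟩

theorem affected_subset_comps (d : Fin k) : affected G φ v d ⊆ comps G φ := by
  intro K hK
  rcases mem_affected.1 hK with ⟨c, rfl⟩ | ⟨w, _, rfl⟩ <;> exact kempe_mem_comps _ _

theorem notMem_of_notMem_affected {d : Fin k} {K : Comp V k} (hK : K ∈ comps G φ)
    (h : K ∉ affected G φ v d) : v ∉ K.2 := by
  intro hv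
  obtain ⟨c, hc⟩ := exists_kempe_eq_of_mem hK hv
  exact h (mem_affected.2 (Or.inl ⟨c, hc.symm⟩))

/-- An unaffected component has the same vertices for both colorings. -/
theorem kempe_eq_of_notMem_affected (h : DiffAt σ τ v) {u : V} {c : Fin k}
    (hK : kempe G σ u c ∉ affected G σ v (τ v)) :
    v ∉ kempeSet G σ u c ∧ kempe G τ u c = kempe G σ u c := by
  have hv : v ∉ kempeSet G σ u c := notMem_of_notMem_affected (kempe_mem_comps u c) hK
  have huv : u ≠ v := fun e => hv (e ▸ self_mem_kempeSet u c)
  have hst : ∀ x ∈ kempeSet G σ u c, σ x = τ x := fun x hx => h.2 x fun e => hv (e ▸ hx)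
  have hu := h.2 u huv
  refine ⟨hv, ?_⟩
  have h1 := kempeSet_subset_of_agree (G := G) hst
  have h2 : kempeSet G τ u c ⊆ kempeSet G σ u c := by
    intro x hx
    refine kempeSet_induction (G := G) (φ := τ) (u := u) (c := c)
      (p := fun x => x ∈ kempeSet G σ u c) (self_mem_kempeSet u c) ?_ x hx
    intro x y _ hxp ha he
    by_cases hy : y = v
    · subst hy
      -- Reaching `v` from the neighbor `x` would make the component equal to `S_σ(x, τ v)`, which
      -- is affected.
      exfalso
      refine hK (mem_affected.2 (Or.inr ⟨x, ha.symm, kempe_eq_of_mem hxp ?_⟩))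
      rw [hst x hxp, he, hu]
    · exact mem_kempeSet_of_adj hxp ha (by rw [hst x hxp, h.2 y hy, he, hu])
  unfold kempe
  rw [hu, h2.antisymm h1]

theorem mem_comps_of_notMem_affected (h : DiffAt σ τ v) {K : Comp V k}
    (hK : K ∈ comps G σ \ affected G σ v (τ v)) : K ∈ comps G τ \ affected G τ v (σ v) := by
  rw [Finset.mem_sdiff] at hK
  obtain ⟨hK1, hK2⟩ := hK
  obtain ⟨u, c, rfl⟩ := mem_comps.1 hK1
  obtain ⟨hv, he⟩ := kempe_eq_of_notMem_affected h hK2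
  rw [Finset.mem_sdiff]
  refine ⟨he ▸ kempe_mem_comps u c, fun hA => ?_⟩
  rcases mem_affected.1 hA with ⟨d, hd⟩ | ⟨w, hw, hd⟩
  · have := congrArg Prod.snd hd
    simp only [kempe_snd] at this
    exact hv (this ▸ self_mem_kempeSet v d)
  · rw [← he, kempe_eq_iff] at hd
    obtain ⟨hw1, hw2⟩ := hd
    have hset := congrArg Prod.snd he
    have hpair := congrArg Prod.fst he
    simp only [kempe_snd, kempe_fst] at hset hpair
    rw [hset] at hw1
    refine hv (mem_kempeSet_of_adj hw1 hw.symm ?_)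
    rw [← hpair, ← hw2, h.2 w hw.ne']

theorem unaffected_eq (h : DiffAt σ τ v) :
    comps G τ \ affected G τ v (σ v) = comps G σ \ affected G σ v (τ v) :=
  Finset.Subset.antisymm (fun _ hK => mem_comps_of_notMem_affected h.symm hK)
    fun _ hK => mem_comps_of_notMem_affected h hK

/-- Flipping an unaffected component in both colorings keeps the difference at `v` only. -/
theorem DiffAt.flipComp (h : DiffAt σ τ v) {K : Comp V k} (hK : v ∉ K.2) :
    DiffAt (flipComp σ K) (flipComp τ K) v := by
  refine ⟨?_, fun x hx => ?_⟩
  · rw [flipComp_of_notMem hK, flipComp_of_notMem hK]; exact h.1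
  · unfold FlipDynamics.flipComp
    rw [h.2 x hx]

/-- For a color `c` other than the colors of `v`, the component `S_σ(v, c)` consists of `v` and
the components `S_τ(w, σ(v))` of the neighbors `w` of `v` of color `c`. -/
theorem kempeSet_eq_insert (h : DiffAt σ τ v) {c : Fin k} (hcs : c ≠ σ v) (hct : c ≠ τ v) :
    kempeSet G σ v c =
      insert v ((colorNbrs G σ v c).biUnion fun w => kempeSet G τ w (σ v)) := by
  apply Finset.Subset.antisymm
  · intro x hx
    refine kempeSet_induction (G := G) (φ := σ) (u := v) (c := c)
      (p := fun x => x ∈ insert v ((colorNbrs G σ v c).biUnion fun w => kempeSet G τ w (σ v)))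
      (by simp) ?_ x hx
    intro x y hx hxp ha he
    by_cases hy : y = v
    · simp [hy]
    by_cases hxv : x = v
    · subst hxv
      refine Finset.mem_insert_of_mem (Finset.mem_biUnion.2 ⟨y, ?_, self_mem_kempeSet _ _⟩)
      exact mem_colorNbrs.2 ⟨ha, Sym2.congr_right.1 he⟩
    · rcases Finset.mem_insert.1 hxp with hxv' | hxp
      · exact absurd hxv' hxv
      obtain ⟨w, hw, hxw⟩ := Finset.mem_biUnion.1 hxp
      refine Finset.mem_insert_of_mem (Finset.mem_biUnion.2 ⟨w, hw, ?_⟩)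
      obtain ⟨hw1, hw2⟩ := mem_colorNbrs.1 hw
      refine mem_kempeSet_of_adj hxw ha ?_
      rw [← h.2 x hxv, ← h.2 y hy, he, ← h.2 w hw1.ne', hw2, Sym2.eq_swap]
  · intro x hx
    rcases Finset.mem_insert.1 hx with rfl | hx
    · exact self_mem_kempeSet _ _
    obtain ⟨w, hw, hxw⟩ := Finset.mem_biUnion.1 hx
    obtain ⟨hw1, hw2⟩ := mem_colorNbrs.1 hw
    have hwt : τ w = c := by rw [← h.2 w hw1.ne', hw2]
    refine kempeSet_induction (G := G) (φ := τ) (u := w) (c := σ v)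
      (p := fun x => x ∈ kempeSet G σ v c)
      (mem_kempeSet_of_adj (self_mem_kempeSet _ _) hw1 (by rw [hw2])) ?_ x hxw
    intro x y hx hxp ha he
    have hv : v ∉ kempeSet G τ w (σ v) := fun hv => by
      rcases color_eq_or_of_mem_kempeSet hv with h1 | h1
      · exact hct (by rw [h1, hwt])
      · exact h.1 h1.symm
    have hy := mem_kempeSet_of_adj hx ha he
    have hxv : x ≠ v := fun e => hv (e ▸ hx)
    have hyv : y ≠ v := fun e => hv (e ▸ hy)
    exact mem_kempeSet_of_adj hxp ha (by rw [h.2 x hxv, h.2 y hyv, he, hwt, Sym2.eq_swap])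

/-- In `τ` the vertex `v` has color `τ v`, which is neither `c` nor `σ v`. -/
theorem notMem_kempeSet_of_ne (h : DiffAt σ τ v) {c : Fin k} (hct : c ≠ τ v)
    {w : V} (hw : w ∈ colorNbrs G σ v c) : v ∉ kempeSet G τ w (σ v) := by
  obtain ⟨hw1, hw2⟩ := mem_colorNbrs.1 hw
  intro hv
  rcases color_eq_or_of_mem_kempeSet hv with h1 | h1
  · exact hct (by rw [h1, ← h.2 w hw1.ne', hw2])
  · exact h.1 h1.symm

theorem kempe_eq_iff_mem_of_color {w x : V} {d : Fin k} (hx : φ x = φ w) :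
    kempe G φ x d = kempe G φ w d ↔ x ∈ kempeSet G φ w d := by
  rw [kempe_eq_iff, hx]; simp

/-- A sum over the vertices of one color, weighted through the entries of a configuration, is a
sum over the distinct components. -/
theorem sum_entry (f : ℕ → ℝ) (hf : f 0 = 0) {W : Finset V} {d c : Fin k}
    (hW : ∀ w ∈ W, φ w = c) {w : V} (hw : w ∈ W) :
    ∑ x ∈ W.filter (fun x => kempe G φ x d = kempe G φ w d), f (entry G φ d W x)
      = f (kempeSet G φ w d).card := by
  classical
  set A := W.filter (fun x => kempe G φ x d = kempe G φ w d) with hA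
  have hAne : A.Nonempty := ⟨w, by simp [hA, hw]⟩
  -- Only the first vertex of the component inside `W` has a nonzero entry.
  set m := A.min' hAne with hm
  have hmA : m ∈ A := A.min'_mem hAne
  have hmW : m ∈ W ∧ kempe G φ m d = kempe G φ w d := by simpa [hA] using hmA
  rw [Finset.sum_eq_single_of_mem m hmA]
  · have : entry G φ d W m = (kempeSet G φ w d).card := by
      unfold entry
      rw [if_neg]
      · exact congrArg (fun K : Comp V k => K.2.card) hmW.2
      · rintro ⟨w', hw', hlt, hmem⟩
        rw [← kempe_eq_iff_mem_of_color (by rw [hW _ hw', hW _ hmW.1]), hmW.2] at hmem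
        have : w' ∈ A := by simp [hA, hw', hmem]
        exact absurd (A.min'_le w' this) (not_le.2 hlt)
    rw [this]
  · intro x hx hxm
    have hxW : x ∈ W ∧ kempe G φ x d = kempe G φ w d := by simpa [hA] using hx
    have hlt : m < x := lt_of_le_of_ne (A.min'_le x hx) (Ne.symm hxm)
    have : entry G φ d W x = 0 := by
      unfold entry
      rw [if_pos]
      refine ⟨m, hmW.1, hlt, ?_⟩
      rw [← kempe_eq_iff_mem_of_color (by rw [hW _ hmW.1, hW _ hxW.1]), hmW.2, hxW.2]
    rw [this, hf]

theorem entry_eq_zero_or (W : Finset V) (d : Fin k) (w : V) :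
    entry G φ d W w = 0 ∨ entry G φ d W w = (kempeSet G φ w d).card := by
  unfold entry; split_ifs <;> simp

/-- Distinct components for one pair of colors are disjoint, and the entries count each of them
once, at its first vertex. -/
theorem card_biUnion_kempeSet {W : Finset V} {d c : Fin k} (hW : ∀ w ∈ W, φ w = c) :
    (W.biUnion fun w => kempeSet G φ w d).card = ∑ w ∈ W, entry G φ d W w := by
  classical
  have himg : (W.biUnion fun w => kempeSet G φ w d)
      = (W.image fun w => kempe G φ w d).biUnion Prod.snd := by
    ext x; simp
  rw [himg, Finset.card_biUnion]
  · rw [← Finset.sum_fiberwise_of_maps_to (s := W) (t := W.image fun w => kempe G φ w d)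
      (g := fun w => kempe G φ w d) (fun w hw => Finset.mem_image_of_mem _ hw)]
    refine Finset.sum_congr rfl fun K hK => ?_
    obtain ⟨w, hw, rfl⟩ := Finset.mem_image.1 hK
    have := sum_entry (G := G) (fun n => (n : ℝ)) (by simp) hW (d := d) hw
    rw [kempe_snd]
    exact_mod_cast this.symm
  · intro K hK L hL hKL
    obtain ⟨x, hx, rfl⟩ := Finset.mem_image.1 hK
    obtain ⟨y, hy, rfl⟩ := Finset.mem_image.1 hL
    refine Finset.disjoint_left.2 fun z hz1 hz2 => hKL ?_
    rw [kempe_snd] at hz1 hz2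
    obtain ⟨e, he⟩ := exists_pair_of_mem_kempeSet hz1
    rw [← kempe_eq_of_mem hz1 he]
    exact kempe_eq_of_mem hz2 (by rw [he, hW x hx, hW y hy])

theorem card_kempeSet_eq (h : DiffAt σ τ v) {c : Fin k} (hcs : c ≠ σ v) (hct : c ≠ τ v) :
    (kempeSet G σ v c).card = 1 + ∑ w ∈ colorNbrs G σ v c, aEntry G σ τ v c w := by
  rw [kempeSet_eq_insert h hcs hct, Finset.card_insert_of_notMem, card_biUnion_kempeSet (c := c),
    add_comm]
  · rfl
  · intro w hw
    obtain ⟨hw1, hw2⟩ := mem_colorNbrs.1 hw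
    rw [← h.2 w hw1.ne', hw2]
  · simp only [Finset.mem_biUnion, not_exists, not_and]
    exact fun w hw => notMem_kempeSet_of_ne h hct hw

/-- Exchanging the chains exchanges the two sides of a configuration. This symmetry lets one-sided
arguments serve both chains. -/
theorem aEntry_swap (h : DiffAt σ τ v) (c : Fin k) : aEntry G τ σ v c = bEntry G σ τ v c := by
  ext w; unfold aEntry bEntry; rw [colorNbrs_eq h]

theorem bEntry_swap (h : DiffAt σ τ v) (c : Fin k) : bEntry G τ σ v c = aEntry G σ τ v c := by
  ext w; unfold aEntry bEntry; rw [colorNbrs_eq h]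

/-- A maximal entry is positive and records the size of its component. -/
theorem argmax_entry {W : Finset V} {d : Fin k} {j : V}
    (hj : IsArgmax W (entry G φ d W) j) :
    entry G φ d W j = (kempeSet G φ j d).card := by
  rcases entry_eq_zero_or (G := G) (φ := φ) W d j with h0 | h0
  · exfalso
    have hne : W.Nonempty := ⟨j, hj.1⟩
    have hm := W.min'_mem hne
    have h1 := hj.2 _ hm
    rw [h0] at h1
    have h2 : entry G φ d W (W.min' hne) = (kempeSet G φ (W.min' hne) d).card := by
      unfold entry
      rw [if_neg]
      rintro ⟨w', hw', hlt, -⟩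
      exact absurd (W.min'_le w' hw') (not_le.2 hlt)
    have := one_le_card_kempeSet (G := G) (φ := φ) (W.min' hne) d
    omega
  · exact h0

end Affected

/-! ### Numerical properties of the flip parameters -/

section PStar

theorem pStar_zero : pStar 0 = 0 := rfl
theorem pStar_of_seven_le {n : ℕ} (h : 7 ≤ n) : pStar n = 0 := by
  obtain ⟨m, rfl⟩ := Nat.exists_eq_add_of_le' h
  rfl

/-- Statements about flip parameters need only be checked for sizes up to `7`. -/
theorem pStar_cases {P : ℕ → ℝ → Prop} (h0 : P 0 0) (h1 : P 1 1) (h2 : P 2 (185 / 616))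
    (h3 : P 3 (1 / 6)) (h4 : P 4 (47 / 462)) (h5 : P 5 (9 / 154)) (h6 : P 6 (2 / 77))
    (h7 : ∀ n, 7 ≤ n → P n 0) (n : ℕ) : P n (pStar n) := by
  rcases Nat.lt_or_ge n 7 with h | h
  · interval_cases n <;> assumption
  · rw [pStar_of_seven_le h]; exact h7 n h

theorem pStar_nonneg (n : ℕ) : 0 ≤ pStar n :=
  pStar_cases (P := fun _ x => 0 ≤ x) (by norm_num) (by norm_num) (by norm_num) (by norm_num)
    (by norm_num) (by norm_num) (by norm_num) (fun _ _ => le_rfl) n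

theorem pStar_le_one (n : ℕ) : pStar n ≤ 1 :=
  pStar_cases (P := fun _ x => x ≤ 1) (by norm_num) (by norm_num) (by norm_num) (by norm_num)
    (by norm_num) (by norm_num) (by norm_num) (fun _ _ => by norm_num) n

theorem mul_pStar_le_one (n : ℕ) : n * pStar n ≤ 1 :=
  pStar_cases (P := fun m x => m * x ≤ 1) (by norm_num) (by norm_num) (by norm_num) (by norm_num)
    (by norm_num) (by norm_num) (by norm_num) (fun _ _ => by norm_num) n

theorem pStar_le_of_two_le {n : ℕ} (h : 2 ≤ n) : pStar n ≤ 185 / 616 :=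
  pStar_cases (P := fun m x => 2 ≤ m → x ≤ 185 / 616) (by norm_num) (by norm_num) (by norm_num)
    (by norm_num) (by norm_num) (by norm_num) (by norm_num) (fun _ _ _ => by norm_num) n h

theorem pStar_succ_le {n : ℕ} (h : 1 ≤ n) : pStar (n + 1) ≤ pStar n := by
  rcases Nat.lt_or_ge n 7 with h7 | h7
  · interval_cases n <;> norm_num [pStar]
  · rw [pStar_of_seven_le h7, pStar_of_seven_le (by omega)]

theorem pStar_anti {m n : ℕ} (hm : 1 ≤ m) (h : m ≤ n) : pStar n ≤ pStar m := by
  induction n, h using Nat.le_induction with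
  | base => exact le_rfl
  | succ n hn ih => exact (pStar_succ_le (hm.trans hn)).trans ih

theorem pStar_div_le {n : ℕ} : pStar n / n ≤ 1 := by
  rcases Nat.eq_zero_or_pos n with rfl | h
  · simp
  · have : (1 : ℝ) ≤ n := by exact_mod_cast h
    rw [div_le_one (by linarith)]
    exact (pStar_le_one n).trans this

theorem pStar_div_le_of_two_le {n : ℕ} (h : 2 ≤ n) : pStar n / n ≤ 185 / 1232 := by
  have h1 : (2 : ℝ) ≤ n := by exact_mod_cast h
  rw [div_le_iff₀ (by linarith)]
  have := pStar_le_of_two_le h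
  nlinarith

end PStar

/-! ### The prescribed masses of the coupling -/

section Masses

variable {V : Type*} [Fintype V] [LinearOrder V] {k : ℕ} {G : SimpleGraph V}
  {φ σ τ : V → Fin k} {v : V} {ia ib : Fin k → V}

theorem none_mem_moves : (none : Option (Comp V k)) ∈ moves G φ := by simp [moves]
theorem some_mem_moves {K : Comp V k} : some K ∈ moves G φ ↔ K ∈ comps G φ := by simp [moves]
theorem some_kempe_mem_moves (u : V) (c : Fin k) : some (kempe G φ u c) ∈ moves G φ :=
  some_mem_moves.2 (kempe_mem_comps u c)

theorem sum_sum_comm {α β ι : Type*} (A : Finset α) (B : Finset β) (s : Finset ι)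
    (f : α → β → ι → ℝ) :
    ∑ X ∈ A, ∑ Y ∈ B, ∑ w ∈ s, f X Y w = ∑ w ∈ s, ∑ X ∈ A, ∑ Y ∈ B, f X Y w := by
  rw [Finset.sum_congr rfl fun X _ => Finset.sum_comm, Finset.sum_comm]

theorem sum_sum_mul_eq_single {α β : Type*} {A : Finset α} {B : Finset β} {x : α} {y : β}
    (hx : x ∈ A) (hy : y ∈ B) {f : α → β → ℝ} (hf : ∀ X Y, ¬ (X = x ∧ Y = y) → f X Y = 0)
    (F : α → β → ℝ) : ∑ X ∈ A, ∑ Y ∈ B, f X Y * F X Y = f x y * F x y := by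
  rw [Finset.sum_eq_single_of_mem x hx, Finset.sum_eq_single_of_mem y hy]
  · intro b _ hb; rw [hf x b fun h => hb h.2, zero_mul]
  · intro a _ ha; exact Finset.sum_eq_zero fun b _ => by rw [hf a b fun h => ha h.1, zero_mul]

theorem sum_sum_ite_mul {α β : Type*} {A : Finset α} {B : Finset β} {x : α} {y : β} (hx : x ∈ A)
    (hy : y ∈ B) (m : ℝ) (D : ∀ X Y, Decidable (X = x ∧ Y = y)) (F : α → β → ℝ) :
    ∑ X ∈ A, ∑ Y ∈ B, (@ite _ _ (D X Y) m 0) * F X Y = m * F x y := by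
  rw [sum_sum_mul_eq_single hx hy (fun X Y h => if_neg h), if_pos ⟨rfl, rfl⟩]

/-- The number `q_i` of a color. -/
noncomputable def qa (G : SimpleGraph V) (σ τ : V → Fin k) (v : V) (c : Fin k) (ia w : V) : ℝ :=
  qWeight pStar (colorNbrs G σ v c) (aEntry G σ τ v c) ia w

/-- The number `q'_i` of a color. -/
noncomputable def qb (G : SimpleGraph V) (σ τ : V → Fin k) (v : V) (c : Fin k) (ib w : V) : ℝ :=
  qWeight pStar (colorNbrs G σ v c) (bEntry G σ τ v c) ib w

/-- The size of `S_σ(v, c)`. -/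
noncomputable def aTotal (G : SimpleGraph V) (σ τ : V → Fin k) (v : V) (c : Fin k) : ℕ :=
  1 + ∑ w ∈ colorNbrs G σ v c, aEntry G σ τ v c w

/-- The size of `S_τ(v, c)`. -/
noncomputable def bTotal (G : SimpleGraph V) (σ τ : V → Fin k) (v : V) (c : Fin k) : ℕ :=
  1 + ∑ w ∈ colorNbrs G σ v c, bEntry G σ τ v c w

theorem sum_colorMass_mul_of_empty {c : Fin k} (hW : colorNbrs G σ v c = ∅) (ia ib : V)
    (F : Option (Comp V k) → Option (Comp V k) → ℝ) :
    ∑ X ∈ moves G σ, ∑ Y ∈ moves G τ, colorMass G pStar σ τ v c ia ib X Y * F X Y =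
      F (some (kempe G σ v c)) (some (kempe G τ v c)) := by
  classical
  rw [← one_mul (F _ _), ← sum_sum_ite_mul (some_kempe_mem_moves v c) (some_kempe_mem_moves v c) 1
    (fun _ _ => inferInstance) F]
  refine Finset.sum_congr rfl fun X _ => Finset.sum_congr rfl fun Y _ => ?_
  unfold colorMass
  simp only
  rw [if_pos hW]
  congr

/-- The value of the masses of one color on a function of the pair of moves. -/
theorem sum_colorMass_mul {c : Fin k} (hW : colorNbrs G σ v c ≠ ∅) (ia ib : V)
    (F : Option (Comp V k) → Option (Comp V k) → ℝ) :
    ∑ X ∈ moves G σ, ∑ Y ∈ moves G τ, colorMass G pStar σ τ v c ia ib X Y * F X Y =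
      pStar (aTotal G σ τ v c) * F (some (kempe G σ v c)) (some (kempe G τ ia (σ v)))
      + pStar (bTotal G σ τ v c) * F (some (kempe G σ ib (τ v))) (some (kempe G τ v c))
      + ∑ w ∈ colorNbrs G σ v c,
        (min (qa G σ τ v c ia w) (qb G σ τ v c ib w) *
            F (some (kempe G σ w (τ v))) (some (kempe G τ w (σ v)))
        + (qa G σ τ v c ia w - min (qa G σ τ v c ia w) (qb G σ τ v c ib w)) *
            F none (some (kempe G τ w (σ v)))
        + (qb G σ τ v c ib w - min (qa G σ τ v c ia w) (qb G σ τ v c ib w)) *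
            F (some (kempe G σ w (τ v))) none) := by
  classical
  have : ∀ X Y, colorMass G pStar σ τ v c ia ib X Y * F X Y =
      (if X = some (kempe G σ v c) ∧ Y = some (kempe G τ ia (σ v)) then
        pStar (aTotal G σ τ v c) else 0) * F X Y
      + (if X = some (kempe G σ ib (τ v)) ∧ Y = some (kempe G τ v c) then
        pStar (bTotal G σ τ v c) else 0) * F X Y
      + ∑ w ∈ colorNbrs G σ v c,
        ((if X = some (kempe G σ w (τ v)) ∧ Y = some (kempe G τ w (σ v)) then
          min (qa G σ τ v c ia w) (qb G σ τ v c ib w) else 0) * F X Y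
      + (if X = none ∧ Y = some (kempe G τ w (σ v)) then
          qa G σ τ v c ia w - min (qa G σ τ v c ia w) (qb G σ τ v c ib w) else 0) * F X Y
      + (if X = some (kempe G σ w (τ v)) ∧ Y = none then
          qb G σ τ v c ib w - min (qa G σ τ v c ia w) (qb G σ τ v c ib w) else 0) * F X Y) := by
    intro X Y
    simp only [← add_mul, ← Finset.sum_mul]
    congr 1
    unfold colorMass
    simp only
    rw [if_neg hW]
    simp only [qa, qb, aTotal, bTotal]
  simp_rw [this, Finset.sum_add_distrib]
  rw [sum_sum_comm (moves G σ) (moves G τ), sum_sum_comm (moves G σ) (moves G τ),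
    sum_sum_comm (moves G σ) (moves G τ)]
  have hss : ∀ u d u' d', ∀ m : ℝ, ∑ X ∈ moves G σ, ∑ Y ∈ moves G τ,
      (if X = some (kempe G σ u d) ∧ Y = some (kempe G τ u' d') then m else 0) * F X Y
        = m * F (some (kempe G σ u d)) (some (kempe G τ u' d')) := fun u d u' d' m =>
    sum_sum_ite_mul (some_kempe_mem_moves u d) (some_kempe_mem_moves u' d') m _ F
  simp only [hss,
    sum_sum_ite_mul none_mem_moves (some_kempe_mem_moves _ _),
    sum_sum_ite_mul (some_kempe_mem_moves _ _) none_mem_moves]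

/-- The chosen indices are admissible. -/
def Admissible (G : SimpleGraph V) (σ τ : V → Fin k) (v : V) (ia ib : Fin k → V) : Prop :=
  ∀ c, c ≠ σ v → c ≠ τ v → (colorNbrs G σ v c).Nonempty →
    IsArgmax (colorNbrs G σ v c) (aEntry G σ τ v c) (ia c) ∧
      IsArgmax (colorNbrs G σ v c) (bEntry G σ τ v c) (ib c)

theorem Admissible.swap (h : DiffAt σ τ v) (hi : Admissible G σ τ v ia ib) :
    Admissible G τ σ v ib ia := by
  intro c h1 h2 h3
  rw [aEntry_swap h, bEntry_swap h]
  rw [colorNbrs_eq h] at h3 ⊢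
  exact (hi c h2 h1 h3).symm

theorem qa_swap (h : DiffAt σ τ v) (c : Fin k) (i w : V) :
    qa G τ σ v c i w = qb G σ τ v c i w := by
  unfold qa qb; rw [aEntry_swap h, colorNbrs_eq h]

theorem colorMass_swap (h : DiffAt σ τ v) (c : Fin k) (ia ib : V) (X Y : Option (Comp V k)) :
    colorMass G pStar τ σ v c ib ia Y X = colorMass G pStar σ τ v c ia ib X Y := by
  classical
  unfold colorMass
  simp only
  rw [aEntry_swap h, bEntry_swap h, colorNbrs_eq h]
  by_cases hW : colorNbrs G σ v c = ∅
  · rw [if_pos hW, if_pos hW]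
    simp only [and_comm]
  · rw [if_neg hW, if_neg hW]
    congr 1
    · rw [add_comm]
      simp only [and_comm]
    · refine Finset.sum_congr rfl fun w _ => ?_
      rw [add_right_comm]
      congr 1
      · congr 1
        · rw [min_comm]; simp only [and_comm]
        · rw [min_comm]; simp only [and_comm]
      · rw [min_comm]; simp only [and_comm]

theorem regularMass_swap (h : DiffAt σ τ v) (X Y : Option (Comp V k)) :
    regularMass G pStar τ σ v ib ia Y X = regularMass G pStar σ τ v ia ib X Y := by
  classical
  unfold regularMass
  rw [unaffected_eq h]
  congr 1
  · rw [Finset.filter_congr (fun c _ => and_comm)]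
    exact Finset.sum_congr rfl fun c _ => colorMass_swap h c _ _ X Y
  · exact Finset.sum_congr rfl fun S _ => by simp only [and_comm]

/-- Written with an indicator, the reduction at `i` becomes a single term in sums over the
neighbors. -/
theorem qa_eq (c : Fin k) (i w : V) :
    qa G σ τ v c i w = pStar (aEntry G σ τ v c w) -
      if w = i then pStar (aTotal G σ τ v c) else 0 := by
  unfold qa qWeight aTotal
  split_ifs with h
  · rw [h]
  · simp

theorem qb_eq (c : Fin k) (i w : V) :
    qb G σ τ v c i w = pStar (bEntry G σ τ v c w) -
      if w = i then pStar (bTotal G σ τ v c) else 0 := by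
  unfold qb qWeight bTotal
  split_ifs with h
  · rw [h]
  · simp

theorem qa_le (c : Fin k) (i w : V) : qa G σ τ v c i w ≤ pStar (aEntry G σ τ v c w) := by
  rw [qa_eq]
  split_ifs
  · linarith [pStar_nonneg (aTotal G σ τ v c)]
  · simp

theorem argmax_aEntry {c : Fin k} {j : V}
    (hj : IsArgmax (colorNbrs G σ v c) (aEntry G σ τ v c) j) :
    aEntry G σ τ v c j = (kempeSet G τ j (σ v)).card := argmax_entry hj

/-- The maximal entry is a positive size not exceeding the total, and the parameters are
nonincreasing from size `1` on. -/
theorem qa_nonneg {c : Fin k} {i : V}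
    (hi : IsArgmax (colorNbrs G σ v c) (aEntry G σ τ v c) i) (w : V) :
    0 ≤ qa G σ τ v c i w := by
  rw [qa_eq]
  split_ifs with h
  · subst h
    have h1 := one_le_card_kempeSet (G := G) (φ := τ) w (σ v)
    rw [← argmax_aEntry hi] at h1
    have h2 : aEntry G σ τ v c w ≤ aTotal G σ τ v c :=
      (Finset.single_le_sum (f := aEntry G σ τ v c) (fun _ _ => Nat.zero_le _) hi.1).trans
        (Nat.le_add_left _ _)
    linarith [pStar_anti h1 h2]
  · simpa using pStar_nonneg _

theorem qb_nonneg (h : DiffAt σ τ v) {c : Fin k} {i : V}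
    (hi : IsArgmax (colorNbrs G σ v c) (bEntry G σ τ v c) i) (w : V) :
    0 ≤ qb G σ τ v c i w := by
  rw [← qa_swap h]
  apply qa_nonneg
  rwa [aEntry_swap h, colorNbrs_eq h]

theorem colorMass_nonneg (h : DiffAt σ τ v) (hi : Admissible G σ τ v ia ib) {c : Fin k}
    (hcs : c ≠ σ v) (hct : c ≠ τ v) (X Y : Option (Comp V k)) :
    0 ≤ colorMass G pStar σ τ v c (ia c) (ib c) X Y := by
  classical
  unfold colorMass
  simp only
  by_cases hW : colorNbrs G σ v c = ∅
  · rw [if_pos hW]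
    split_ifs
    · exact pStar_nonneg _
    · exact le_rfl
  · rw [if_neg hW]
    obtain ⟨h1, h2⟩ := hi c hcs hct (Finset.nonempty_iff_ne_empty.2 hW)
    refine add_nonneg (add_nonneg ?_ ?_) (Finset.sum_nonneg fun w _ =>
      add_nonneg (add_nonneg ?_ ?_) ?_)
    · split_ifs; exacts [pStar_nonneg _, le_rfl]
    · split_ifs; exacts [pStar_nonneg _, le_rfl]
    · split_ifs; exacts [le_min (qa_nonneg h1 w) (qb_nonneg h h2 w), le_rfl]
    · split_ifs; exacts [sub_nonneg.2 (min_le_left _ _), le_rfl]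
    · split_ifs; exacts [sub_nonneg.2 (min_le_right _ _), le_rfl]

theorem regularMass_nonneg (h : DiffAt σ τ v) (hi : Admissible G σ τ v ia ib)
    (X Y : Option (Comp V k)) : 0 ≤ regularMass G pStar σ τ v ia ib X Y := by
  classical
  unfold regularMass
  refine add_nonneg (Finset.sum_nonneg fun c hc => ?_) (Finset.sum_nonneg fun S _ => ?_)
  · simp only [Finset.mem_filter, Finset.mem_univ, true_and] at hc
    exact colorMass_nonneg h hi hc.1 hc.2 X Y
  · split_ifs; exacts [pStar_nonneg _, le_rfl]

/-- The colors other than those of `v`. -/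
def otherColors (σ τ : V → Fin k) (v : V) : Finset (Fin k) :=
  Finset.univ.filter fun c => c ≠ σ v ∧ c ≠ τ v

theorem mem_otherColors {c : Fin k} : c ∈ otherColors σ τ v ↔ c ≠ σ v ∧ c ≠ τ v := by
  simp [otherColors]

/-- The value of the prescribed masses on a function of the pair of moves. -/
theorem sum_regularMass_mul (h : DiffAt σ τ v) (F : Option (Comp V k) → Option (Comp V k) → ℝ) :
    ∑ X ∈ moves G σ, ∑ Y ∈ moves G τ, regularMass G pStar σ τ v ia ib X Y * F X Y =
      ∑ c ∈ otherColors σ τ v,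
        ∑ X ∈ moves G σ, ∑ Y ∈ moves G τ, colorMass G pStar σ τ v c (ia c) (ib c) X Y * F X Y
      + ∑ S ∈ comps G σ \ affected G σ v (τ v), pStar S.2.card * F (some S) (some S) := by
  classical
  unfold regularMass
  simp_rw [add_mul, Finset.sum_mul, Finset.sum_add_distrib]
  rw [sum_sum_comm (moves G σ) (moves G τ), sum_sum_comm (moves G σ) (moves G τ)]
  congr 1
  refine Finset.sum_congr rfl fun S hS => ?_
  have h1 : some S ∈ moves G σ := some_mem_moves.2 (Finset.mem_sdiff.1 hS).1
  have h2 : some S ∈ moves G τ := some_mem_moves.2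
    (Finset.mem_sdiff.1 (mem_comps_of_notMem_affected h (by convert hS))).1
  rw [← sum_sum_ite_mul h1 h2 _ (fun _ _ => inferInstance)]

end Masses

/-! ### Existence of the coupling -/

section Existence

variable {V : Type*} [Fintype V] [LinearOrder V] {k : ℕ} {G : SimpleGraph V}
  {φ σ τ : V → Fin k} {v : V} {ia ib : Fin k → V}

theorem affectedBy_fst {d c : Fin k} {K : Comp V k} (hK : K ∈ affectedBy G φ v d c) :
    K.1 = s(φ v, c) ∨ K.1 = s(c, d) := by
  rcases mem_affectedBy.1 hK with rfl | ⟨w, _, rfl, rfl⟩ <;> simp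

/-- The color pair of a member of `𝒜(c)` is `{φ v, c}` or `{c, d}`, so `c` can be read off from it
when it differs from `φ v` and `d`. -/
theorem affectedBy_unique {d c c' : Fin k} (h1 : c ≠ φ v) (h2 : c ≠ d) {K : Comp V k}
    (hK : K ∈ affectedBy G φ v d c) (hK' : K ∈ affectedBy G φ v d c') : c = c' := by
  have hc : c ∈ K.1 := by rcases affectedBy_fst hK with h | h <;> simp [h]
  rcases affectedBy_fst hK' with h | h <;> rw [h] at hc <;> simp [h1, h2] at hc <;> exact hc

/-- The total mass of the pairs with first member `K` on account of one color. -/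
theorem rowSum_colorMass_some (h : DiffAt σ τ v) (hi : Admissible G σ τ v ia ib) {c : Fin k}
    (hcs : c ≠ σ v) (hct : c ≠ τ v) (K : Comp V k) [Decidable (K ∈ affectedBy G σ v (τ v) c)] :
    (∑ X ∈ moves G σ, ∑ Y ∈ moves G τ, colorMass G pStar σ τ v c (ia c) (ib c) X Y *
      (if X = some K then 1 else 0)) =
      if K ∈ affectedBy G σ v (τ v) c then pStar K.2.card else 0 := by
  classical
  have hfst : ∀ w ∈ colorNbrs G σ v c, kempe G σ v c ≠ kempe G σ w (τ v) := by
    intro w hw he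
    have := congrArg Prod.fst he
    rw [kempe_fst, kempe_fst, (mem_colorNbrs.1 hw).2, Sym2.eq_swap, Sym2.congr_right] at this
    exact h.1 this
  by_cases hW : colorNbrs G σ v c = ∅
  · rw [sum_colorMass_mul_of_empty hW]
    have hcard : (kempeSet G σ v c).card = 1 := by rw [card_kempeSet_eq h hcs hct, hW]; simp
    have hmem : K ∈ affectedBy G σ v (τ v) c ↔ K = kempe G σ v c := by
      simp [affectedBy, hW]
    simp only [hmem, Option.some.injEq]
    by_cases hK : K = kempe G σ v c
    · subst hK; simp [hcard, pStar]
    · simp [hK, Ne.symm hK]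
  · rw [sum_colorMass_mul hW]
    obtain ⟨h1, h2⟩ := hi c hcs hct (Finset.nonempty_iff_ne_empty.2 hW)
    -- The mass `p_b` withdrawn at the index `i_b` is returned by the pair with `S_τ(v, c)`; what is
    -- left counts every component once.
    have hsum : ∑ w ∈ colorNbrs G σ v c, qb G σ τ v c (ib c) w *
        (if kempe G σ w (τ v) = K then (1 : ℝ) else 0)
        = ∑ w ∈ (colorNbrs G σ v c).filter (fun w => kempe G σ w (τ v) = K),
            pStar (bEntry G σ τ v c w)
          - pStar (bTotal G σ τ v c) * (if kempe G σ (ib c) (τ v) = K then (1 : ℝ) else 0) := by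
      simp_rw [qb_eq, sub_mul, Finset.sum_sub_distrib, Finset.sum_filter, ite_mul, zero_mul,
        mul_ite, mul_one, mul_zero]
      congr 1
      rw [Finset.sum_ite_eq', if_pos h2.1]
    have hrest : ∑ w ∈ colorNbrs G σ v c,
        (min (qa G σ τ v c (ia c) w) (qb G σ τ v c (ib c) w) *
            (if some (kempe G σ w (τ v)) = some K then (1 : ℝ) else 0)
        + (qa G σ τ v c (ia c) w - min (qa G σ τ v c (ia c) w) (qb G σ τ v c (ib c) w)) *
            (if (none : Option (Comp V k)) = some K then 1 else 0)
        + (qb G σ τ v c (ib c) w - min (qa G σ τ v c (ia c) w) (qb G σ τ v c (ib c) w)) *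
            (if some (kempe G σ w (τ v)) = some K then 1 else 0))
        = ∑ w ∈ colorNbrs G σ v c, qb G σ τ v c (ib c) w *
        (if kempe G σ w (τ v) = K then (1 : ℝ) else 0) := by
      refine Finset.sum_congr rfl fun w _ => ?_
      simp only [Option.some.injEq, reduceCtorEq, if_false]
      ring
    rw [hrest, hsum]
    simp only [Option.some.injEq]
    by_cases hK : K ∈ affectedBy G σ v (τ v) c
    · rw [if_pos hK]
      rcases mem_affectedBy.1 hK with rfl | ⟨w, hw1, hw2, rfl⟩
      · rw [Finset.filter_false_of_mem fun w hw => (hfst w hw).symm]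
        simp [(hfst _ h2.1).symm, aTotal, card_kempeSet_eq h hcs hct]
      · have hw := mem_colorNbrs.2 ⟨hw1, hw2⟩
        have := sum_entry (G := G) pStar pStar_zero
          (fun w hw => (mem_colorNbrs.1 hw).2) (d := τ v) hw
        simp only [bEntry]
        rw [this]
        simp [hfst _ hw]
    · rw [if_neg hK]
      have hn1 : kempe G σ v c ≠ K := fun e => hK (mem_affectedBy.2 (Or.inl e.symm))
      have hn2 : ∀ w ∈ colorNbrs G σ v c, kempe G σ w (τ v) ≠ K := fun w hw e =>
        hK (mem_affectedBy.2 (Or.inr ⟨w, (mem_colorNbrs.1 hw).1, (mem_colorNbrs.1 hw).2, e⟩))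
      rw [Finset.filter_false_of_mem hn2]
      simp [hn1, hn2 _ h2.1]

/-- Marginals become sums against an indicator, to which the formulas for test functions apply. -/
theorem rowSum_eq (X₀ : Option (Comp V k)) (hX : X₀ ∈ moves G σ)
    (M : Option (Comp V k) → Option (Comp V k) → ℝ) :
    ∑ Y ∈ moves G τ, M X₀ Y =
      ∑ X ∈ moves G σ, ∑ Y ∈ moves G τ, M X Y * (if X = X₀ then 1 else 0) := by
  classical
  rw [Finset.sum_eq_single_of_mem X₀ hX]
  · simp
  · intro X _ hne; simp [hne]

theorem mem_specialMoves_some {d : Fin k} {K : Comp V k} :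
    some K ∈ specialMoves G φ v d ↔ K ∈ affectedBy G φ v d (φ v) ∨ K ∈ affectedBy G φ v d d := by
  simp [specialMoves]

theorem none_mem_specialMoves {d : Fin k} : none ∈ specialMoves G φ v d := by
  simp [specialMoves]

open Classical in
/-- The prescribed masses already give the correct marginal on every move that is not special, and
give nothing to the special components. -/
theorem rowSum_regularMass_some (h : DiffAt σ τ v) (hi : Admissible G σ τ v ia ib) {K : Comp V k}
    (hK : K ∈ comps G σ) :
    ∑ Y ∈ moves G τ, regularMass G pStar σ τ v ia ib (some K) Y =
      if some K ∈ specialMoves G σ v (τ v) then 0 else pStar K.2.card := by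
  rw [rowSum_eq _ (some_mem_moves.2 hK), sum_regularMass_mul h]
  have h1 : ∑ c ∈ otherColors σ τ v, ∑ X ∈ moves G σ, ∑ Y ∈ moves G τ,
      colorMass G pStar σ τ v c (ia c) (ib c) X Y * (if X = some K then 1 else 0) =
      ∑ c ∈ otherColors σ τ v, if K ∈ affectedBy G σ v (τ v) c then pStar K.2.card else 0 := by
    refine Finset.sum_congr rfl fun c hc => ?_
    rw [mem_otherColors] at hc
    exact rowSum_colorMass_some h hi hc.1 hc.2 K
  rw [h1]
  have h2 : ∑ S ∈ comps G σ \ affected G σ v (τ v), pStar S.2.card *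
      (if some S = some K then 1 else 0) =
      if K ∈ affected G σ v (τ v) then 0 else pStar K.2.card := by
    simp only [Option.some.injEq, mul_ite, mul_one, mul_zero]
    rw [Finset.sum_ite_eq']
    simp only [Finset.mem_sdiff, hK, true_and]
    split_ifs <;> simp_all
  rw [h2]
  simp only [mem_specialMoves_some]
  by_cases hA : K ∈ affected G σ v (τ v)
  · rw [if_pos hA]
    obtain ⟨c₀, -, hc₀⟩ : ∃ c ∈ Finset.univ, K ∈ affectedBy G σ v (τ v) c := by
      simpa [affected] using hA
    by_cases hsp : K ∈ affectedBy G σ v (τ v) (σ v) ∨ K ∈ affectedBy G σ v (τ v) (τ v)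
    · rw [if_pos hsp, Finset.sum_eq_zero, add_zero]
      intro c hc
      rw [mem_otherColors] at hc
      rw [if_neg]
      intro hKc
      rcases hsp with hs | hs
      · exact hc.1 (affectedBy_unique hc.1 hc.2 hKc hs)
      · exact hc.2 (affectedBy_unique hc.1 hc.2 hKc hs)
    · rw [if_neg hsp]
      push Not at hsp
      have hs : c₀ ≠ σ v := fun e => hsp.1 (e ▸ hc₀)
      have ht : c₀ ≠ τ v := fun e => hsp.2 (e ▸ hc₀)
      rw [Finset.sum_eq_single_of_mem c₀ (mem_otherColors.2 ⟨hs, ht⟩), if_pos hc₀, add_zero]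
      intro c hc hne
      exact if_neg fun hKc => hne (affectedBy_unique hs ht hc₀ hKc).symm
  · have hno : ∀ c, K ∉ affectedBy G σ v (τ v) c := fun c hc =>
      hA (affectedBy_subset_affected _ _ hc)
    simp [hA, hno]

/-- Summation over the neighbors of `v` of the colors in a set. -/
theorem sum_colorNbrs [DecidableRel G.Adj] (C : Finset (Fin k)) (t : V → ℝ) :
    ∑ c ∈ C, ∑ w ∈ colorNbrs G φ v c, t w =
      ∑ w ∈ (G.neighborFinset v).filter (fun w => φ w ∈ C), t w := by
  rw [← Finset.sum_fiberwise_of_maps_to (t := C) (g := φ)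
    (fun w hw => (Finset.mem_filter.1 hw).2)]
  refine Finset.sum_congr rfl fun c hc => Finset.sum_congr ?_ fun _ _ => rfl
  ext w
  simp only [mem_colorNbrs, Finset.mem_filter, SimpleGraph.mem_neighborFinset]
  constructor
  · rintro ⟨h1, h2⟩; exact ⟨⟨h1, h2 ▸ hc⟩, h2⟩
  · rintro ⟨⟨h1, _⟩, h2⟩; exact ⟨h1, h2⟩

theorem rowSum_regularMass_none (h : DiffAt σ τ v) :
    ∑ Y ∈ moves G τ, regularMass G pStar σ τ v ia ib none Y =
      ∑ c ∈ otherColors σ τ v, ∑ w ∈ colorNbrs G σ v c,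
        (qa G σ τ v c (ia c) w - min (qa G σ τ v c (ia c) w) (qb G σ τ v c (ib c) w)) := by
  classical
  rw [rowSum_eq _ none_mem_moves, sum_regularMass_mul h]
  simp only [reduceCtorEq, if_false, mul_zero, Finset.sum_const_zero, add_zero]
  refine Finset.sum_congr rfl fun c hc => ?_
  by_cases hW : colorNbrs G σ v c = ∅
  · rw [sum_colorMass_mul_of_empty hW, hW]; simp
  · rw [sum_colorMass_mul hW]; simp

theorem one_sub_div_nonneg (n : ℕ) : 0 ≤ 1 - pStar n / n := sub_nonneg.2 pStar_div_le

/-- The empty move has enough probability for the pairs in which it is prescribed. -/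
theorem rowSum_regularMass_none_le (h : DiffAt σ τ v) (hi : Admissible G σ τ v ia ib) :
    ∑ Y ∈ moves G τ, regularMass G pStar σ τ v ia ib none Y ≤
      k * Fintype.card V * moveProb G pStar σ none := by
  classical
  rw [rowSum_regularMass_none h, kempe_moveProb_none _ (Fintype.card_pos_iff.2 ⟨v⟩)
    (Fin.pos (σ v))]
  have hle : ∀ c ∈ otherColors σ τ v, ∀ w ∈ colorNbrs G σ v c,
      (qa G σ τ v c (ia c) w - min (qa G σ τ v c (ia c) w) (qb G σ τ v c (ib c) w)) ≤
      ∑ d : Fin k, (1 - pStar (kempeSet G σ w d).card / (kempeSet G σ w d).card) := by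
    intro c hc w hw
    rw [mem_otherColors] at hc
    obtain ⟨h1, h2⟩ := hi c hc.1 hc.2 ⟨w, hw⟩
    -- The idle mass of the choices `(w, σ v)` and `(w, τ v)` alone pays for the neighbor `w`.
    have hpair := Finset.sum_le_sum_of_subset_of_nonneg (Finset.subset_univ {σ v, τ v})
      (fun d _ _ => one_sub_div_nonneg (kempeSet G σ w d).card)
    rw [Finset.sum_pair h.1] at hpair
    refine le_trans ?_ hpair
    obtain ⟨hw1, hw2⟩ := mem_colorNbrs.1 hw
    -- In `σ` this component contains both `w` and `v`, so its idle mass is at least `1 - 185/1232`.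
    have hs : 2 ≤ (kempeSet G σ w (σ v)).card := by
      have : ({w, v} : Finset V) ⊆ kempeSet G σ w (σ v) := by
        intro x hx
        rcases Finset.mem_insert.1 hx with rfl | hx
        · exact self_mem_kempeSet _ _
        · rw [Finset.mem_singleton.1 hx]
          exact mem_kempeSet_of_adj (self_mem_kempeSet _ _) hw1.symm rfl
      rw [← Finset.card_pair hw1.ne']
      exact Finset.card_le_card this
    have hs' := pStar_div_le_of_two_le hs
    have hqa0 := qa_nonneg h1 w
    have hqb0 := qb_nonneg h h2 w
    have hqa : qa G σ τ v c (ia c) w ≤ 1 := (qa_le c _ w).trans (pStar_le_one _)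
    -- A singleton `S_σ(w, τ v)` has no idle mass since `p_1 = 1`; but then `q' ≥ 1 - p_2`, and the
    -- excess of `q` over `q'` is at most `p_2`.
    rcases Nat.lt_or_ge (kempeSet G σ w (τ v)).card 2 with hB | hB
    · have hB1 : (kempeSet G σ w (τ v)).card = 1 := by
        have := one_le_card_kempeSet (G := G) (φ := σ) w (τ v); omega
      have hset : kempeSet G σ w (τ v) = {w} := by
        obtain ⟨y, hy⟩ := Finset.card_eq_one.1 hB1
        have := self_mem_kempeSet (G := G) (φ := σ) w (τ v)
        rw [hy] at this ⊢
        rw [Finset.mem_singleton.1 this]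
      have hentry : bEntry G σ τ v c w = 1 := by
        unfold bEntry entry
        rw [if_neg, hB1]
        rintro ⟨w', _, hlt, hm⟩
        rw [hset, Finset.mem_singleton] at hm
        exact absurd hm hlt.ne
      have hqb : 1 - 185 / 616 ≤ qb G σ τ v c (ib c) w := by
        rw [qb_eq, hentry]
        split_ifs with e
        · have h3 : bEntry G σ τ v c w ≤ ∑ x ∈ colorNbrs G σ v c, bEntry G σ τ v c x :=
            Finset.single_le_sum (fun _ _ => Nat.zero_le _) hw
          have : 2 ≤ bTotal G σ τ v c := by unfold bTotal; omega
          have := pStar_le_of_two_le this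
          have hp1 : pStar 1 = 1 := rfl
          linarith
        · norm_num [pStar]
      rw [hB1]
      have hp1 : pStar 1 = 1 := rfl
      rw [hp1]
      rcases le_total (qa G σ τ v c (ia c) w) (qb G σ τ v c (ib c) w) with hm | hm
      · rw [min_eq_left hm]; norm_num; linarith
      · rw [min_eq_right hm]; norm_num; linarith
    · have hB' := pStar_div_le_of_two_le hB
      have := le_min hqa0 hqb0
      linarith
  calc _ ≤ ∑ c ∈ otherColors σ τ v, ∑ w ∈ colorNbrs G σ v c,
        ∑ d : Fin k, (1 - pStar (kempeSet G σ w d).card / (kempeSet G σ w d).card) :=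
        Finset.sum_le_sum fun c hc => Finset.sum_le_sum fun w hw => hle c hc w hw
    _ ≤ _ := by
        rw [sum_colorNbrs]
        exact Finset.sum_le_sum_of_subset_of_nonneg (Finset.subset_univ _) fun w _ _ =>
          Finset.sum_nonneg fun d _ => one_sub_div_nonneg _

/-- What the prescribed masses leave of the law of a move. -/
noncomputable def restMass (G : SimpleGraph V) (σ τ : V → Fin k) (v : V) (ia ib : Fin k → V)
    (X : Option (Comp V k)) : ℝ :=
  moveProb G pStar σ X -
    (∑ Y ∈ moves G τ, regularMass G pStar σ τ v ia ib X Y) / (k * Fintype.card V)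

theorem restMass_nonneg (h : DiffAt σ τ v) (hi : Admissible G σ τ v ia ib)
    {X : Option (Comp V k)} (hX : X ∈ moves G σ) : 0 ≤ restMass G σ τ v ia ib X := by
  classical
  have hn : (0 : ℝ) < k * Fintype.card V := by
    have h1 : 0 < Fintype.card V := Fintype.card_pos_iff.2 ⟨v⟩
    have h2 : 0 < k := Fin.pos (σ v)
    positivity
  unfold restMass
  rw [sub_nonneg, div_le_iff₀ hn]
  cases X with
  | none => rw [mul_comm]; exact rowSum_regularMass_none_le h hi
  | some K =>
    have hK := some_mem_moves.1 hX
    rw [rowSum_regularMass_some h hi hK, moveProb_some _ hK, div_mul_cancel₀ _ hn.ne']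
    split_ifs
    · exact pStar_nonneg _
    · exact le_rfl

theorem restMass_eq_zero (h : DiffAt σ τ v) (hi : Admissible G σ τ v ia ib)
    {X : Option (Comp V k)} (hX : X ∈ moves G σ) (hsp : X ∉ specialMoves G σ v (τ v)) :
    restMass G σ τ v ia ib X = 0 := by
  classical
  cases X with
  | none => exact absurd none_mem_specialMoves hsp
  | some K =>
    have hK := some_mem_moves.1 hX
    unfold restMass
    rw [rowSum_regularMass_some h hi hK, moveProb_some _ hK, if_neg hsp, sub_self]

/-- Both totals equal one minus the whole prescribed mass, divided by `kn`. -/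
theorem sum_restMass_swap (h : DiffAt σ τ v) :
    ∑ Y ∈ moves G τ, restMass G τ σ v ib ia Y = ∑ X ∈ moves G σ, restMass G σ τ v ia ib X := by
  have hn : 0 < Fintype.card V := Fintype.card_pos_iff.2 ⟨v⟩
  have hk : 0 < k := Fin.pos (σ v)
  unfold restMass
  rw [Finset.sum_sub_distrib, Finset.sum_sub_distrib, sum_moveProb _ hn hk, sum_moveProb _ hn hk,
    ← Finset.sum_div, ← Finset.sum_div, Finset.sum_comm]
  simp_rw [regularMass_swap h]

/-- Vigoda's coupling exists. -/
theorem exists_vigodaCoupling (h : DiffAt σ τ v) (hi : Admissible G σ τ v ia ib) :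
    ∃ P, IsVigodaCoupling G pStar σ τ v ia ib P := by
  classical
  have hn : (0 : ℝ) < k * Fintype.card V := by
    have h1 : 0 < Fintype.card V := Fintype.card_pos_iff.2 ⟨v⟩
    have h2 : 0 < k := Fin.pos (σ v)
    positivity
  have hi' := hi.swap h
  set R := ∑ X ∈ moves G σ, restMass G σ τ v ia ib X with hR
  have hR0 : 0 ≤ R := Finset.sum_nonneg fun X hX => restMass_nonneg h hi hX
  have hRτ : ∑ Y ∈ moves G τ, restMass G τ σ v ib ia Y = R := sum_restMass_swap h
  -- The remainders of the two chains have the same total `R`, so their product over `R` has them as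
  -- marginals. If `R = 0` they all vanish, and division by zero gives the right value.
  refine ⟨fun X Y => regularMass G pStar σ τ v ia ib X Y / (k * Fintype.card V) +
    restMass G σ τ v ia ib X * restMass G τ σ v ib ia Y / R, ?_, ?_, ?_, ?_⟩
  · intro X hX Y hY
    exact add_nonneg (div_nonneg (regularMass_nonneg h hi X Y) hn.le)
      (div_nonneg (mul_nonneg (restMass_nonneg h hi hX) (restMass_nonneg h.symm hi' hY)) hR0)
  · intro X hX
    rw [Finset.sum_add_distrib, ← Finset.sum_div, ← Finset.sum_div, ← Finset.mul_sum, hRτ]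
    have : restMass G σ τ v ia ib X * R / R = restMass G σ τ v ia ib X := by
      rcases eq_or_ne R 0 with h0 | h0
      · rw [h0, (Finset.sum_eq_zero_iff_of_nonneg fun X hX => restMass_nonneg h hi hX).1 h0 X hX]
        simp
      · exact mul_div_cancel_right₀ _ h0
    rw [this]
    unfold restMass
    ring
  · intro Y hY
    rw [Finset.sum_add_distrib, ← Finset.sum_div, ← Finset.sum_div, ← Finset.sum_mul, ← hR]
    have : R * restMass G τ σ v ib ia Y / R = restMass G τ σ v ib ia Y := by
      rcases eq_or_ne R 0 with h0 | h0
      · rw [(Finset.sum_eq_zero_iff_of_nonneg fun X hX => restMass_nonneg h.symm hi' hX).1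
          (hRτ.trans h0) Y hY]
        simp
      · exact mul_div_cancel_left₀ _ h0
    rw [this]
    unfold restMass
    simp_rw [regularMass_swap h]
    ring
  · intro X hX Y hY hsp
    have : restMass G σ τ v ia ib X * restMass G τ σ v ib ia Y = 0 := by
      by_cases h1 : X ∈ specialMoves G σ v (τ v)
      · rw [restMass_eq_zero h.symm hi' hY fun h2 => hsp ⟨h1, h2⟩, mul_zero]
      · rw [restMass_eq_zero h hi hX h1, zero_mul]
    rw [this]
    simp

end Existence

/-! ### Extremal neighbors -/

section Extremal

variable {V : Type*} [Fintype V] [LinearOrder V] {k : ℕ} {G : SimpleGraph V}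
  {φ σ τ : V → Fin k} {v : V}

/-- The colors with an extremal configuration. -/
def IsExtremal (G : SimpleGraph V) (σ τ : V → Fin k) (v : V) (c : Fin k) : Prop :=
  c ∈ extremalOne G σ τ v ∨ c ∈ extremalTwo G σ τ v

open Classical in
/-- The neighbors of `v` whose color has an extremal configuration. -/
noncomputable def extNbrs (G : SimpleGraph V) (σ τ : V → Fin k) (v : V) : Finset V :=
  Finset.univ.filter fun w => G.Adj v w ∧ IsExtremal G σ τ v (σ w)

theorem mem_extNbrs {w : V} : w ∈ extNbrs G σ τ v ↔ G.Adj v w ∧ IsExtremal G σ τ v (σ w) := by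
  simp [extNbrs]

theorem length_configuration_fst (c : Fin k) :
    (configuration G σ τ v c).1.length = (colorNbrs G σ v c).card := by
  simp [configuration]

theorem card_colorNbrs_of_extremalOne {c : Fin k} (hc : c ∈ extremalOne G σ τ v) :
    (colorNbrs G σ v c).card = 1 := by
  rw [← length_configuration_fst (τ := τ)]
  simp only [extremalOne, Finset.mem_filter, Finset.mem_univ, true_and] at hc
  rcases hc with h | h <;> rw [h] <;> rfl

theorem card_colorNbrs_of_extremalTwo {c : Fin k} (hc : c ∈ extremalTwo G σ τ v) :
    (colorNbrs G σ v c).card = 2 := by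
  rw [← length_configuration_fst (τ := τ)]
  simp only [extremalTwo, Finset.mem_filter, Finset.mem_univ, true_and] at hc
  rcases hc with h | h <;> rw [h] <;> rfl

/-- A color with an extremal `i`-configuration has exactly `i` neighbors. Thus `β Δ` counts
vertices, whose creation and destruction can be bounded one vertex at a time. -/
theorem card_extNbrs [DecidableRel G.Adj] :
    (extNbrs G σ τ v).card = (extremalOne G σ τ v).card + 2 * (extremalTwo G σ τ v).card := by
  classical
  have hd : Disjoint (extremalOne G σ τ v) (extremalTwo G σ τ v) :=
    Finset.disjoint_left.2 fun c h1 h2 => by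
      have := card_colorNbrs_of_extremalOne h1
      rw [card_colorNbrs_of_extremalTwo h2] at this
      omega
  have h := sum_colorNbrs (G := G) (φ := σ) (v := v)
    (extremalOne G σ τ v ∪ extremalTwo G σ τ v) (fun _ => 1)
  have he : extNbrs G σ τ v = (G.neighborFinset v).filter
      (fun w => σ w ∈ extremalOne G σ τ v ∪ extremalTwo G σ τ v) := by
    ext w; simp [mem_extNbrs, IsExtremal]
  rw [← he] at h
  simp only [Finset.sum_const, nsmul_eq_mul, mul_one] at h
  rw [Finset.sum_union hd, Finset.sum_congr rfl fun c hc => by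
      rw [card_colorNbrs_of_extremalOne hc],
    Finset.sum_congr (s₁ := extremalTwo G σ τ v) rfl fun c hc => by
      rw [card_colorNbrs_of_extremalTwo hc]] at h
  simp only [Finset.sum_const, nsmul_eq_mul] at h
  have h' : (((extNbrs G σ τ v).card : ℕ) : ℝ)
      = (((extremalOne G σ τ v).card + 2 * (extremalTwo G σ τ v).card : ℕ) : ℝ) := by
    push_cast at h ⊢
    linarith
  exact_mod_cast h'

variable [DecidableRel G.Adj]

theorem beta_eq : beta G σ τ v = (extNbrs G σ τ v).card / G.maxDegree := by
  rw [card_extNbrs, beta]; push_cast; rfl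

theorem extNbrs_subset : extNbrs G σ τ v ⊆ G.neighborFinset v := by
  intro w hw; simpa using (mem_extNbrs.1 hw).1

theorem card_extNbrs_le : (extNbrs G σ τ v).card ≤ G.maxDegree :=
  (Finset.card_le_card extNbrs_subset).trans (G.degree_le_maxDegree v)

theorem beta_nonneg : 0 ≤ beta G σ τ v := by rw [beta_eq]; positivity

theorem beta_le_one : beta G σ τ v ≤ 1 := by
  rw [beta_eq]
  exact div_le_one_of_le₀ (by exact_mod_cast card_extNbrs_le) (by positivity)

theorem edgeWeight_eq (h : DiffAt σ τ v) (γ : ℝ) :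
    edgeWeight G γ σ τ = 1 - γ * (1 - beta G σ τ v) := by
  unfold edgeWeight; rw [h.filter_eq]; simp

theorem exists_diffAt (h : (colorGraph V k).Adj σ τ) : ∃ v, DiffAt σ τ v := by
  have h1 : hammingDist σ τ = 1 := h
  by_contra hne
  push Not at hne
  have : σ = τ := by
    funext x
    by_contra hx
    exact hne x (DiffAt.of_hammingDist h1 hx)
  rw [this, hammingDist_self] at h1
  omega

theorem DiffAt.adj (h : DiffAt σ τ v) : (colorGraph V k).Adj σ τ := h.hammingDist_eq

/-! ### The extremal metric on adjacent colorings -/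

section Weights

variable {γ : ℝ}

theorem edgeWeight_bounds (hγ0 : 0 ≤ γ) (h : (colorGraph V k).Adj σ τ) :
    1 - γ ≤ edgeWeight G γ σ τ ∧ edgeWeight G γ σ τ ≤ 1 := by
  obtain ⟨v, hv⟩ := exists_diffAt h
  rw [edgeWeight_eq hv]
  have h0 := beta_nonneg (G := G) (σ := σ) (τ := τ) (v := v)
  have h1 := beta_le_one (G := G) (σ := σ) (τ := τ) (v := v)
  constructor <;> nlinarith

theorem walk_weight_bounds (hγ0 : 0 ≤ γ)
    (p : (colorGraph V k).Walk σ τ) :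
    (1 - γ) * p.length ≤ (p.darts.map fun e => edgeWeight G γ e.fst e.snd).sum ∧
      (p.darts.map fun e => edgeWeight G γ e.fst e.snd).sum ≤ p.length := by
  induction p with
  | nil => simp
  | cons h p ih =>
    have := edgeWeight_bounds (G := G) hγ0 h
    simp only [SimpleGraph.Walk.darts_cons, List.map_cons, List.sum_cons,
      SimpleGraph.Walk.length_cons]
    push_cast
    constructor <;> linarith [ih.1, ih.2]

theorem extDist_bddBelow (hγ0 : 0 ≤ γ) (hγ1 : γ ≤ 1 / 2) :
    BddBelow (Set.range fun P : (colorGraph V k).Path σ τ =>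
    (P.1.darts.map fun e => edgeWeight G γ e.fst e.snd).sum) := by
  refine ⟨0, ?_⟩
  rintro _ ⟨P, rfl⟩
  refine le_trans ?_ (walk_weight_bounds hγ0 P.1).1
  have : 0 ≤ 1 - γ := by linarith
  positivity

/-- The differing vertices are corrected one at a time. -/
theorem exists_walk_length (n : ℕ) : ∀ σ τ : V → Fin k, hammingDist σ τ = n →
    ∃ p : (colorGraph V k).Walk σ τ, p.length = n := by
  induction n with
  | zero =>
    intro σ τ h
    obtain rfl := hammingDist_eq_zero.1 h
    exact ⟨SimpleGraph.Walk.nil, rfl⟩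
  | succ n ih =>
    intro σ τ h
    obtain ⟨x, hx⟩ : ∃ x, σ x ≠ τ x := by
      by_contra hne
      push Not at hne
      rw [funext hne, hammingDist_self] at h
      omega
    have hd : DiffAt σ (Function.update σ x (τ x)) x :=
      ⟨by simpa using hx, fun y hy => by simp [hy]⟩
    have h1 : hammingDist (Function.update σ x (τ x)) τ = n := by
      have : Finset.univ.filter (fun i => Function.update σ x (τ x) i ≠ τ i)
          = (Finset.univ.filter (fun i => σ i ≠ τ i)).erase x := by
        ext i
        simp only [Finset.mem_filter, Finset.mem_univ, true_and, Finset.mem_erase]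
        by_cases hi : i = x
        · subst hi; simp
        · simp [hi]
      unfold hammingDist at h ⊢
      rw [this, Finset.card_erase_of_mem (by simp [hx]), h]
      rfl
    obtain ⟨p, hp⟩ := ih _ _ h1
    exact ⟨SimpleGraph.Walk.cons hd.adj p, by simp [hp]⟩

theorem extDist_le_hammingDist (hγ0 : 0 ≤ γ) (hγ1 : γ ≤ 1 / 2) :
    extDist G γ σ τ ≤ hammingDist σ τ := by
  classical
  obtain ⟨p, hp⟩ := exists_walk_length _ σ τ rfl
  refine (ciInf_le (extDist_bddBelow hγ0 hγ1) p.toPath).trans ?_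
  refine (walk_weight_bounds hγ0 _).2.trans ?_
  rw [← hp]
  exact_mod_cast p.length_bypass_le_length

theorem extDist_le_edgeWeight (hγ0 : 0 ≤ γ) (hγ1 : γ ≤ 1 / 2)
    (h : (colorGraph V k).Adj σ τ) :
    extDist G γ σ τ ≤ edgeWeight G γ σ τ := by
  refine (ciInf_le (extDist_bddBelow hγ0 hγ1) (SimpleGraph.Path.singleton h)).trans ?_
  simp [SimpleGraph.Path.singleton]

/-- A path with two or more edges weighs at least `2 (1 - γ) ≥ 1`, and no edge weighs more than `1`.
-/
theorem extDist_of_diffAt (hγ0 : 0 ≤ γ) (hγ1 : γ ≤ 1 / 2)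
    (h : DiffAt σ τ v) :
    extDist G γ σ τ = 1 - γ * (1 - beta G σ τ v) := by
  rw [← edgeWeight_eq h]
  refine le_antisymm (extDist_le_edgeWeight hγ0 hγ1 h.adj) ?_
  have : Nonempty ((colorGraph V k).Path σ τ) := ⟨SimpleGraph.Path.singleton h.adj⟩
  refine le_ciInf fun P => ?_
  obtain ⟨p, hp⟩ := P
  show edgeWeight G γ σ τ ≤ (p.darts.map fun e => edgeWeight G γ e.fst e.snd).sum
  cases p with
  | nil => exact absurd rfl h.1
  | cons h1 p =>
    cases p with
    | nil => simp
    | cons h2 p =>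
      refine (edgeWeight_bounds hγ0 h.adj).2.trans (le_trans ?_
        (walk_weight_bounds hγ0 _).1)
      simp only [SimpleGraph.Walk.length_cons]
      push_cast
      have : (0 : ℝ) ≤ p.length := by positivity
      nlinarith

end Weights

end Extremal

/-! ### Numerical bounds for configurations -/

section Configurations

variable {V : Type*} [LinearOrder V]

/-- The bound on `∇_H` for a color with entries `a`, `b`. -/
noncomputable def hVal (W : Finset V) (a b : V → ℕ) (ia ib : V) : ℝ :=
  pStar (1 + ∑ w ∈ W, a w) * (∑ w ∈ W, (a w : ℝ) - a ia)
  + pStar (1 + ∑ w ∈ W, b w) * (∑ w ∈ W, (b w : ℝ) - b ib)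
  + ∑ w ∈ W, (a w * qWeight pStar W a ia w + b w * qWeight pStar W b ib w
      - min (qWeight pStar W a ia w) (qWeight pStar W b ib w))

theorem pred_mul_pStar_le (n : ℕ) : (n - 1) * pStar n ≤ 1 / 3 :=
  pStar_cases (P := fun m x => ((m : ℝ) - 1) * x ≤ 1 / 3) (by norm_num) (by norm_num) (by norm_num)
    (by norm_num) (by norm_num) (by norm_num) (by norm_num) (fun _ _ => by norm_num) n

/-- Subtracting the smaller parameter turns its factor `n` into `n - 1`; then `(n - 1) p_n ≤ 1/3`
and `n p_n ≤ 1` apply. -/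
theorem entry_term_le (x y : ℕ) :
    x * pStar x + y * pStar y - min (pStar x) (pStar y) ≤ 4 / 3 := by
  have h1 := pred_mul_pStar_le x
  have h2 := pred_mul_pStar_le y
  have h3 := mul_pStar_le_one x
  have h4 := mul_pStar_le_one y
  rcases le_total (pStar x) (pStar y) with h | h
  · rw [min_eq_left h]; linarith
  · rw [min_eq_right h]; linarith

theorem sub_two_mul_pStar_le (n : ℕ) : (n - 2) * pStar n ≤ 47 / 231 :=
  pStar_cases (P := fun m x => ((m : ℝ) - 2) * x ≤ 47 / 231) (by norm_num) (by norm_num)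
    (by norm_num) (by norm_num) (by norm_num) (by norm_num) (by norm_num)
    (fun _ _ => by norm_num) n

theorem qWeight_eq (W : Finset V) (f : V → ℕ) (j w : V) :
    qWeight pStar W f j w = pStar (f w) -
      if w = j then pStar (1 + ∑ x ∈ W, f x) else 0 := by
  unfold qWeight
  split_ifs with h
  · rw [h]
  · simp

/-- A bound that suffices for colors with at least three neighbors. -/
theorem hVal_le_of_three_le {W : Finset V} {a b : V → ℕ} {ia ib : V} (hia : ia ∈ W) (hib : ib ∈ W)
    (ha : 1 ≤ a ia) (hb : 1 ≤ b ib) (hW : 3 ≤ W.card) :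
    hVal W a b ia ib ≤ -1 + 161 / 88 * W.card := by
  set A := 1 + ∑ w ∈ W, a w with hA
  set B := 1 + ∑ w ∈ W, b w with hB
  have hterm : ∀ w ∈ W, (a w * qWeight pStar W a ia w + b w * qWeight pStar W b ib w
      - min (qWeight pStar W a ia w) (qWeight pStar W b ib w)) ≤
      4 / 3 + (if w = ia then (1 - a ia) * pStar A else 0)
        + (if w = ib then (1 - b ib) * pStar B else 0) := by
    intro w _
    have h0 := entry_term_le (a w) (b w)
    have hpA := pStar_nonneg A
    have hpB := pStar_nonneg B
    rw [qWeight_eq, qWeight_eq, ← hA, ← hB]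
    -- Lowering the two arguments lowers the minimum by at most the sum of the reductions.
    have hmin : min (pStar (a w)) (pStar (b w)) - (if w = ia then pStar A else 0)
        - (if w = ib then pStar B else 0) ≤
        min (pStar (a w) - if w = ia then pStar A else 0)
          (pStar (b w) - if w = ib then pStar B else 0) := by
      have h1 := min_le_left (pStar (a w)) (pStar (b w))
      have h2 := min_le_right (pStar (a w)) (pStar (b w))
      apply le_min <;> split_ifs <;> linarith
    have e1 : (a w : ℝ) * (if w = ia then pStar A else 0) =
        if w = ia then a ia * pStar A else 0 := by split_ifs with h <;> simp [h]
    have e2 : (b w : ℝ) * (if w = ib then pStar B else 0) =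
        if w = ib then b ib * pStar B else 0 := by split_ifs with h <;> simp [h]
    rw [mul_sub, mul_sub, e1, e2]
    split_ifs at hmin ⊢ <;> linarith
  have hsum := Finset.sum_le_sum hterm
  rw [Finset.sum_add_distrib, Finset.sum_add_distrib, Finset.sum_ite_eq', Finset.sum_ite_eq',
    if_pos hia, if_pos hib, Finset.sum_const, nsmul_eq_mul] at hsum
  unfold hVal
  rw [← hA, ← hB]
  have hAr : (A : ℝ) = 1 + ∑ w ∈ W, (a w : ℝ) := by rw [hA]; push_cast; rfl
  have hBr : (B : ℝ) = 1 + ∑ w ∈ W, (b w : ℝ) := by rw [hB]; push_cast; rfl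
  -- With `m` the chosen maximum, the corrections with `p_A` add up to `(A - 2m) p_A ≤ (A - 2) p_A ≤
  -- 47/231`, and likewise for `B`. The inequality `4/3 r + 94/231 ≤ -1 + 161/88 r` fails for `r =
  -- 2` and holds from `r = 3` on.
  have h1 := sub_two_mul_pStar_le A
  have h2 := sub_two_mul_pStar_le B
  have hpA := pStar_nonneg A
  have hpB := pStar_nonneg B
  have ha' : (1 : ℝ) ≤ a ia := by exact_mod_cast ha
  have hb' : (1 : ℝ) ≤ b ib := by exact_mod_cast hb
  have hW' : (3 : ℝ) ≤ W.card := by exact_mod_cast hW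
  have e1 : ∑ w ∈ W, (a w : ℝ) = A - 1 := by rw [hAr]; ring
  have e2 : ∑ w ∈ W, (b w : ℝ) = B - 1 := by rw [hBr]; ring
  rw [e1, e2]
  have h3 : (a ia : ℝ) * pStar A ≥ pStar A := by nlinarith
  have h4 : (b ib : ℝ) * pStar B ≥ pStar B := by nlinarith
  nlinarith

/-- The difference of consecutive parameters. -/
theorem pred_mul_pStar_sub_le {n : ℕ} (hn1 : 1 ≤ n) (hn : n ≠ 2) :
    (n - 1) * (pStar n - pStar (n + 1)) ≤ 10 / 77 := by
  rcases Nat.lt_or_ge n 7 with h | h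
  · interval_cases n <;> first | exact absurd rfl hn | norm_num [pStar]
  · rw [pStar_of_seven_le h, pStar_of_seven_le (by omega)]; norm_num

theorem pred_mul_pStar_sub_le' {n : ℕ} (hn1 : 1 ≤ n) :
    (n - 1) * (pStar n - pStar (n + 1)) ≤ 247 / 1848 := by
  by_cases hn : n = 2
  · subst hn; norm_num [pStar]
  · exact (pred_mul_pStar_sub_le hn1 hn).trans (by norm_num)

theorem mul_pStar_sub_le (n : ℕ) : n * (pStar n - pStar (n + 1)) ≤ 431 / 616 := by
  rcases Nat.lt_or_ge n 7 with h | h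
  · interval_cases n <;> norm_num [pStar]
  · rw [pStar_of_seven_le h, pStar_of_seven_le (by omega)]; norm_num

theorem mul_pStar_sub_le_of_two_le {n : ℕ} (hn : 2 ≤ n) :
    n * (pStar n - pStar (n + 1)) ≤ 1 / 2 := by
  rcases Nat.lt_or_ge n 7 with h | h
  · interval_cases n <;> norm_num [pStar]
  · rw [pStar_of_seven_le h, pStar_of_seven_le (by omega)]; norm_num

/-- The minimum removes one copy of the smaller difference. The two bounds used are attained at
sizes `2` and `1`, and `247/1848 + 431/616 = 5/6 = 11/6 - 1`. -/
theorem single_term_le {x y : ℕ} (hx : 1 ≤ x) (hy : 1 ≤ y) :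
    x * (pStar x - pStar (x + 1)) + y * (pStar y - pStar (y + 1))
      - min (pStar x - pStar (x + 1)) (pStar y - pStar (y + 1)) ≤ 5 / 6 := by
  have h1 := pred_mul_pStar_sub_le' hx
  have h2 := pred_mul_pStar_sub_le' hy
  have h3 := mul_pStar_sub_le x
  have h4 := mul_pStar_sub_le y
  rcases le_total (pStar x - pStar (x + 1)) (pStar y - pStar (y + 1)) with h | h
  · rw [min_eq_left h]; linarith
  · rw [min_eq_right h]; linarith

/-- If the reduced factor does not belong to size `2`, then `10/77` replaces `247/1848`, and `10/77
+ 431/616 = 73/88 = 161/88 - 1`. If it does, the other size is at least `2`, where `1/2` replaces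
`431/616`. -/
theorem single_term_le_of_ne {x y : ℕ} (hx : 1 ≤ x) (hy : 1 ≤ y) (h21 : ¬ (x = 2 ∧ y = 1))
    (h12 : ¬ (x = 1 ∧ y = 2)) :
    x * (pStar x - pStar (x + 1)) + y * (pStar y - pStar (y + 1))
      - min (pStar x - pStar (x + 1)) (pStar y - pStar (y + 1)) ≤ 73 / 88 := by
  have key : ∀ x y : ℕ, 1 ≤ x → 1 ≤ y → ¬ (x = 2 ∧ y = 1) →
      (x - 1) * (pStar x - pStar (x + 1)) + y * (pStar y - pStar (y + 1)) ≤ 73 / 88 := by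
    intro x y hx hy hxy
    by_cases hx2 : x = 2
    · have h1 := pred_mul_pStar_sub_le' hx
      have h2 := mul_pStar_sub_le_of_two_le (n := y) (by omega)
      linarith
    · have h1 := pred_mul_pStar_sub_le hx hx2
      have h2 := mul_pStar_sub_le y
      linarith
  have k1 := key x y hx hy h21
  have k2 := key y x hy hx (fun h => h12 h.symm)
  rcases le_total (pStar x - pStar (x + 1)) (pStar y - pStar (y + 1)) with h | h
  · rw [min_eq_left h]; linarith
  · rw [min_eq_right h]; linarith

theorem hVal_singleton (w : V) (a b : V → ℕ) : hVal {w} a b w w =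
    a w * (pStar (a w) - pStar (a w + 1)) + b w * (pStar (b w) - pStar (b w + 1))
      - min (pStar (a w) - pStar (a w + 1)) (pStar (b w) - pStar (b w + 1)) := by
  simp [hVal, qWeight, add_comm]

/-- The parameters scaled by `1848`, for integer arithmetic. -/
def scaledP : ℕ → ℕ
  | 1 => 1848
  | 2 => 555
  | 3 => 308
  | 4 => 188
  | 5 => 108
  | 6 => 48
  | _ => 0

theorem scaledP_of_seven_le {n : ℕ} (h : 7 ≤ n) : scaledP n = 0 := by
  obtain ⟨m, rfl⟩ := Nat.exists_eq_add_of_le' h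
  rfl

theorem pStar_eq_scaledP (n : ℕ) : pStar n = scaledP n / 1848 := by
  rcases Nat.lt_or_ge n 7 with h | h
  · interval_cases n <;> norm_num [pStar, scaledP]
  · rw [pStar_of_seven_le h, scaledP_of_seven_le h]; simp

/-- The scaled positive part of the bound for two neighbors; the entries of one side are `x`, `y`
and `x` is the chosen maximum. -/
def pairPart (x y : ℕ) : ℕ :=
  y * scaledP (1 + x + y) + x * (scaledP x - scaledP (1 + x + y)) + y * scaledP y

/-- The scaled bounds for two neighbors, for the two positions of the chosen maxima. -/
def PairBound (x y z t m : ℕ) : Prop :=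
  (t ≤ z → 1 ≤ z → pairPart x y + pairPart z t ≤ m +
    min (scaledP x - scaledP (1 + x + y)) (scaledP z - scaledP (1 + z + t)) +
    min (scaledP y) (scaledP t)) ∧
  (z ≤ t → 1 ≤ t → pairPart x y + pairPart t z ≤ m +
    min (scaledP x - scaledP (1 + x + y)) (scaledP z) +
    min (scaledP y) (scaledP t - scaledP (1 + t + z)))

instance (x y z t m : ℕ) : Decidable (PairBound x y z t m) := by
  unfold PairBound; infer_instance

/-- The bounds are `4928/1848 = -1 + 2 · 11/6` and `4914/1848 = -1 + 2 · 161/88`. Sizes up to `7`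
suffice because all larger ones also have parameter `0`. -/
theorem pairBound_small : ∀ x < 8, ∀ y ≤ x, ∀ z < 8, ∀ t < 8, 1 ≤ x →
    PairBound x y z t (if (x = 3 ∧ y = 3 ∧ z = 1 ∧ t = 1) ∨ (x = 1 ∧ y = 1 ∧ z = 3 ∧ t = 3)
      then 4928 else 4914) := by
  decide +kernel

/-- A size that is cut down to `7` is multiplied only by parameters that are zero before and after.
-/
theorem pairPart_min (x y : ℕ) : pairPart (min x 7) (min y 7) = pairPart x y := by
  unfold pairPart
  rcases le_total 7 x with hx | hx <;> rcases le_total 7 y with hy | hy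
  · simp [hx, hy, scaledP_of_seven_le, show 7 ≤ 1 + x + y by omega]
  · simp [hx, hy, scaledP_of_seven_le, show 7 ≤ 1 + x + y by omega, show 7 ≤ 1 + 7 + y by omega]
  · simp [hx, hy, scaledP_of_seven_le, show 7 ≤ 1 + x + y by omega, show 7 ≤ 1 + x + 7 by omega]
  · simp [hx, hy]

theorem scaledP_min (x : ℕ) : scaledP (min x 7) = scaledP x := by
  rcases le_total 7 x with hx | hx
  · simp [hx, scaledP_of_seven_le]
  · simp [hx]

theorem scaledP_min_add (x y : ℕ) : scaledP (1 + min x 7 + min y 7) = scaledP (1 + x + y) := by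
  rcases le_total 7 x with hx | hx <;> rcases le_total 7 y with hy | hy
  · simp [hx, hy, scaledP_of_seven_le, show 7 ≤ 1 + x + y by omega]
  · simp [hx, hy, scaledP_of_seven_le, show 7 ≤ 1 + x + y by omega, show 7 ≤ 1 + 7 + y by omega]
  · simp [hx, hy, scaledP_of_seven_le, show 7 ≤ 1 + x + y by omega, show 7 ≤ 1 + x + 7 by omega]
  · simp [hx, hy]

theorem pairBound (x y z t : ℕ) (hyx : y ≤ x) (hx : 1 ≤ x) :
    PairBound x y z t (if (x = 3 ∧ y = 3 ∧ z = 1 ∧ t = 1) ∨ (x = 1 ∧ y = 1 ∧ z = 3 ∧ t = 3)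
      then 4928 else 4914) := by
  have h := pairBound_small (min x 7) (by omega) (min y 7) (by omega) (min z 7) (by omega)
    (min t 7) (by omega) (by omega)
  have hm : ((min x 7 = 3 ∧ min y 7 = 3 ∧ min z 7 = 1 ∧ min t 7 = 1) ∨
      (min x 7 = 1 ∧ min y 7 = 1 ∧ min z 7 = 3 ∧ min t 7 = 3)) ↔
      ((x = 3 ∧ y = 3 ∧ z = 1 ∧ t = 1) ∨ (x = 1 ∧ y = 1 ∧ z = 3 ∧ t = 3)) := by omega
  simp only [hm] at h
  unfold PairBound at h ⊢
  simp only [pairPart_min, scaledP_min, scaledP_min_add] at h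
  exact ⟨fun h1 h2 => h.1 (by omega) (by omega), fun h1 h2 => h.2 (by omega) (by omega)⟩

/-- Monotonicity of the parameters makes the truncated subtraction exact. -/
theorem cast_scaledP_sub {x : ℕ} (hx : 1 ≤ x) (y : ℕ) :
    ((scaledP x - scaledP (1 + x + y) : ℕ) : ℝ) = scaledP x - scaledP (1 + x + y) := by
  rw [Nat.cast_sub]
  have := pStar_anti hx (show x ≤ 1 + x + y by omega)
  rw [pStar_eq_scaledP, pStar_eq_scaledP] at this
  have h2 : (scaledP (1 + x + y) : ℝ) ≤ scaledP x := by linarith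
  exact_mod_cast h2

theorem min_div_1848 (x y : ℝ) : min (x / 1848) (y / 1848) = min x y / 1848 :=
  min_div_div_right (by norm_num) x y

theorem sub_div_1848 (x y : ℝ) : x / 1848 - y / 1848 = (x - y) / 1848 := (sub_div x y _).symm

theorem hVal_pair_same {i j : V} (hij : i ≠ j) {a b : V → ℕ} (ha : 1 ≤ a i) (hb : 1 ≤ b i)
    (haj : a j ≤ a i) (hbj : b j ≤ b i) : hVal {i, j} a b i i ≤
    (if (a i = 3 ∧ a j = 3 ∧ b i = 1 ∧ b j = 1) ∨ (a i = 1 ∧ a j = 1 ∧ b i = 3 ∧ b j = 3)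
      then 4928 else 4914) / 1848 := by
  have h := (pairBound (a i) (a j) (b i) (b j) haj ha).1 hbj hb
  have h' := Nat.cast_le (α := ℝ).2 h
  unfold pairPart at h'
  push_cast [cast_scaledP_sub ha, cast_scaledP_sub hb] at h'
  unfold hVal
  simp only [Finset.sum_pair hij, qWeight, if_true, if_neg hij.symm, ← add_assoc]
  simp only [pStar_eq_scaledP, min_div_1848, sub_div_1848]
  rw [le_div_iff₀ (by norm_num)]
  refine le_trans (le_of_eq ?_) (sub_le_iff_le_add.2 (sub_le_iff_le_add.2 h'))
  ring

theorem hVal_pair_cross {i j : V} (hij : i ≠ j) {a b : V → ℕ} (ha : 1 ≤ a i) (hb : 1 ≤ b j)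
    (haj : a j ≤ a i) (hbi : b i ≤ b j) : hVal {i, j} a b i j ≤
    (if (a i = 3 ∧ a j = 3 ∧ b i = 1 ∧ b j = 1) ∨ (a i = 1 ∧ a j = 1 ∧ b i = 3 ∧ b j = 3)
      then 4928 else 4914) / 1848 := by
  have h := (pairBound (a i) (a j) (b i) (b j) haj ha).2 hbi hb
  have h' := Nat.cast_le (α := ℝ).2 h
  unfold pairPart at h'
  push_cast [cast_scaledP_sub ha, cast_scaledP_sub hb] at h'
  unfold hVal
  have e : 1 + b i + b j = 1 + b j + b i := by omega
  simp only [Finset.sum_pair hij, qWeight, if_true, if_neg hij.symm, if_neg hij, ← add_assoc]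
  rw [e]
  simp only [pStar_eq_scaledP, min_div_1848, sub_div_1848]
  rw [le_div_iff₀ (by norm_num)]
  refine le_trans (le_of_eq ?_) (sub_le_iff_le_add.2 (sub_le_iff_le_add.2 h'))
  ring

/-- The configurations `(2; 1)`, `(1; 2)`, `(3, 3; 1, 1)`, `(1, 1; 3, 3)`. -/
def ExtremalEntries (W : Finset V) (a b : V → ℕ) : Prop :=
  (W.card = 1 ∧ ((∀ w ∈ W, a w = 2 ∧ b w = 1) ∨ ∀ w ∈ W, a w = 1 ∧ b w = 2)) ∨
  (W.card = 2 ∧ ((∀ w ∈ W, a w = 3 ∧ b w = 1) ∨ ∀ w ∈ W, a w = 1 ∧ b w = 3))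

/-- The bounds for all configurations. -/
theorem hVal_le {W : Finset V} {a b : V → ℕ} {ia ib : V} (hia : IsArgmax W a ia)
    (hib : IsArgmax W b ib) (ha : 1 ≤ a ia) (hb : 1 ≤ b ib) :
    hVal W a b ia ib ≤ -1 + 11 / 6 * W.card ∧
      (¬ ExtremalEntries W a b → hVal W a b ia ib ≤ -1 + 161 / 88 * W.card) := by
  classical
  have hpos : 1 ≤ W.card := Finset.card_pos.2 ⟨ia, hia.1⟩
  rcases (by omega : W.card = 1 ∨ W.card = 2 ∨ 3 ≤ W.card) with h | h | h
  · obtain ⟨w, rfl⟩ := Finset.card_eq_one.1 h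
    obtain rfl := Finset.mem_singleton.1 hia.1
    obtain rfl := Finset.mem_singleton.1 hib.1
    rw [hVal_singleton, h]
    refine ⟨(single_term_le ha hb).trans (by norm_num), fun hE => ?_⟩
    refine (single_term_le_of_ne ha hb ?_ ?_).trans (by norm_num)
    · exact fun h' => hE (Or.inl ⟨by simp, Or.inl (by simpa using h')⟩)
    · exact fun h' => hE (Or.inl ⟨by simp, Or.inr (by simpa using h')⟩)
  · obtain ⟨j, hj⟩ : ∃ j, ia ≠ j ∧ W = {ia, j} := by
      obtain ⟨x, y, hxy, rfl⟩ := Finset.card_eq_two.1 h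
      have := hia.1
      simp only [Finset.mem_insert, Finset.mem_singleton] at this
      rcases this with rfl | rfl
      · exact ⟨y, hxy, rfl⟩
      · exact ⟨x, hxy.symm, Finset.pair_comm _ _⟩
    obtain ⟨hij, rfl⟩ := hj
    rw [h]
    have key : hVal {ia, j} a b ia ib ≤ (if (a ia = 3 ∧ a j = 3 ∧ b ia = 1 ∧ b j = 1) ∨
        (a ia = 1 ∧ a j = 1 ∧ b ia = 3 ∧ b j = 3) then 4928 else 4914) / 1848 := by
      have haj := hia.2 j (by simp)
      have := hib.1
      simp only [Finset.mem_insert, Finset.mem_singleton] at this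
      rcases this with rfl | rfl
      · exact hVal_pair_same hij ha hb haj (hib.2 j (by simp))
      · exact hVal_pair_cross hij ha hb haj (hib.2 ia (by simp))
    refine ⟨key.trans (by split_ifs <;> norm_num), fun hE => key.trans ?_⟩
    rw [if_neg]
    · norm_num
    · rintro (⟨h1, h2, h3, h4⟩ | ⟨h1, h2, h3, h4⟩)
      · exact hE (Or.inr ⟨h, Or.inl (by simp [h1, h2, h3, h4])⟩)
      · exact hE (Or.inr ⟨h, Or.inr (by simp [h1, h2, h3, h4])⟩)
  · have := hVal_le_of_three_le hia.1 hib.1 ha hb h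
    refine ⟨this.trans ?_, fun _ => this⟩
    have : (0 : ℝ) ≤ W.card := by positivity
    linarith

end Configurations

/-! ### Extremal configurations in terms of entries -/

section ExtremalConfiguration

variable {V : Type*} [Fintype V] [LinearOrder V] {k : ℕ} {G : SimpleGraph V}
  {σ τ : V → Fin k} {v : V}

theorem map_sort_singleton_iff {W : Finset V} {f g : V → ℕ} {x y : ℕ} :
    ((W.sort (· ≤ ·)).map f, (W.sort (· ≤ ·)).map g) = ([x], [y]) ↔
      W.card = 1 ∧ ∀ w ∈ W, f w = x ∧ g w = y := by
  constructor
  · intro h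
    have hc : W.card = 1 := by
      have := congrArg (fun l => l.1.length) h
      simpa using this
    obtain ⟨w, rfl⟩ := Finset.card_eq_one.1 hc
    refine ⟨hc, ?_⟩
    simpa using h
  · rintro ⟨hc, h⟩
    obtain ⟨w, rfl⟩ := Finset.card_eq_one.1 hc
    simpa using h

theorem map_sort_pair_iff {W : Finset V} {f g : V → ℕ} {x y : ℕ} :
    ((W.sort (· ≤ ·)).map f, (W.sort (· ≤ ·)).map g) = ([x, x], [y, y]) ↔
      W.card = 2 ∧ ∀ w ∈ W, f w = x ∧ g w = y := by
  have e : ∀ (f : V → ℕ) (x : ℕ), (W.sort (· ≤ ·)).map f = [x, x] ↔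
      W.card = 2 ∧ ∀ w ∈ W, f w = x := by
    intro f x
    rw [show [x, x] = List.replicate 2 x from rfl, List.eq_replicate_iff]
    simp
  rw [Prod.mk.injEq, e, e]
  constructor
  · rintro ⟨⟨h1, h2⟩, -, h3⟩; exact ⟨h1, fun w hw => ⟨h2 w hw, h3 w hw⟩⟩
  · rintro ⟨h1, h2⟩; exact ⟨⟨h1, fun w hw => (h2 w hw).1⟩, h1, fun w hw => (h2 w hw).2⟩

theorem isExtremal_iff {c : Fin k} : IsExtremal G σ τ v c ↔
    ExtremalEntries (colorNbrs G σ v c) (aEntry G σ τ v c) (bEntry G σ τ v c) := by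
  simp only [IsExtremal, extremalOne, extremalTwo, Finset.mem_filter, Finset.mem_univ, true_and,
    configuration, ExtremalEntries, map_sort_singleton_iff, map_sort_pair_iff, and_or_left]

end ExtremalConfiguration

/-! ### The contribution of a color other than those of `v` -/

section ColorBound

variable {V : Type*} [Fintype V] [LinearOrder V] {k : ℕ} {G : SimpleGraph V}
  {φ σ τ : V → Fin k} {v : V} {ia ib : Fin k → V}

theorem hammingDist_le_card {f g : V → Fin k} {S : Finset V} (h : ∀ x, x ∉ S → f x = g x) :
    hammingDist f g ≤ S.card :=
  Finset.card_le_card fun x hx => by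
    by_contra hn
    exact (Finset.mem_filter.1 hx).2 (h x hn)

/-- Both flips exchange `c` and `σ v` on `S_τ(i, σ v)` and so agree there; differences remain only
in the rest of `S_σ(v, c)`. -/
theorem flip_large_hammingDist (h : DiffAt σ τ v) {c : Fin k} (hcs : c ≠ σ v) (hct : c ≠ τ v)
    {i : V} (hi : IsArgmax (colorNbrs G σ v c) (aEntry G σ τ v c) i) :
    (hammingDist (flipComp σ (kempe G σ v c)) (flipComp τ (kempe G τ i (σ v))) : ℝ) - 1 ≤
      ∑ w ∈ colorNbrs G σ v c, (aEntry G σ τ v c w : ℝ) - aEntry G σ τ v c i := by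
  classical
  have hsub : kempeSet G τ i (σ v) ⊆ kempeSet G σ v c := by
    rw [kempeSet_eq_insert h hcs hct]
    exact (Finset.subset_biUnion_of_mem (fun w => kempeSet G τ w (σ v)) hi.1).trans
      (Finset.subset_insert _ _)
  obtain ⟨hi1, hi2⟩ := mem_colorNbrs.1 hi.1
  have hd : hammingDist (flipComp σ (kempe G σ v c)) (flipComp τ (kempe G τ i (σ v))) ≤
      (kempeSet G σ v c \ kempeSet G τ i (σ v)).card := by
    refine hammingDist_le_card fun x hx => ?_
    rw [Finset.mem_sdiff, not_and, not_not] at hx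
    by_cases hxs : x ∈ kempeSet G σ v c
    · have hxt := hx hxs
      have hxv : x ≠ v := fun e => notMem_kempeSet_of_ne h hct hi.1 (e ▸ hxt)
      rw [flipComp_kempe_of_mem hxs, flipComp_kempe_of_mem hxt, ← h.2 x hxv, ← h.2 i hi1.ne', hi2,
        Equiv.swap_comm]
    · have hxv : x ≠ v := fun e => hxs (by rw [e]; exact self_mem_kempeSet v c)
      rw [flipComp_of_notMem (K := kempe G σ v c) hxs,
        flipComp_of_notMem (K := kempe G τ i (σ v)) fun hm => hxs (hsub hm), h.2 x hxv]
  rw [Finset.card_sdiff_of_subset hsub, card_kempeSet_eq h hcs hct, ← argmax_aEntry hi] at hd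
  have hle : aEntry G σ τ v c i ≤ ∑ w ∈ colorNbrs G σ v c, aEntry G σ τ v c w :=
    Finset.single_le_sum (f := aEntry G σ τ v c) (fun _ _ => Nat.zero_le _) hi.1
  have hd' : hammingDist (flipComp σ (kempe G σ v c)) (flipComp τ (kempe G τ i (σ v))) +
      aEntry G σ τ v c i ≤ 1 + ∑ w ∈ colorNbrs G σ v c, aEntry G σ τ v c w := by omega
  have hd'' := Nat.cast_le (α := ℝ).2 hd'
  push_cast at hd''
  linarith

/-- Both components contain `w`, and this overlap makes up for the extra vertex `v`. The `-1` is the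
source of the subtracted minimum in `hVal`. -/
theorem flip_both_hammingDist (h : DiffAt σ τ v) (w : V) :
    (hammingDist (flipComp σ (kempe G σ w (τ v))) (flipComp τ (kempe G τ w (σ v))) : ℝ) - 1 ≤
      (kempeSet G τ w (σ v)).card + (kempeSet G σ w (τ v)).card - 1 := by
  classical
  have hd : hammingDist (flipComp σ (kempe G σ w (τ v))) (flipComp τ (kempe G τ w (σ v))) ≤
      (insert v (kempeSet G τ w (σ v) ∪ (kempeSet G σ w (τ v)).erase w)).card := by
    refine hammingDist_le_card fun x hx => ?_
    simp only [Finset.mem_insert, Finset.mem_union, Finset.mem_erase, not_or, not_and] at hx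
    obtain ⟨hxv, hx1, hx2⟩ := hx
    have hxw : x ≠ w := fun e => hx1 (e ▸ self_mem_kempeSet _ _)
    rw [flipComp_of_notMem (K := kempe G σ w (τ v)) (hx2 hxw),
      flipComp_of_notMem (K := kempe G τ w (σ v)) hx1, h.2 x hxv]
  have h1 := (hd.trans (Finset.card_insert_le _ _)).trans
    (Nat.add_le_add_right (Finset.card_union_le _ _) 1)
  have h2 := Finset.card_erase_add_one (self_mem_kempeSet (G := G) (φ := σ) w (τ v))
  have h3 : hammingDist (flipComp σ (kempe G σ w (τ v))) (flipComp τ (kempe G τ w (σ v))) ≤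
      (kempeSet G τ w (σ v)).card + (kempeSet G σ w (τ v)).card := by omega
  have h4 := Nat.cast_le (α := ℝ).2 h3
  push_cast at h4
  linarith

theorem hammingDist_flipComp_le (φ : V → Fin k) (K : Comp V k) :
    hammingDist φ (flipComp φ K) ≤ K.2.card :=
  hammingDist_le_card fun _ hx => (flipComp_of_notMem hx).symm

theorem flip_right_hammingDist (h : DiffAt σ τ v) (K : Comp V k) :
    (hammingDist σ (flipComp τ K) : ℝ) - 1 ≤ K.2.card := by
  have h1 := hammingDist_triangle σ τ (flipComp τ K)
  rw [h.hammingDist_eq] at h1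
  have h2 := hammingDist_flipComp_le τ K
  have h3 := Nat.cast_le (α := ℝ).2 (h1.trans (Nat.add_le_add_left h2 1))
  push_cast at h3
  linarith

/-- Both flips recolor `v` alone, to `c`, so the chains meet. -/
theorem flip_eq_of_empty (h : DiffAt σ τ v) {c : Fin k} (hcs : c ≠ σ v) (hct : c ≠ τ v)
    (hW : colorNbrs G σ v c = ∅) :
    flipComp σ (kempe G σ v c) = flipComp τ (kempe G τ v c) := by
  have h1 : kempeSet G σ v c = {v} := by rw [kempeSet_eq_insert h hcs hct, hW]; simp
  have h2 : kempeSet G τ v c = {v} := by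
    rw [kempeSet_eq_insert h.symm hct hcs, colorNbrs_eq h, hW]; simp
  funext x
  by_cases hx : x = v
  · subst hx; rw [flipComp_kempe_self, flipComp_kempe_self]
  · rw [flipComp_of_notMem (by simpa [h1] using hx), flipComp_of_notMem (by simpa [h2] using hx),
      h.2 x hx]

/-- The contribution of one color other than the colors of `v`. -/
theorem sum_colorMass_le (h : DiffAt σ τ v) (hi : Admissible G σ τ v ia ib) {c : Fin k}
    (hcs : c ≠ σ v) (hct : c ≠ τ v) {δ : ℝ} (hδ : 0 ≤ δ)
    {F : Option (Comp V k) → Option (Comp V k) → ℝ}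
    (hF : ∀ X Y, F X Y ≤ (hammingDist (applyMove σ X) (applyMove τ Y) : ℝ) - 1 + δ) :
    ∑ X ∈ moves G σ, ∑ Y ∈ moves G τ, colorMass G pStar σ τ v c (ia c) (ib c) X Y * F X Y ≤
      (-1 + 161 / 88 * (colorNbrs G σ v c).card) + δ * (1 + 2 * (colorNbrs G σ v c).card) +
      (11 / 6 - 161 / 88) * (∑ w ∈ colorNbrs G σ v c, if w ∈ extNbrs G σ τ v then 1 else 0) := by
  classical
  by_cases hW : colorNbrs G σ v c = ∅
  · rw [sum_colorMass_mul_of_empty hW, hW]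
    have := hF (some (kempe G σ v c)) (some (kempe G τ v c))
    simp only [applyMove, flip_eq_of_empty h hcs hct hW, hammingDist_self] at this
    simp at this ⊢
    linarith
  obtain ⟨h1, h2⟩ := hi c hcs hct (Finset.nonempty_iff_ne_empty.2 hW)
  rw [sum_colorMass_mul hW]
  have ha1 : 1 ≤ aEntry G σ τ v c (ia c) := by
    rw [argmax_aEntry h1]; exact one_le_card_kempeSet _ _
  have h2' : IsArgmax (colorNbrs G τ v c) (aEntry G τ σ v c) (ib c) := by
    rwa [aEntry_swap h, colorNbrs_eq h]
  have hb1 : 1 ≤ bEntry G σ τ v c (ib c) := by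
    rw [← aEntry_swap h, argmax_aEntry h2']; exact one_le_card_kempeSet _ _
  have hH := hVal_le h1 h2 ha1 hb1
  have hext : hVal (colorNbrs G σ v c) (aEntry G σ τ v c) (bEntry G σ τ v c) (ia c) (ib c) ≤
      -1 + 161 / 88 * (colorNbrs G σ v c).card +
      (11 / 6 - 161 / 88) * (∑ w ∈ colorNbrs G σ v c, if w ∈ extNbrs G σ τ v then 1 else 0) := by
    by_cases hE : IsExtremal G σ τ v c
    · have : ∑ w ∈ colorNbrs G σ v c, (if w ∈ extNbrs G σ τ v then (1 : ℝ) else 0)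
          = (colorNbrs G σ v c).card := by
        rw [Finset.sum_congr rfl fun w hw => if_pos (mem_extNbrs.2
          ⟨(mem_colorNbrs.1 hw).1, by rw [(mem_colorNbrs.1 hw).2]; exact hE⟩)]
        simp
      rw [this]
      linarith [hH.1]
    · have h0 : (0 : ℝ) ≤ ∑ w ∈ colorNbrs G σ v c, if w ∈ extNbrs G σ τ v then 1 else 0 :=
        Finset.sum_nonneg fun _ _ => by split_ifs <;> norm_num
      have := hH.2 (fun hE' => hE (isExtremal_iff.2 hE'))
      nlinarith
  have hA : pStar (aTotal G σ τ v c) *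
      F (some (kempe G σ v c)) (some (kempe G τ (ia c) (σ v))) ≤ pStar (aTotal G σ τ v c) *
      (∑ w ∈ colorNbrs G σ v c, (aEntry G σ τ v c w : ℝ) - aEntry G σ τ v c (ia c))
      + δ * pStar (aTotal G σ τ v c) := by
    have e1 := hF (some (kempe G σ v c)) (some (kempe G τ (ia c) (σ v)))
    simp only [applyMove] at e1
    have e2 := flip_large_hammingDist h hcs hct h1
    have := mul_le_mul_of_nonneg_left (e1.trans (add_le_add_left e2 δ))
      (pStar_nonneg (aTotal G σ τ v c))
    linarith
  have hB : pStar (bTotal G σ τ v c) *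
      F (some (kempe G σ (ib c) (τ v))) (some (kempe G τ v c)) ≤ pStar (bTotal G σ τ v c) *
      (∑ w ∈ colorNbrs G σ v c, (bEntry G σ τ v c w : ℝ) - bEntry G σ τ v c (ib c))
      + δ * pStar (bTotal G σ τ v c) := by
    have e1 := hF (some (kempe G σ (ib c) (τ v))) (some (kempe G τ v c))
    simp only [applyMove] at e1
    have e2 := flip_large_hammingDist h.symm hct hcs h2'
    rw [aEntry_swap h, colorNbrs_eq h, hammingDist_comm] at e2
    have := mul_le_mul_of_nonneg_left (e1.trans (add_le_add_left e2 δ))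
      (pStar_nonneg (bTotal G σ τ v c))
    linarith
  have hS : ∀ w ∈ colorNbrs G σ v c,
      (min (qa G σ τ v c (ia c) w) (qb G σ τ v c (ib c) w) *
          F (some (kempe G σ w (τ v))) (some (kempe G τ w (σ v)))
      + (qa G σ τ v c (ia c) w - min (qa G σ τ v c (ia c) w) (qb G σ τ v c (ib c) w)) *
          F none (some (kempe G τ w (σ v)))
      + (qb G σ τ v c (ib c) w - min (qa G σ τ v c (ia c) w) (qb G σ τ v c (ib c) w)) *
          F (some (kempe G σ w (τ v))) none) ≤
      (aEntry G σ τ v c w * qa G σ τ v c (ia c) w + bEntry G σ τ v c w * qb G σ τ v c (ib c) w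
        - min (qa G σ τ v c (ia c) w) (qb G σ τ v c (ib c) w))
      + δ * (qa G σ τ v c (ia c) w + qb G σ τ v c (ib c) w) := by
    intro w hw
    have hqa := qa_nonneg h1 w
    have hqb := qb_nonneg h h2 w
    -- The entry `0` of a repeated component gives `q ≤ p_0 = 0`; wherever `q` is positive, the
    -- entry is the true size.
    have hza : 0 < qa G σ τ v c (ia c) w →
        (aEntry G σ τ v c w : ℝ) = (kempeSet G τ w (σ v)).card := fun hpos => by
      rcases entry_eq_zero_or (G := G) (φ := τ) (colorNbrs G σ v c) (σ v) w with e | e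
      · have := qa_le (G := G) (σ := σ) (τ := τ) (v := v) c (ia c) w
        unfold aEntry at this
        rw [e, pStar_zero] at this
        linarith
      · unfold aEntry; rw [e]
    have hzb : 0 < qb G σ τ v c (ib c) w →
        (bEntry G σ τ v c w : ℝ) = (kempeSet G σ w (τ v)).card := fun hpos => by
      rcases entry_eq_zero_or (G := G) (φ := σ) (colorNbrs G σ v c) (τ v) w with e | e
      · have := qa_le (G := G) (σ := τ) (τ := σ) (v := v) c (ib c) w
        rw [qa_swap h, aEntry_swap h] at this
        unfold bEntry at this
        rw [e, pStar_zero] at this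
        linarith
      · unfold bEntry; rw [e]
    set x := qa G σ τ v c (ia c) w
    set y := qb G σ τ v c (ib c) w
    have e1 := (hF (some (kempe G σ w (τ v))) (some (kempe G τ w (σ v)))).trans
      (add_le_add_left (flip_both_hammingDist h w) δ)
    have e2 := (hF none (some (kempe G τ w (σ v)))).trans
      (add_le_add_left (flip_right_hammingDist h _) δ)
    have e3 := hF (some (kempe G σ w (τ v))) none
    simp only [applyMove] at e3
    rw [hammingDist_comm] at e3
    have e3 := e3.trans (add_le_add_left (flip_right_hammingDist h.symm _) δ)
    simp only [kempe_snd] at e1 e2 e3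
    have hm0 : 0 ≤ min x y := le_min hqa hqb
    have m1 : min x y * F (some (kempe G σ w (τ v))) (some (kempe G τ w (σ v))) ≤
        min x y * (aEntry G σ τ v c w + bEntry G σ τ v c w - 1 + δ) := by
      rcases hm0.eq_or_lt with hm | hm
      · rw [← hm]; simp
      · rw [hza (hm.trans_le (min_le_left _ _)), hzb (hm.trans_le (min_le_right _ _))]
        exact mul_le_mul_of_nonneg_left e1 hm0
    have m2 : (x - min x y) * F none (some (kempe G τ w (σ v))) ≤
        (x - min x y) * (aEntry G σ τ v c w + δ) := by
      rcases (sub_nonneg.2 (min_le_left x y)).eq_or_lt with hm | hm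
      · rw [← hm]; simp
      · rw [hza (by linarith)]
        exact mul_le_mul_of_nonneg_left e2 hm.le
    have m3 : (y - min x y) * F (some (kempe G σ w (τ v))) none ≤
        (y - min x y) * (bEntry G σ τ v c w + δ) := by
      rcases (sub_nonneg.2 (min_le_right x y)).eq_or_lt with hm | hm
      · rw [← hm]; simp
      · rw [hzb (by linarith)]
        exact mul_le_mul_of_nonneg_left e3 hm.le
    nlinarith [mul_nonneg hδ hm0]
  -- The withdrawn parameters cancel: `p_a + Σ q_i = Σ p_{a_i} ≤ r`, and likewise for `b`. This
  -- bounds the mass on which `δ` is paid.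
  have hmass : pStar (aTotal G σ τ v c) + pStar (bTotal G σ τ v c) +
      ∑ w ∈ colorNbrs G σ v c, (qa G σ τ v c (ia c) w + qb G σ τ v c (ib c) w) ≤
      2 * (colorNbrs G σ v c).card := by
    simp_rw [qa_eq, qb_eq]
    rw [Finset.sum_add_distrib, Finset.sum_sub_distrib, Finset.sum_sub_distrib,
      Finset.sum_ite_eq', Finset.sum_ite_eq', if_pos h1.1, if_pos h2.1]
    have s1 : ∑ w ∈ colorNbrs G σ v c, pStar (aEntry G σ τ v c w) ≤
        ∑ w ∈ colorNbrs G σ v c, (1 : ℝ) := Finset.sum_le_sum fun _ _ => pStar_le_one _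
    have s2 : ∑ w ∈ colorNbrs G σ v c, pStar (bEntry G σ τ v c w) ≤
        ∑ w ∈ colorNbrs G σ v c, (1 : ℝ) := Finset.sum_le_sum fun _ _ => pStar_le_one _
    simp only [Finset.sum_const, nsmul_eq_mul, mul_one] at s1 s2
    linarith
  have hsum := (Finset.sum_le_sum hS).trans_eq Finset.sum_add_distrib
  rw [← Finset.mul_sum] at hsum
  have hmass' := mul_le_mul_of_nonneg_left hmass hδ
  have hdef : hVal (colorNbrs G σ v c) (aEntry G σ τ v c) (bEntry G σ τ v c) (ia c) (ib c) =
      pStar (aTotal G σ τ v c) *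
        (∑ w ∈ colorNbrs G σ v c, (aEntry G σ τ v c w : ℝ) - aEntry G σ τ v c (ia c))
      + pStar (bTotal G σ τ v c) *
        (∑ w ∈ colorNbrs G σ v c, (bEntry G σ τ v c w : ℝ) - bEntry G σ τ v c (ib c))
      + ∑ w ∈ colorNbrs G σ v c,
        (aEntry G σ τ v c w * qa G σ τ v c (ia c) w + bEntry G σ τ v c w * qb G σ τ v c (ib c) w
        - min (qa G σ τ v c (ia c) w) (qb G σ τ v c (ib c) w)) := rfl
  rw [hdef] at hext
  linarith

end ColorBound

/-! ### The contribution of the two colors of `v` -/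

section SpecialBound

variable {V : Type*} [Fintype V] [LinearOrder V] {k : ℕ} {G : SimpleGraph V}
  {φ σ τ : V → Fin k} {v : V} {ia ib : Fin k → V}

open Classical in
/-- An upper bound for the number of vertices that change color when a component is flipped. -/
noncomputable def flipSize (K : Comp V k) : ℝ := if K.1.IsDiag then 0 else K.2.card

theorem flipSize_nonneg (K : Comp V k) : 0 ≤ flipSize K := by
  unfold flipSize; split_ifs <;> positivity

theorem flipComp_of_isDiag {K : Comp V k} (h : K.1.IsDiag) : flipComp φ K = φ := by
  obtain ⟨e, S⟩ := K
  induction e with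
  | h a b =>
    obtain rfl : a = b := by simpa using h
    funext x
    simp [flipComp]

theorem hammingDist_le_flipSize (K : Comp V k) :
    (hammingDist φ (flipComp φ K) : ℝ) ≤ flipSize K := by
  unfold flipSize
  split_ifs with h
  · rw [flipComp_of_isDiag h]; simp
  · exact_mod_cast hammingDist_flipComp_le φ K

/-- The cost charged to one move of a pair. -/
noncomputable def moveCost (δ : ℝ) : Option (Comp V k) → ℝ
  | none => 0
  | some K => flipSize K + δ

theorem moveCost_nonneg {δ : ℝ} (hδ : 0 ≤ δ) (X : Option (Comp V k)) : 0 ≤ moveCost δ X := by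
  cases X with
  | none => exact le_rfl
  | some K => exact add_nonneg (flipSize_nonneg K) hδ

/-- By the triangle inequality the cost of a pair splits into costs of its two moves, so only the
marginals matter where the coupling is free. -/
theorem le_moveCost_add (h : DiffAt σ τ v) {δ : ℝ} (hδ : 0 ≤ δ)
    {F : Option (Comp V k) → Option (Comp V k) → ℝ}
    (hF : ∀ X Y, F X Y ≤ (hammingDist (applyMove σ X) (applyMove τ Y) : ℝ) - 1 + δ)
    (hF0 : F none none ≤ 0) (X Y : Option (Comp V k)) :
    F X Y ≤ moveCost δ X + moveCost δ Y := by
  have key : ∀ (σ' τ' : V → Fin k), (hammingDist σ' τ' : ℝ) - 1 ≤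
      hammingDist σ σ' + hammingDist τ τ' := by
    intro σ' τ'
    have h1 := hammingDist_triangle σ' σ τ'
    have h2 := hammingDist_triangle σ τ τ'
    rw [h.hammingDist_eq] at h2
    rw [hammingDist_comm σ' σ] at h1
    have h3 : hammingDist σ' τ' ≤ hammingDist σ σ' + (1 + hammingDist τ τ') := by omega
    have h4 := Nat.cast_le (α := ℝ).2 h3
    push_cast at h4
    linarith
  cases X with
  | none =>
    cases Y with
    | none => simpa [moveCost] using hF0
    | some L =>
      have h1 := hF none (some L)
      have h2 := key (applyMove σ none) (applyMove τ (some L))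
      have h3 := hammingDist_le_flipSize (φ := τ) L
      simp only [applyMove, moveCost, hammingDist_self, Nat.cast_zero] at h1 h2 ⊢
      linarith
  | some K =>
    have h3 := hammingDist_le_flipSize (φ := σ) K
    cases Y with
    | none =>
      have h1 := hF (some K) none
      have h2 := key (applyMove σ (some K)) (applyMove τ none)
      simp only [applyMove, moveCost, hammingDist_self, Nat.cast_zero] at h1 h2 ⊢
      linarith
    | some L =>
      have h1 := hF (some K) (some L)
      have h2 := key (applyMove σ (some K)) (applyMove τ (some L))
      have h4 := hammingDist_le_flipSize (φ := τ) L
      simp only [applyMove, moveCost] at h1 h2 ⊢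
      linarith

theorem sum_affectedBy_le {d c : Fin k} {f : Comp V k → ℝ} (hf : ∀ K, 0 ≤ f K) :
    ∑ K ∈ affectedBy G φ v d c, f K ≤
      f (kempe G φ v c) + ∑ w ∈ colorNbrs G φ v c, f (kempe G φ w d) := by
  classical
  unfold affectedBy
  have h1 : ∑ K ∈ (colorNbrs G φ v c).image (fun w => kempe G φ w d), f K ≤
      ∑ w ∈ colorNbrs G φ v c, f (kempe G φ w d) :=
    Finset.sum_image_le_of_nonneg fun _ _ => hf _
  by_cases hm : kempe G φ v c ∈ (colorNbrs G φ v c).image (fun w => kempe G φ w d)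
  · rw [Finset.insert_eq_of_mem (by convert hm)]
    have := hf (kempe G φ v c)
    refine le_trans (le_of_eq ?_) (h1.trans (by linarith))
    congr
  · rw [Finset.sum_insert (by convert hm)]
    refine add_le_add le_rfl (le_trans (le_of_eq ?_) h1)
    congr

/-- Since `n p_n ≤ 1`, a component costs at most `1 + δ`, and only `δ` if it is monochromatic, as
its flip then changes nothing. The two-colored ones are `S_σ(v, τ v)` and the `S_σ(w, τ v)` with `σ
w = σ v`. -/
theorem sum_specialMoves_le (σ τ : V → Fin k) {δ : ℝ} (hδ : 0 ≤ δ) :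
    k * Fintype.card V *
      ∑ X ∈ specialMoves G σ v (τ v), moveCost δ X * moveProb G pStar σ X ≤
      1 + (colorNbrs G σ v (σ v)).card +
      δ * (2 + (colorNbrs G σ v (σ v)).card + (colorNbrs G σ v (τ v)).card) := by
  classical
  have hn : (0 : ℝ) < k * Fintype.card V := by
    have h1 : 0 < Fintype.card V := Fintype.card_pos_iff.2 ⟨v⟩
    have h2 : 0 < k := Fin.pos (σ v)
    positivity
  set f : Comp V k → ℝ := fun K => (if K.1.IsDiag then 0 else 1) + δ with hfdef
  have hf : ∀ K, 0 ≤ f K := fun K => by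
    simp only [hfdef]; split_ifs <;> linarith
  have hle : ∀ K ∈ comps G σ,
      k * Fintype.card V * (moveCost δ (some K) * moveProb G pStar σ (some K)) ≤ f K := by
    intro K hK
    rw [moveProb_some _ hK]
    have e : k * Fintype.card V * (moveCost δ (some K) * (pStar K.2.card / (k * Fintype.card V)))
        = moveCost δ (some K) * pStar K.2.card := by
      rw [mul_div_assoc', mul_div_cancel₀ _ hn.ne']
    rw [e]
    simp only [moveCost, flipSize, hfdef]
    have h1 := mul_pStar_le_one K.2.card
    have h2 := pStar_le_one K.2.card
    have h3 := pStar_nonneg K.2.card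
    split_ifs <;> nlinarith
  unfold specialMoves
  rw [Finset.sum_insertNone]
  simp only [moveCost, zero_mul, zero_add]
  rw [Finset.mul_sum]
  have hsub : ∀ c, ∀ K ∈ affectedBy G σ v (τ v) c, K ∈ comps G σ := fun c K hK =>
    affected_subset_comps _ (affectedBy_subset_affected _ c hK)
  calc _ ≤ ∑ K ∈ affectedBy G σ v (τ v) (σ v) ∪ affectedBy G σ v (τ v) (τ v), f K :=
        Finset.sum_le_sum fun K hK => hle K (by
          rcases Finset.mem_union.1 hK with hK | hK <;> exact hsub _ K hK)
    _ ≤ ∑ K ∈ affectedBy G σ v (τ v) (σ v), f K + ∑ K ∈ affectedBy G σ v (τ v) (τ v), f K := by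
        rw [← Finset.sum_union_inter]
        exact le_add_of_nonneg_right (Finset.sum_nonneg fun K _ => hf K)
    _ ≤ _ := by
        have h1 := sum_affectedBy_le (G := G) (φ := σ) (v := v) (d := τ v) (c := σ v) hf
        have h2 := sum_affectedBy_le (G := G) (φ := σ) (v := v) (d := τ v) (c := τ v) hf
        have e1 : f (kempe G σ v (σ v)) = δ := by simp [hfdef]
        have e2 : f (kempe G σ v (τ v)) ≤ 1 + δ := by
          simp only [hfdef]; split_ifs <;> linarith
        have e3 : ∑ w ∈ colorNbrs G σ v (σ v), f (kempe G σ w (τ v)) ≤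
            ∑ w ∈ colorNbrs G σ v (σ v), (1 + δ) := Finset.sum_le_sum fun w _ => by
          simp only [hfdef]; split_ifs <;> linarith
        have e4 : ∑ w ∈ colorNbrs G σ v (τ v), f (kempe G σ w (τ v)) =
            ∑ w ∈ colorNbrs G σ v (τ v), δ := Finset.sum_congr rfl fun w hw => by
          simp [hfdef, (mem_colorNbrs.1 hw).2]
        simp only [Finset.sum_const, nsmul_eq_mul] at e3 e4
        rw [e4] at h2
        rw [e1] at h1
        nlinarith

/-- The prescribed masses give nothing to pairs of special moves. -/
theorem regularMass_special (h : DiffAt σ τ v) (hi : Admissible G σ τ v ia ib)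
    {X Y : Option (Comp V k)} (hX : X ∈ moves G σ) (hY : Y ∈ moves G τ)
    (hXs : X ∈ specialMoves G σ v (τ v)) (hYs : Y ∈ specialMoves G τ v (σ v)) :
    regularMass G pStar σ τ v ia ib X Y = 0 := by
  classical
  have key : ∀ {σ τ : V → Fin k} {ia ib : Fin k → V}, DiffAt σ τ v → Admissible G σ τ v ia ib →
      ∀ {K : Comp V k} {Y : Option (Comp V k)}, K ∈ comps G σ → Y ∈ moves G τ →
      some K ∈ specialMoves G σ v (τ v) → regularMass G pStar σ τ v ia ib (some K) Y = 0 := by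
    intro σ τ ia ib h hi K Y hK hY hs
    have h1 := rowSum_regularMass_some h hi hK
    rw [if_pos hs] at h1
    exact (Finset.sum_eq_zero_iff_of_nonneg fun Y _ => regularMass_nonneg h hi _ Y).1 h1 Y hY
  cases X with
  | some K => exact key h hi (some_mem_moves.1 hX) hY hXs
  | none =>
    cases Y with
    | some L =>
      rw [← regularMass_swap h]
      exact key h.symm (hi.swap h) (some_mem_moves.1 hY) hX hYs
    | none =>
      unfold regularMass colorMass
      simp

/-- Any coupling splits into the prescribed masses and the special pairs. -/
theorem coupling_sum_le (h : DiffAt σ τ v) (hi : Admissible G σ τ v ia ib)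
    {P : Option (Comp V k) → Option (Comp V k) → ℝ}
    (hP : IsVigodaCoupling G pStar σ τ v ia ib P) {δ : ℝ} (hδ : 0 ≤ δ)
    {F : Option (Comp V k) → Option (Comp V k) → ℝ}
    (hF : ∀ X Y, F X Y ≤ (hammingDist (applyMove σ X) (applyMove τ Y) : ℝ) - 1 + δ)
    (hF0 : F none none ≤ 0) :
    k * Fintype.card V * ∑ X ∈ moves G σ, ∑ Y ∈ moves G τ, P X Y * F X Y ≤
      ∑ X ∈ moves G σ, ∑ Y ∈ moves G τ, regularMass G pStar σ τ v ia ib X Y * F X Y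
      + (2 + (colorNbrs G σ v (σ v)).card + (colorNbrs G σ v (τ v)).card +
        δ * (4 + 2 * ((colorNbrs G σ v (σ v)).card + (colorNbrs G σ v (τ v)).card))) := by
  classical
  have hn : (0 : ℝ) < k * Fintype.card V := by
    have h1 : 0 < Fintype.card V := Fintype.card_pos_iff.2 ⟨v⟩
    have h2 : 0 < k := Fin.pos (σ v)
    positivity
  have hpt : ∀ X ∈ moves G σ, ∀ Y ∈ moves G τ, P X Y * F X Y ≤
      regularMass G pStar σ τ v ia ib X Y * F X Y / (k * Fintype.card V) +
      ((if X ∈ specialMoves G σ v (τ v) then moveCost δ X else 0) * P X Y +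
       (if Y ∈ specialMoves G τ v (σ v) then moveCost δ Y else 0) * P X Y) := by
    intro X hX Y hY
    have hP0 := hP.nonneg X hX Y hY
    by_cases hs : X ∈ specialMoves G σ v (τ v) ∧ Y ∈ specialMoves G τ v (σ v)
    · rw [regularMass_special h hi hX hY hs.1 hs.2, if_pos hs.1, if_pos hs.2]
      have := mul_le_mul_of_nonneg_left (le_moveCost_add h hδ hF hF0 X Y) hP0
      rw [zero_mul, zero_div]
      linarith
    · rw [hP.regular X hX Y hY hs] at hP0 ⊢
      have e1 : 0 ≤ (if X ∈ specialMoves G σ v (τ v) then moveCost δ X else 0) := by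
        split_ifs; exacts [moveCost_nonneg hδ X, le_rfl]
      have e2 : 0 ≤ (if Y ∈ specialMoves G τ v (σ v) then moveCost δ Y else 0) := by
        split_ifs; exacts [moveCost_nonneg hδ Y, le_rfl]
      have := mul_nonneg e1 hP0
      have := mul_nonneg e2 hP0
      rw [div_mul_eq_mul_div]
      linarith
  have hsubσ : specialMoves G σ v (τ v) ⊆ moves G σ := by
    intro X hX
    cases X with
    | none => exact none_mem_moves
    | some K =>
      rcases mem_specialMoves_some.1 hX with hK | hK <;>
      exact some_mem_moves.2 (affected_subset_comps _ (affectedBy_subset_affected _ _ hK))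
  have hsubτ : specialMoves G τ v (σ v) ⊆ moves G τ := by
    intro X hX
    cases X with
    | none => exact none_mem_moves
    | some K =>
      rcases mem_specialMoves_some.1 hX with hK | hK <;>
      exact some_mem_moves.2 (affected_subset_comps _ (affectedBy_subset_affected _ _ hK))
  have hsum := Finset.sum_le_sum fun X hX => Finset.sum_le_sum fun Y hY => hpt X hX Y hY
  simp_rw [Finset.sum_add_distrib, ← Finset.sum_div, ← Finset.mul_sum] at hsum
  have e1 : ∑ X ∈ moves G σ, (if X ∈ specialMoves G σ v (τ v) then moveCost δ X else 0) *
      ∑ Y ∈ moves G τ, P X Y =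
      ∑ X ∈ specialMoves G σ v (τ v), moveCost δ X * moveProb G pStar σ X := by
    rw [← Finset.inter_eq_right.2 hsubσ, ← Finset.sum_ite_mem]
    refine Finset.sum_congr rfl fun X hX => ?_
    rw [hP.fst_law X hX, Finset.inter_eq_right.2 hsubσ, ite_mul, zero_mul]
  have e2 : ∑ X ∈ moves G σ, ∑ Y ∈ moves G τ,
      (if Y ∈ specialMoves G τ v (σ v) then moveCost δ Y else 0) * P X Y =
      ∑ Y ∈ specialMoves G τ v (σ v), moveCost δ Y * moveProb G pStar τ Y := by
    rw [Finset.sum_comm, ← Finset.inter_eq_right.2 hsubτ, ← Finset.sum_ite_mem]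
    refine Finset.sum_congr rfl fun Y hY => ?_
    rw [← Finset.mul_sum, hP.snd_law Y hY, Finset.inter_eq_right.2 hsubτ, ite_mul, zero_mul]
  rw [e1, e2] at hsum
  have hm := mul_le_mul_of_nonneg_left hsum hn.le
  rw [mul_add, mul_add, mul_div_cancel₀ _ hn.ne'] at hm
  have s1 := sum_specialMoves_le (G := G) (v := v) σ τ hδ
  have s2 := sum_specialMoves_le (G := G) (v := v) τ σ hδ
  rw [colorNbrs_eq h, colorNbrs_eq h] at s2
  linarith

end SpecialBound

/-! ### Creation and destruction of extremal neighbors -/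

section Change

variable {V : Type*} [Fintype V] [LinearOrder V] {k : ℕ} {G : SimpleGraph V}
  {φ σ τ : V → Fin k} {v : V}

/-- Connected subsets of a Kempe component, of every size up to that of the component. -/
theorem exists_connected_subset (φ : V → Fin k) (w : V) (d : Fin k) (n : ℕ) :
    ∃ X : Finset V, w ∈ X ∧ X ⊆ kempeSet G φ w d ∧ X.card ≤ n + 1 ∧
      (X = kempeSet G φ w d ∨ X.card = n + 1) ∧
      ∀ ψ : V → Fin k, (∀ x ∈ X, ψ x = φ x) → X ⊆ kempeSet G ψ w d := by
  induction n with
  | zero =>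
    refine ⟨{w}, by simp, by simpa using self_mem_kempeSet w d, by simp, Or.inr (by simp), ?_⟩
    intro ψ _
    simpa using self_mem_kempeSet w d
  | succ n ih =>
    obtain ⟨X, h1, h2, h3, h4, h5⟩ := ih
    by_cases hX : X = kempeSet G φ w d
    · exact ⟨X, h1, h2, by omega, Or.inl hX, h5⟩
    obtain ⟨z, hz, y, hy, ha, he⟩ : ∃ z ∈ X, ∃ y, y ∉ X ∧ G.Adj z y ∧
        s(φ z, φ y) = s(φ w, d) := by
      by_contra hne
      push Not at hne
      refine hX (h2.antisymm fun x hx => ?_)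
      refine kempeSet_induction (G := G) (φ := φ) (u := w) (c := d) (p := fun x => x ∈ X) h1 ?_ x hx
      intro x y _ hxX hxy hc
      by_contra hyX
      exact hne x hxX y hyX hxy hc
    have hcard : (insert y X).card = n + 2 := by
      rw [Finset.card_insert_of_notMem hy]
      rcases h4 with h4 | h4
      · exact absurd h4 hX
      · omega
    refine ⟨insert y X, Finset.mem_insert_of_mem h1, ?_, hcard.le, Or.inr hcard, ?_⟩
    · exact Finset.insert_subset (mem_kempeSet_of_adj (h2 hz) ha he) h2
    · intro ψ hψ
      have hψX : ∀ x ∈ X, ψ x = φ x := fun x hx => hψ x (Finset.mem_insert_of_mem hx)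
      have h6 := h5 ψ hψX
      refine Finset.insert_subset (mem_kempeSet_of_adj (h6 hz) ha ?_) h6
      rw [hψX z hz, hψX w h1, hψ y (Finset.mem_insert_self _ _), he]

/-- Few flips outside a bounded set turn a component into a different one of size at most `3`. -/
theorem exists_change_cover [DecidableRel G.Adj] (φ : V → Fin k) (w : V) (d : Fin k) :
    ∃ (X : Finset V) (F : Finset (Comp V k)), X.card ≤ 4 ∧ F.card ≤ 4 * G.maxDegree ∧
      ∀ K ∈ comps G φ, (∀ x ∈ X, x ∉ K.2) →
        kempeSet G (flipComp φ K) w d ≠ kempeSet G φ w d →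
        (kempeSet G (flipComp φ K) w d).card ≤ 3 → K ∈ F := by
  classical
  -- Four connected vertices avoided by `K` would survive in the new component and make it too
  -- large. So `X` is the whole old component, and a change means growth across an edge leaving `X`.
  obtain ⟨X, h1, h2, h3, h4, h5⟩ := exists_connected_subset (G := G) φ w d 3
  refine ⟨X, X.biUnion fun z => (G.neighborFinset z).image fun y =>
    kempe G φ y (if φ z = φ w then d else φ w), h3, ?_, ?_⟩
  · refine Finset.card_biUnion_le.trans ?_
    calc _ ≤ ∑ z ∈ X, G.maxDegree := Finset.sum_le_sum fun z _ =>
          Finset.card_image_le.trans (G.degree_le_maxDegree z)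
      _ ≤ _ := by
          rw [Finset.sum_const, smul_eq_mul]
          exact Nat.mul_le_mul_right _ h3
  intro K hK hKX hne hcard
  have hag : ∀ x ∈ X, flipComp φ K x = φ x := fun x hx => flipComp_of_notMem (hKX x hx)
  have hsub := h5 _ hag
  have hXT : X = kempeSet G φ w d := by
    rcases h4 with h4 | h4
    · exact h4
    · have := Finset.card_le_card hsub
      omega
  obtain ⟨z, hz, y, hy, ha, he⟩ : ∃ z ∈ X, ∃ y, y ∉ X ∧ G.Adj z y ∧
      s(flipComp φ K z, flipComp φ K y) = s(flipComp φ K w, d) := by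
    by_contra hno
    push Not at hno
    refine hne (Finset.Subset.antisymm ?_ (hXT ▸ hsub))
    rw [← hXT]
    intro x hx
    refine kempeSet_induction (G := G) (φ := flipComp φ K) (u := w) (c := d)
      (p := fun x => x ∈ X) h1 ?_ x hx
    intro x y _ hxX hxy hc
    by_contra hyX
    exact hno x hxX y hyX hxy hc
  rw [hag z hz, hag w h1] at he
  -- The joining vertex `y` was recolored, and its new color is forced by `z`; a vertex with its new
  -- color determines `K`.
  have hyK : y ∈ K.2 := by
    by_contra hyK
    rw [flipComp_of_notMem hyK] at he
    exact hy (hXT ▸ mem_kempeSet_of_adj (hXT ▸ hz) ha he)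
  have hcol : flipComp φ K y = if φ z = φ w then d else φ w := by
    rcases Sym2.eq_iff.1 he with ⟨e1, e2⟩ | ⟨e1, e2⟩
    · rw [if_pos e1, e2]
    · split_ifs with e
      · rw [e2, ← e, e1]
      · exact e2
  refine Finset.mem_biUnion.2 ⟨z, hz, Finset.mem_image.2 ⟨y, by simpa using ha, ?_⟩⟩
  rw [← hcol]
  exact kempe_flipComp hK hyK

theorem entry_congr {ψ : V → Fin k} {d : Fin k} {W : Finset V} {w : V}
    (h : kempeSet G ψ w d = kempeSet G φ w d) : entry G ψ d W w = entry G φ d W w := by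
  unfold entry; rw [h]

theorem extremalEntries_congr {W : Finset V} {a b a' b' : V → ℕ} (ha : ∀ w ∈ W, a' w = a w)
    (hb : ∀ w ∈ W, b' w = b w) (h : ExtremalEntries W a' b') : ExtremalEntries W a b := by
  unfold ExtremalEntries at h ⊢
  refine h.imp (fun h => ⟨h.1, h.2.imp ?_ ?_⟩) (fun h => ⟨h.1, h.2.imp ?_ ?_⟩) <;>
  exact fun h w hw => by rw [← ha w hw, ← hb w hw]; exact h w hw

theorem ExtremalEntries.bounds {W : Finset V} {a b : V → ℕ} (h : ExtremalEntries W a b) :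
    W.card ≤ 2 ∧ ∀ w ∈ W, 1 ≤ a w ∧ a w ≤ 3 ∧ 1 ≤ b w ∧ b w ≤ 3 := by
  rcases h with ⟨h1, h2 | h2⟩ | ⟨h1, h2 | h2⟩ <;>
  exact ⟨by omega, fun w hw => by have := h2 w hw; omega⟩

theorem ExtremalEntries.symm {W : Finset V} {a b : V → ℕ} (h : ExtremalEntries W a b) :
    ExtremalEntries W b a := by
  rcases h with ⟨h1, h2 | h2⟩ | ⟨h1, h2 | h2⟩
  · exact Or.inl ⟨h1, Or.inr fun w hw => (h2 w hw).symm⟩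
  · exact Or.inl ⟨h1, Or.inl fun w hw => (h2 w hw).symm⟩
  · exact Or.inr ⟨h1, Or.inr fun w hw => (h2 w hw).symm⟩
  · exact Or.inr ⟨h1, Or.inl fun w hw => (h2 w hw).symm⟩

theorem isExtremal_swap (h : DiffAt σ τ v) {c : Fin k} :
    IsExtremal G τ σ v c ↔ IsExtremal G σ τ v c := by
  rw [isExtremal_iff, isExtremal_iff, aEntry_swap h, bEntry_swap h, colorNbrs_eq h]
  exact ⟨ExtremalEntries.symm, ExtremalEntries.symm⟩

theorem extNbrs_swap (h : DiffAt σ τ v) : extNbrs G τ σ v = extNbrs G σ τ v := by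
  ext w
  rw [mem_extNbrs, mem_extNbrs]
  refine and_congr_right fun hw => ?_
  rw [isExtremal_swap h, h.2 w hw.ne']

/-- The neighbors of `v` that are extremal after flipping `K`. -/
noncomputable def extAfter (G : SimpleGraph V) (σ τ : V → Fin k) (v : V) (K : Comp V k) :
    Finset V := extNbrs G (flipComp σ K) (flipComp τ K) v

/-- The unaffected components. -/
noncomputable def unaffected (G : SimpleGraph V) (σ τ : V → Fin k) (v : V) :
    Finset (Comp V k) := by
  classical
  exact comps G σ \ affected G σ v (τ v)

theorem mem_unaffected {K : Comp V k} : K ∈ unaffected G σ τ v ↔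
    K ∈ comps G σ ∧ K ∉ affected G σ v (τ v) := by
  classical
  unfold unaffected
  rw [Finset.mem_sdiff]

theorem unaffected_swap (h : DiffAt σ τ v) : unaffected G τ σ v = unaffected G σ τ v := by
  classical
  have := unaffected_eq (G := G) h
  unfold unaffected
  convert this

theorem notMem_of_mem_unaffected {K : Comp V k} (hK : K ∈ unaffected G σ τ v) : v ∉ K.2 :=
  notMem_of_notMem_affected (mem_unaffected.1 hK).1 (mem_unaffected.1 hK).2

/-- The flips that make a neighbor of `v` extremal meet a bounded set or belong to a small
family. -/
theorem exists_create_cover [DecidableRel G.Adj] (h : DiffAt σ τ v) {w : V} (hvw : G.Adj v w)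
    (hw : w ∉ extNbrs G σ τ v) :
    ∃ (X : Finset V) (F : Finset (Comp V k)), X.card ≤ 18 ∧ F.card ≤ 17 * G.maxDegree ∧
      ∀ K ∈ unaffected G σ τ v, w ∈ extAfter G σ τ v K → (∃ x ∈ X, x ∈ K.2) ∨ K ∈ F := by
  classical
  set c := σ w with hc
  set W := colorNbrs G σ v c with hWdef
  have hwW : w ∈ W := mem_colorNbrs.2 ⟨hvw, rfl⟩
  have hstay : ∀ K : Comp V k, ∀ x ∈ W, x ∉ K.2 → x ∈ colorNbrs G (flipComp σ K) v c := by
    intro K x hx hxK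
    obtain ⟨h1, h2⟩ := mem_colorNbrs.1 hx
    exact mem_colorNbrs.2 ⟨h1, by rw [flipComp_of_notMem hxK, h2]⟩
  -- Three neighbors of color `c` that stay unflipped rule out an extremal configuration.
  rcases Nat.lt_or_ge 2 W.card with hbig | hsmall
  · obtain ⟨X, hX1, hX2, hX3⟩ : ∃ X : Finset V, X ⊆ W ∧ w ∈ X ∧ X.card = 3 := by
      obtain ⟨X, h1, h2, h3⟩ := Finset.exists_subsuperset_card_eq
        (Finset.singleton_subset_iff.2 hwW) (by simp) hbig
      exact ⟨X, h2, Finset.singleton_subset_iff.1 h1, h3⟩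
    refine ⟨X, ∅, by omega, by simp, fun K hK hext => Or.inl ?_⟩
    by_contra hno
    push Not at hno
    obtain ⟨-, hE⟩ := mem_extNbrs.1 hext
    rw [flipComp_of_notMem (hno w hX2), ← hc, isExtremal_iff] at hE
    have hb := hE.bounds.1
    have := Finset.card_le_card fun x hx => hstay K x (hX1 hx) (hno x hx)
    omega
  · choose Xa Fa hXa hFa hca using fun x => exists_change_cover (G := G) τ x (σ v)
    choose Xb Fb hXb hFb hcb using fun x => exists_change_cover (G := G) σ x (τ v)
    -- At most `2 + 2 · 8` vertices and `Δ + 2 · 8 Δ` components. They cover the flips that touch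
    -- `W`, give a new neighbor of `v` the color `c`, or change a recorded component into one of
    -- size at most `3`.
    refine ⟨W ∪ W.biUnion fun x => Xa x ∪ Xb x,
      ((G.neighborFinset v).image fun x => kempe G σ x c) ∪ W.biUnion fun x => Fa x ∪ Fb x,
      ?_, ?_, ?_⟩
    · have h1 : (W.biUnion fun x => Xa x ∪ Xb x).card ≤ W.card * 8 :=
        Finset.card_biUnion_le_card_mul _ _ _ fun x _ =>
          (Finset.card_union_le _ _).trans (by have := hXa x; have := hXb x; omega)
      have := Finset.card_union_le W (W.biUnion fun x => Xa x ∪ Xb x)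
      omega
    · have h1 : (W.biUnion fun x => Fa x ∪ Fb x).card ≤ W.card * (8 * G.maxDegree) :=
        Finset.card_biUnion_le_card_mul _ _ _ fun x _ =>
          (Finset.card_union_le _ _).trans (by have := hFa x; have := hFb x; omega)
      have h2 : ((G.neighborFinset v).image fun x => kempe G σ x c).card ≤ G.maxDegree :=
        Finset.card_image_le.trans (G.degree_le_maxDegree v)
      have h3 : W.card * (8 * G.maxDegree) ≤ 2 * (8 * G.maxDegree) :=
        Nat.mul_le_mul_right _ hsmall
      have := Finset.card_union_le ((G.neighborFinset v).image fun x => kempe G σ x c)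
        (W.biUnion fun x => Fa x ∪ Fb x)
      omega
    intro K hK hext
    by_contra hno
    push Not at hno
    obtain ⟨hno1, hno2⟩ := hno
    simp only [Finset.mem_union, Finset.mem_biUnion, not_or, not_exists, not_and] at hno1 hno2
    have hKW : ∀ x ∈ W, x ∉ K.2 := fun x hx => hno1 x (Or.inl hx)
    have hKv := notMem_of_mem_unaffected hK
    have hKσ := (mem_unaffected.1 hK).1
    have hKτ : K ∈ comps G τ := by
      rw [← unaffected_swap h] at hK; exact (mem_unaffected.1 hK).1
    have hW' : colorNbrs G (flipComp σ K) v c = W := by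
      refine Finset.Subset.antisymm (fun x hx => ?_) fun x hx => hstay K x hx (hKW x hx)
      obtain ⟨h1, h2⟩ := mem_colorNbrs.1 hx
      by_cases hxK : x ∈ K.2
      · refine absurd (Finset.mem_image.2 ⟨x, by simpa using h1, ?_⟩) hno2.1
        rw [← h2]
        exact kempe_flipComp hKσ hxK
      · rw [flipComp_of_notMem hxK] at h2
        exact mem_colorNbrs.2 ⟨h1, h2⟩
    obtain ⟨-, hE⟩ := mem_extNbrs.1 hext
    rw [flipComp_of_notMem (hKW w hwW), isExtremal_iff] at hE
    rw [← hc, hW'] at hE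
    -- Extremal entries lie between `1` and `3`, so the components after the flip are small enough
    -- for the covers to apply.
    have hbd := hE.bounds.2
    have ha : ∀ x ∈ W, aEntry G (flipComp σ K) (flipComp τ K) v c x = aEntry G σ τ v c x := by
      intro x hx
      have hx' := hbd x hx
      unfold aEntry at hx' ⊢
      rw [hW', flipComp_of_notMem hKv] at hx' ⊢
      refine entry_congr (by_contra fun hne => (hno2.2 x hx).1 ?_)
      refine hca x K hKτ (fun y hy hyK => hno1 y (Or.inr ⟨x, hx, Or.inl hy⟩) hyK) hne ?_
      rcases entry_eq_zero_or (G := G) (φ := flipComp τ K) W (σ v) x with e | e <;> omega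
    have hb : ∀ x ∈ W, bEntry G (flipComp σ K) (flipComp τ K) v c x = bEntry G σ τ v c x := by
      intro x hx
      have hx' := hbd x hx
      unfold bEntry at hx' ⊢
      rw [hW', flipComp_of_notMem hKv] at hx' ⊢
      refine entry_congr (by_contra fun hne => (hno2.2 x hx).2 ?_)
      refine hcb x K hKσ (fun y hy hyK => hno1 y (Or.inr ⟨x, hx, Or.inr hy⟩) hyK) hne ?_
      rcases entry_eq_zero_or (G := G) (φ := flipComp σ K) W (τ v) x with e | e <;> omega
    exact hw (mem_extNbrs.2 ⟨hvw, isExtremal_iff.2 (extremalEntries_congr ha hb hE)⟩)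

theorem card_comps_filter_mem_le (x : V) :
    ((comps G φ).filter fun K => x ∈ K.2).card ≤ k := by
  classical
  have hsub : (comps G φ).filter (fun K => x ∈ K.2) ⊆
      (Finset.univ : Finset (Fin k)).image fun d => kempe G φ x d := by
    intro K hK
    obtain ⟨h1, h2⟩ := Finset.mem_filter.1 hK
    obtain ⟨d, hd⟩ := exists_kempe_eq_of_mem h1 h2
    exact Finset.mem_image.2 ⟨d, Finset.mem_univ _, hd⟩
  exact (Finset.card_le_card hsub).trans (Finset.card_image_le.trans (by simp))

theorem sum_create_le [DecidableRel G.Adj] (h : DiffAt σ τ v) {w : V} (hvw : G.Adj v w)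
    (hw : w ∉ extNbrs G σ τ v) :
    ∑ K ∈ (unaffected G σ τ v).filter (fun K => w ∈ extAfter G σ τ v K), pStar K.2.card ≤
      18 * k + 17 * G.maxDegree := by
  classical
  obtain ⟨X, F, hX, hF, hcov⟩ := exists_create_cover h hvw hw
  have hsub : (unaffected G σ τ v).filter (fun K => w ∈ extAfter G σ τ v K) ⊆
      (X.biUnion fun x => (comps G σ).filter fun K => x ∈ K.2) ∪ F := by
    intro K hK
    obtain ⟨h1, h2⟩ := Finset.mem_filter.1 hK
    rcases hcov K h1 h2 with ⟨x, hx, hxK⟩ | hKF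
    · exact Finset.mem_union_left _ (Finset.mem_biUnion.2
        ⟨x, hx, Finset.mem_filter.2 ⟨(mem_unaffected.1 h1).1, hxK⟩⟩)
    · exact Finset.mem_union_right _ hKF
  have hcard : ((unaffected G σ τ v).filter (fun K => w ∈ extAfter G σ τ v K)).card ≤
      18 * k + 17 * G.maxDegree := by
    refine (Finset.card_le_card hsub).trans ((Finset.card_union_le _ _).trans (add_le_add ?_ hF))
    exact (Finset.card_biUnion_le_card_mul _ _ _ fun x _ => card_comps_filter_mem_le x).trans
      (Nat.mul_le_mul_right _ hX)
  calc _ ≤ ∑ K ∈ (unaffected G σ τ v).filter (fun K => w ∈ extAfter G σ τ v K), (1 : ℝ) :=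
        Finset.sum_le_sum fun K _ => pStar_le_one _
    _ ≤ _ := by simpa using (by exact_mod_cast hcard :
        ((((unaffected G σ τ v).filter (fun K => w ∈ extAfter G σ τ v K)).card : ℕ) : ℝ) ≤
          18 * k + 17 * G.maxDegree)

theorem exists_adj_of_two_le {w : V} {d : Fin k} (h : 2 ≤ (kempeSet G φ w d).card) :
    ∃ u, G.Adj w u ∧ s(φ w, φ u) = s(φ w, d) := by
  by_contra hne
  push Not at hne
  have : kempeSet G φ w d ⊆ {w} := by
    intro x hx
    rw [Finset.mem_singleton]
    refine kempeSet_induction (G := G) (φ := φ) (u := w) (c := d) (p := fun x => x = w) rfl ?_ x hx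
    rintro x y _ rfl hxy hc
    exact absurd hc (hne y hxy)
  have := Finset.card_le_card this
  simp at this
  omega

/-- Some neighbor `u` of `w₁` lies in `S_τ(w₁, σ v)`. Recoloring `u` alone by a color missing around
it lowers the entry `a` at `w₁` and keeps `W` and the entry `b` there. In an extremal configuration
`r` and `b` determine `a`, so the configuration is lost, and each such color has mass `p_1 = 1`. -/
theorem sum_destroy_ge_aux [DecidableRel G.Adj] (h : DiffAt σ τ v) {c : Fin k} (hcs : c ≠ σ v)
    (hE : IsExtremal G σ τ v c) {w₁ : V} (hw₁ : w₁ ∈ colorNbrs G σ v c)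
    (ha : 2 ≤ aEntry G σ τ v c w₁) {w : V} (hw : w ∈ colorNbrs G σ v c) :
    (k : ℝ) - G.maxDegree - 2 ≤
    ∑ K ∈ (unaffected G σ τ v).filter (fun K => w ∉ extAfter G σ τ v K), pStar K.2.card := by
  classical
  have hacard : aEntry G σ τ v c w₁ = (kempeSet G τ w₁ (σ v)).card := by
    rcases entry_eq_zero_or (G := G) (φ := τ) (colorNbrs G σ v c) (σ v) w₁ with e | e
    · unfold aEntry at ha; omega
    · exact e
  obtain ⟨u, hu1, hu2⟩ := exists_adj_of_two_le (hacard ▸ ha)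
  have hu2 : τ u = σ v := Sym2.congr_right.1 hu2
  have huv : u ≠ v := fun e => h.1 (by rw [← hu2, e])
  have hu3 : σ u = σ v := by rw [h.2 u huv, hu2]
  obtain ⟨hw₁v, hw₁c⟩ := mem_colorNbrs.1 hw₁
  have hcolne : ∀ x, σ x = c → x ≠ u := fun x hx e => hcs (by rw [← hx, e, hu3])
  -- A color missing around `u` makes `{u}` a component; excluding `τ v` keeps it out of `𝒜_σ`, and
  -- excluding `σ v` makes the flip a real change.
  set good : Finset (Fin k) :=
    Finset.univ \ ((G.neighborFinset u).image σ ∪ {σ v, τ v}) with hgood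
  have hgcard : (k : ℝ) - G.maxDegree - 2 ≤ good.card := by
    have h1 : ((G.neighborFinset u).image σ ∪ {σ v, τ v}).card ≤ G.maxDegree + 2 :=
      (Finset.card_union_le _ _).trans (add_le_add
        (Finset.card_image_le.trans (G.degree_le_maxDegree u)) Finset.card_le_two)
    have h2 := Finset.le_card_sdiff ((G.neighborFinset u).image σ ∪ {σ v, τ v})
      (Finset.univ : Finset (Fin k))
    rw [← hgood, Finset.card_fin] at h2
    have h3 : k ≤ good.card + (G.maxDegree + 2) := by omega
    have h4 := Nat.cast_le (α := ℝ).2 h3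
    push_cast at h4
    linarith
  have hmemgood : ∀ d ∈ good, (∀ y, G.Adj u y → σ y ≠ d) ∧ d ≠ σ v ∧ d ≠ τ v := by
    intro d hd
    simp only [hgood, Finset.mem_sdiff, Finset.mem_univ, true_and, Finset.mem_union,
      Finset.mem_image, SimpleGraph.mem_neighborFinset, Finset.mem_insert, Finset.mem_singleton,
      not_or, not_exists, not_and] at hd
    exact ⟨hd.1, hd.2⟩
  have hset : ∀ d ∈ good, kempeSet G σ u d = {u} := by
    intro d hd
    obtain ⟨h1, h2, h3⟩ := hmemgood d hd
    refine Finset.Subset.antisymm (fun x hx => ?_) (by simpa using self_mem_kempeSet u d)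
    rw [Finset.mem_singleton]
    refine kempeSet_induction (G := G) (φ := σ) (u := u) (c := d) (p := fun x => x = u) rfl ?_ x hx
    rintro x y _ rfl hxy hc
    exact absurd (Sym2.congr_right.1 hc) (h1 y hxy)
  have hunaff : ∀ d ∈ good, kempe G σ u d ∈ unaffected G σ τ v := by
    intro d hd
    obtain ⟨h1, h2, h3⟩ := hmemgood d hd
    refine mem_unaffected.2 ⟨kempe_mem_comps u d, fun hA => ?_⟩
    rcases mem_affected.1 hA with ⟨e, he⟩ | ⟨x, hx, he⟩
    · have := congrArg Prod.snd he
      simp only [kempe_snd, hset d hd] at this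
      have hv : v ∈ ({u} : Finset V) := this ▸ self_mem_kempeSet v e
      exact huv (Finset.mem_singleton.1 hv).symm
    · have := congrArg Prod.fst he
      simp only [kempe_fst] at this
      have ht : τ v ∈ s(σ u, d) := this ▸ by simp
      rw [hu3] at ht
      rcases Sym2.mem_iff.1 ht with e | e
      · exact h.1 e.symm
      · exact h3 e.symm
  have hdest : ∀ d ∈ good, w ∉ extAfter G σ τ v (kempe G σ u d) := by
    intro d hd hext
    obtain ⟨h1, h2, h3⟩ := hmemgood d hd
    have hdc : d ≠ c := fun e => h1 w₁ hu1.symm (by rw [hw₁c, e])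
    set K := kempe G σ u d with hK
    have hK2 : K.2 = {u} := hset d hd
    have hσ' : ∀ x, x ≠ u → flipComp σ K x = σ x := fun x hx =>
      flipComp_of_notMem (by simpa [hK2] using hx)
    have hτ' : ∀ x, x ≠ u → flipComp τ K x = τ x := fun x hx =>
      flipComp_of_notMem (by simpa [hK2] using hx)
    have hσu : flipComp σ K u = d := flipComp_kempe_self u d
    have hD := h.flipComp (K := K) (by simpa [hK2] using huv.symm)
    have hτu : flipComp τ K u = d := by rw [← hD.2 u huv, hσu]
    have hW : colorNbrs G (flipComp σ K) v c = colorNbrs G σ v c := by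
      ext x
      rw [mem_colorNbrs, mem_colorNbrs]
      refine and_congr_right fun _ => ?_
      by_cases hx : x = u
      · rw [hx, hσu, hu3]; exact ⟨fun e => absurd e hdc, fun e => absurd e.symm hcs⟩
      · rw [hσ' x hx]
    obtain ⟨-, hE'⟩ := mem_extNbrs.1 hext
    rw [hσ' w (hcolne w (mem_colorNbrs.1 hw).2), (mem_colorNbrs.1 hw).2, isExtremal_iff, hW] at hE'
    rw [isExtremal_iff] at hE
    have hb : bEntry G (flipComp σ K) (flipComp τ K) v c w₁ = bEntry G σ τ v c w₁ := by
      unfold bEntry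
      rw [hW, hτ' v huv.symm]
      have hw₁u := hcolne w₁ hw₁c
      refine entry_congr (Finset.Subset.antisymm ?_ ?_)
      · refine kempeSet_subset_of_agree fun x hx => hσ' x fun e => ?_
        rw [e] at hx
        have := color_eq_or_of_mem_kempeSet hx
        rw [hσu, hσ' w₁ hw₁u, hw₁c] at this
        exact this.elim hdc h3
      · refine kempeSet_subset_of_agree fun x hx => (hσ' x fun e => ?_).symm
        rw [e] at hx
        have := color_eq_or_of_mem_kempeSet hx
        rw [hu3, hw₁c] at this
        exact this.elim (fun e => hcs e.symm) h.1
    have hlt : aEntry G (flipComp σ K) (flipComp τ K) v c w₁ < aEntry G σ τ v c w₁ := by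
      have hcd : (kempeSet G (flipComp τ K) w₁ (σ v)).card < (kempeSet G τ w₁ (σ v)).card := by
        have hw₁u := hcolne w₁ hw₁c
        have hnu : ∀ x ∈ kempeSet G (flipComp τ K) w₁ (σ v), x ≠ u := by
          rintro x hx rfl
          have := color_eq_or_of_mem_kempeSet hx
          rw [hτu, hτ' w₁ hw₁u, ← h.2 w₁ hw₁v.ne', hw₁c] at this
          exact this.elim hdc h2
        refine Finset.card_lt_card ⟨?_, fun hss => ?_⟩
        · exact kempeSet_subset_of_agree fun x hx => hτ' x (hnu x hx)
        · refine hnu u (hss (mem_kempeSet_of_adj (self_mem_kempeSet _ _) hu1 ?_)) rfl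
          rw [hu2]
      rw [hacard]
      rcases entry_eq_zero_or (G := G) (φ := flipComp τ K) (colorNbrs G σ v c) (σ v) w₁ with e | e
      · unfold aEntry
        rw [hW, hσ' v huv.symm, e]
        exact one_le_card_kempeSet _ _
      · unfold aEntry
        rw [hW, hσ' v huv.symm, e]
        exact hcd
    rcases hE with ⟨c1, e1 | e1⟩ | ⟨c1, e1 | e1⟩ <;>
    rcases hE' with ⟨c2, e2 | e2⟩ | ⟨c2, e2 | e2⟩ <;>
    · have f1 := e1 w₁ hw₁
      have f2 := e2 w₁ hw₁
      omega
  have hinj : Set.InjOn (fun d => kempe G σ u d) good := by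
    intro d _ e _ hde
    exact Sym2.congr_right.1 (congrArg Prod.fst hde)
  calc (k : ℝ) - G.maxDegree - 2 ≤ good.card := hgcard
    _ = ∑ K ∈ good.image (fun d => kempe G σ u d), pStar K.2.card := by
        rw [Finset.sum_image hinj, Finset.sum_congr rfl fun d hd => by rw [kempe_snd, hset d hd]]
        simp [pStar]
    _ ≤ _ := by
        refine Finset.sum_le_sum_of_subset_of_nonneg ?_ fun K _ _ => pStar_nonneg _
        intro K hK
        obtain ⟨d, hd, rfl⟩ := Finset.mem_image.1 hK
        exact Finset.mem_filter.2 ⟨hunaff d hd, hdest d hd⟩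

/-- One of the entries at an extremal neighbor is at least `2`; if it is `b`, the chains are
exchanged. -/
theorem sum_destroy_ge [DecidableRel G.Adj] (h : DiffAt σ τ v) {w : V}
    (hw : w ∈ extNbrs G σ τ v) (hcs : σ w ≠ σ v) (hct : σ w ≠ τ v) :
    (k : ℝ) - G.maxDegree - 2 ≤
    ∑ K ∈ (unaffected G σ τ v).filter (fun K => w ∉ extAfter G σ τ v K), pStar K.2.card := by
  classical
  obtain ⟨hvw, hE⟩ := mem_extNbrs.1 hw
  have hwW : w ∈ colorNbrs G σ v (σ w) := mem_colorNbrs.2 ⟨hvw, rfl⟩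
  have hcase : 2 ≤ aEntry G σ τ v (σ w) w ∨ 2 ≤ bEntry G σ τ v (σ w) w := by
    rcases isExtremal_iff.1 hE with ⟨_, e | e⟩ | ⟨_, e | e⟩ <;>
    · have := e w hwW; omega
  rcases hcase with ha | hb
  · exact sum_destroy_ge_aux h hcs hE hwW ha hwW
  · have hsw := colorNbrs_eq (G := G) h (σ w)
    have := sum_destroy_ge_aux h.symm hct ((isExtremal_swap h).2 hE) (hsw ▸ hwW)
      (by rw [aEntry_swap h]; exact hb) (hsw ▸ hwW)
    rw [unaffected_swap h] at this
    refine this.trans (le_of_eq ?_)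
    refine Finset.sum_congr (Finset.filter_congr fun K hK => ?_) fun _ _ => rfl
    unfold extAfter
    rw [extNbrs_swap (h.flipComp (notMem_of_mem_unaffected hK))]

end Change

/-! ### Summing all contributions -/

section Total

variable {V : Type*} [Fintype V] [LinearOrder V] {k : ℕ} {G : SimpleGraph V}
  {φ σ τ : V → Fin k} {v : V} {ia ib : Fin k → V}

/-- The number of extremal neighbors changes by the created minus the destroyed ones. -/
theorem card_extAfter_sub [DecidableRel G.Adj] (K : Comp V k) :
    ((extAfter G σ τ v K).card : ℝ) - (extNbrs G σ τ v).card =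
      ∑ w ∈ G.neighborFinset v \ extNbrs G σ τ v, (if w ∈ extAfter G σ τ v K then 1 else 0)
      - ∑ w ∈ extNbrs G σ τ v, (if w ∉ extAfter G σ τ v K then 1 else 0) := by
  classical
  have h1 : ((extAfter G σ τ v K).card : ℝ) =
      ∑ w ∈ G.neighborFinset v, (if w ∈ extAfter G σ τ v K then (1 : ℝ) else 0) := by
    have hsub : extAfter G σ τ v K ⊆ G.neighborFinset v := extNbrs_subset
    rw [Finset.sum_ite_mem, Finset.inter_eq_right.2 hsub]
    simp
  rw [h1, ← Finset.sum_sdiff (extNbrs_subset (G := G) (σ := σ) (τ := τ) (v := v)), add_sub_assoc,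
    sub_eq_add_neg _ (∑ w ∈ extNbrs G σ τ v, _)]
  congr 1
  rw [Finset.card_eq_sum_ones, Nat.cast_sum, ← Finset.sum_sub_distrib, ← Finset.sum_neg_distrib]
  refine Finset.sum_congr rfl fun w _ => ?_
  split_ifs <;> simp_all

/-- A color with an extremal configuration has at most two neighbors. These vertices escape the
destruction bound and cause the `-4` in `drift_le`. -/
theorem card_special_extNbrs_le :
    ((extNbrs G σ τ v).filter fun w => σ w = σ v ∨ σ w = τ v).card ≤ 4 := by
  classical
  have key : ∀ c, ((extNbrs G σ τ v).filter fun w => σ w = c).card ≤ 2 := by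
    intro c
    rcases ((extNbrs G σ τ v).filter fun w => σ w = c).eq_empty_or_nonempty with h | ⟨w, hw⟩
    · rw [h]; simp
    · obtain ⟨h1, h2⟩ := Finset.mem_filter.1 hw
      have hE := (mem_extNbrs.1 h1).2
      rw [h2, isExtremal_iff] at hE
      refine (Finset.card_le_card fun x hx => ?_).trans hE.bounds.1
      obtain ⟨h3, h4⟩ := Finset.mem_filter.1 hx
      exact mem_colorNbrs.2 ⟨(mem_extNbrs.1 h3).1, h4⟩
  rw [Finset.filter_or]
  refine (Finset.card_union_le _ _).trans ?_
  have := key (σ v)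
  have := key (τ v)
  omega

/-- The drift of the number of extremal neighbors under the unaffected moves. -/
theorem drift_le [DecidableRel G.Adj] (h : DiffAt σ τ v) (hk : (0 : ℝ) ≤ k - G.maxDegree - 2) :
    ∑ K ∈ unaffected G σ τ v,
      pStar K.2.card * (((extAfter G σ τ v K).card : ℝ) - (extNbrs G σ τ v).card) ≤
    (G.maxDegree - (extNbrs G σ τ v).card) * (18 * k + 17 * G.maxDegree)
      - ((extNbrs G σ τ v).card - 4) * (k - G.maxDegree - 2) := by
  classical
  simp_rw [card_extAfter_sub, mul_sub, Finset.mul_sum, Finset.sum_sub_distrib]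
  -- From here on the change is counted by vertices instead of by components.
  rw [Finset.sum_comm, Finset.sum_comm (s := unaffected G σ τ v) (t := extNbrs G σ τ v)]
  simp_rw [mul_ite, mul_one, mul_zero, ← Finset.sum_filter]
  have h1 : ∑ w ∈ G.neighborFinset v \ extNbrs G σ τ v,
      ∑ K ∈ (unaffected G σ τ v).filter (fun K => w ∈ extAfter G σ τ v K), pStar K.2.card ≤
      (G.maxDegree - (extNbrs G σ τ v).card) * (18 * k + 17 * G.maxDegree) := by
    calc _ ≤ ∑ w ∈ G.neighborFinset v \ extNbrs G σ τ v, (18 * k + 17 * G.maxDegree : ℝ) := by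
          refine Finset.sum_le_sum fun w hw => ?_
          obtain ⟨h1, h2⟩ := Finset.mem_sdiff.1 hw
          exact sum_create_le h (by simpa using h1) h2
      _ ≤ _ := by
          rw [Finset.sum_const, nsmul_eq_mul, Finset.card_sdiff_of_subset extNbrs_subset]
          refine mul_le_mul_of_nonneg_right ?_ (by positivity)
          rw [Nat.cast_sub (Finset.card_le_card extNbrs_subset)]
          have : ((G.neighborFinset v).card : ℝ) ≤ G.maxDegree := by
            exact_mod_cast G.degree_le_maxDegree v
          linarith
  have h2 : ((extNbrs G σ τ v).card - 4) * (k - G.maxDegree - 2 : ℝ) ≤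
      ∑ w ∈ extNbrs G σ τ v,
      ∑ K ∈ (unaffected G σ τ v).filter (fun K => w ∉ extAfter G σ τ v K), pStar K.2.card := by
    set A := (extNbrs G σ τ v).filter fun w => ¬ (σ w = σ v ∨ σ w = τ v) with hA
    have hcard : ((extNbrs G σ τ v).card : ℝ) - 4 ≤ A.card := by
      have e1 : ((extNbrs G σ τ v).filter fun w => σ w = σ v ∨ σ w = τ v).card + A.card =
          (extNbrs G σ τ v).card := by
        rw [hA]
        convert Finset.card_filter_add_card_filter_not (s := extNbrs G σ τ v)
          (fun w => σ w = σ v ∨ σ w = τ v)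
      have e2 := card_special_extNbrs_le (G := G) (σ := σ) (τ := τ) (v := v)
      have e3 : (extNbrs G σ τ v).card ≤ A.card + 4 := by omega
      have e4 := Nat.cast_le (α := ℝ).2 e3
      push_cast at e4
      linarith
    calc _ ≤ (A.card : ℝ) * (k - G.maxDegree - 2 : ℝ) := mul_le_mul_of_nonneg_right hcard hk
      _ = ∑ w ∈ A, (k - G.maxDegree - 2 : ℝ) := by
          rw [Finset.sum_const, nsmul_eq_mul]
      _ ≤ ∑ w ∈ A, ∑ K ∈ (unaffected G σ τ v).filter (fun K => w ∉ extAfter G σ τ v K),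
            pStar K.2.card := by
          refine Finset.sum_le_sum fun w hw => ?_
          obtain ⟨h1, h2⟩ := Finset.mem_filter.1 hw
          push Not at h2
          exact sum_destroy_ge h h1 h2.1 h2.2
      _ ≤ _ := Finset.sum_le_sum_of_subset_of_nonneg (Finset.filter_subset _ _) fun w _ _ =>
          Finset.sum_nonneg fun K _ => pStar_nonneg _
  linarith

theorem sum_card_colorNbrs_le [DecidableRel G.Adj] (h : DiffAt σ τ v) :
    (∑ c ∈ otherColors σ τ v, ((colorNbrs G σ v c).card : ℝ)) +
      (colorNbrs G σ v (σ v)).card + (colorNbrs G σ v (τ v)).card ≤ G.maxDegree := by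
  classical
  have hs := sum_colorNbrs (G := G) (φ := σ) (v := v) Finset.univ (fun _ => (1 : ℝ))
  simp only [Finset.sum_const, nsmul_eq_mul, mul_one, Finset.mem_univ, Finset.filter_true] at hs
  have hd : (((G.neighborFinset v).card : ℕ) : ℝ) ≤ G.maxDegree := by
    exact_mod_cast G.degree_le_maxDegree v
  rw [← hs] at hd
  rw [← Finset.sum_filter_add_sum_filter_not Finset.univ (fun c => c ≠ σ v ∧ c ≠ τ v)] at hd
  have e : Finset.univ.filter (fun c => ¬ (c ≠ σ v ∧ c ≠ τ v)) = {σ v, τ v} := by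
    ext c
    simp only [Finset.mem_filter, Finset.mem_univ, true_and, Finset.mem_insert,
      Finset.mem_singleton]
    tauto
  rw [e, Finset.sum_pair h.1] at hd
  unfold otherColors
  linarith

theorem card_otherColors (h : DiffAt σ τ v) : ((otherColors σ τ v).card : ℝ) = k - 2 := by
  have e : otherColors σ τ v = Finset.univ \ {σ v, τ v} := by
    ext c; simp [mem_otherColors]
  have h2 : ({σ v, τ v} : Finset (Fin k)).card = 2 := Finset.card_pair h.1
  have hle : 2 ≤ k := by
    rw [← h2]; exact (Finset.card_le_univ _).trans (by simp)
  rw [e, Finset.card_sdiff_of_subset (Finset.subset_univ _), h2, Finset.card_fin,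
    Nat.cast_sub hle]
  norm_num

/-- The bound on `∇` in terms of the number of extremal neighbors. -/
theorem nabla_le [DecidableRel G.Adj] (h : DiffAt σ τ v) (hi : Admissible G σ τ v ia ib)
    {P : Option (Comp V k) → Option (Comp V k) → ℝ}
    (hP : IsVigodaCoupling G pStar σ τ v ia ib P) {γ : ℝ} (hγ0 : 0 ≤ γ) (hγ1 : γ ≤ 1 / 2)
    (hk : (0 : ℝ) ≤ k - G.maxDegree - 2) :
    nabla G γ σ τ P ≤ -k + 4 + 161 / 88 * G.maxDegree
      + γ * (1 - beta G σ τ v) * (k + 2 + 2 * G.maxDegree)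
      + (11 / 6 - 161 / 88) * (extNbrs G σ τ v).card
      + γ / G.maxDegree * ((G.maxDegree - (extNbrs G σ τ v).card) * (18 * k + 17 * G.maxDegree)
        - ((extNbrs G σ τ v).card - 4) * (k - G.maxDegree - 2)) := by
  classical
  rw [nabla_eq]
  set F : Option (Comp V k) → Option (Comp V k) → ℝ := fun X Y =>
    extDist G γ (applyMove σ X) (applyMove τ Y) - extDist G γ σ τ with hFdef
  set δ := γ * (1 - beta G σ τ v) with hδdef
  have hδ : 0 ≤ δ := mul_nonneg hγ0 (sub_nonneg.2 beta_le_one)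
  have hF : ∀ X Y, F X Y ≤ (hammingDist (applyMove σ X) (applyMove τ Y) : ℝ) - 1 + δ := by
    intro X Y
    have h1 := extDist_le_hammingDist (G := G) hγ0 hγ1 (σ := applyMove σ X) (τ := applyMove τ Y)
    have h2 := extDist_of_diffAt (G := G) hγ0 hγ1 h
    simp only [hFdef, hδdef]
    linarith
  have hF0 : F none none ≤ 0 := by simp [hFdef, applyMove]
  have hdiag : ∀ K ∈ unaffected G σ τ v, F (some K) (some K) ≤
      γ / G.maxDegree * (((extAfter G σ τ v K).card : ℝ) - (extNbrs G σ τ v).card) := by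
    intro K hK
    have hD := h.flipComp (notMem_of_mem_unaffected hK)
    have h1 := extDist_of_diffAt (G := G) hγ0 hγ1 hD
    have h2 := extDist_of_diffAt (G := G) hγ0 hγ1 h
    simp only [hFdef, applyMove]
    rw [h1, h2, beta_eq, beta_eq]
    unfold extAfter
    refine le_of_eq ?_
    ring
  have hmain := coupling_sum_le h hi hP hδ hF hF0
  rw [sum_regularMass_mul h] at hmain
  have hU : ∑ S ∈ comps G σ \ affected G σ v (τ v), pStar S.2.card * F (some S) (some S) ≤
      γ / G.maxDegree * ((G.maxDegree - (extNbrs G σ τ v).card) * (18 * k + 17 * G.maxDegree)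
        - ((extNbrs G σ τ v).card - 4) * (k - G.maxDegree - 2)) := by
    have e : ∑ S ∈ comps G σ \ affected G σ v (τ v), pStar S.2.card * F (some S) (some S) =
      ∑ S ∈ unaffected G σ τ v, pStar S.2.card * F (some S) (some S) := by
      unfold unaffected; congr
    rw [e]
    calc _ ≤ ∑ K ∈ unaffected G σ τ v, γ / G.maxDegree *
          (pStar K.2.card * (((extAfter G σ τ v K).card : ℝ) - (extNbrs G σ τ v).card)) := by
          refine Finset.sum_le_sum fun K hK => ?_
          have := mul_le_mul_of_nonneg_left (hdiag K hK) (pStar_nonneg K.2.card)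
          linarith
      _ ≤ _ := by
          rw [← Finset.mul_sum]
          exact mul_le_mul_of_nonneg_left (drift_le h hk) (by positivity)
  have hC : ∑ c ∈ otherColors σ τ v, ∑ X ∈ moves G σ, ∑ Y ∈ moves G τ,
      colorMass G pStar σ τ v c (ia c) (ib c) X Y * F X Y ≤
      -(k - 2) + 161 / 88 * (∑ c ∈ otherColors σ τ v, ((colorNbrs G σ v c).card : ℝ)) +
      δ * ((k - 2) + 2 * ∑ c ∈ otherColors σ τ v, ((colorNbrs G σ v c).card : ℝ)) +
      (11 / 6 - 161 / 88) * (extNbrs G σ τ v).card := by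
    have h1 := Finset.sum_le_sum fun c hc =>
      sum_colorMass_le h hi (mem_otherColors.1 hc).1 (mem_otherColors.1 hc).2 hδ hF
    refine h1.trans ?_
    rw [Finset.sum_add_distrib, Finset.sum_add_distrib, Finset.sum_add_distrib, ← Finset.mul_sum,
      ← Finset.mul_sum, ← Finset.mul_sum, Finset.sum_add_distrib, ← Finset.mul_sum,
      Finset.sum_const, Finset.sum_const, nsmul_eq_mul, nsmul_eq_mul, card_otherColors h]
    have h2 : ∑ c ∈ otherColors σ τ v, ∑ w ∈ colorNbrs G σ v c,
        (if w ∈ extNbrs G σ τ v then (1 : ℝ) else 0) ≤ (extNbrs G σ τ v).card := by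
      rw [sum_colorNbrs, Finset.sum_ite_mem, Finset.sum_const, nsmul_eq_mul, mul_one]
      exact_mod_cast Finset.card_le_card Finset.inter_subset_right
    linarith
  -- Neighbors with a color of `v` cost `1 ≤ 161/88` each, so all neighbors are charged alike. The
  -- constant is `-(k - 2) + 2 = -k + 4`.
  have hr := sum_card_colorNbrs_le (G := G) h
  have hs0 : (0 : ℝ) ≤ (colorNbrs G σ v (σ v)).card := by positivity
  have ht0 : (0 : ℝ) ≤ (colorNbrs G σ v (τ v)).card := by positivity
  have hδr := mul_le_mul_of_nonneg_left hr hδ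
  linarith

/-- Measured in units of `γ k = D / 13992`, `ε D` is `53`, `γ D` is at most `0.55`, and `D / 84000`
is about `0.17`. Up to constants, `E = 0` gives at most `-53 + 0.17 + 18 + 17 · 0.55 + 1 + 2 · 0.55
< 0`, and `E = D` gives at most `-0.45 + 0.17 < 0`; the expression is affine in between. -/
theorem final_arithmetic {k D E γ : ℝ} (hD : 1000000 ≤ D) (hk : (11 / 6 - 1 / 84000) * D ≤ k)
    (hE0 : 0 ≤ E) (hE : E ≤ D) (hγ : γ = (11 / 6 - 161 / 88) * D / (53 * k)) :
    -k + 4 + 161 / 88 * D + γ * (1 - E / D) * (k + 2 + 2 * D) + (11 / 6 - 161 / 88) * E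
      + γ / D * ((D - E) * (18 * k + 17 * D) - (E - 4) * (k - D - 2)) ≤ -1 := by
  have hD0 : 0 < D := by linarith
  have hk0 : 0 < k := by nlinarith
  have hγk : γ * k = D / 13992 := by rw [hγ]; field_simp; norm_num
  have hγ0 : 0 ≤ γ := by rw [hγ]; positivity
  obtain ⟨x, hx⟩ : ∃ x, x = E / D := ⟨_, rfl⟩
  have hEx : E = x * D := by rw [hx]; field_simp
  have hx0 : 0 ≤ x := by rw [hx]; positivity
  have hx1 : x ≤ 1 := by rw [hx]; exact div_le_one_of_le₀ hE hD0.le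
  rw [← hx, hEx]
  have e : γ / D * ((D - x * D) * (18 * k + 17 * D) - (x * D - 4) * (k - D - 2)) =
      (1 - x) * (18 * (γ * k) + 17 * (γ * D)) - x * (γ * k - γ * D - 2 * γ)
      + 4 * (γ * k - γ * D - 2 * γ) / D := by
    field_simp; ring
  have e2 : γ * (1 - x) * (k + 2 + 2 * D) = (1 - x) * (γ * k + 2 * γ + 2 * (γ * D)) := by ring
  rw [e, e2, hγk]
  have hγD : γ * D ≤ 55 / 100 * (D / 13992) := by
    rw [← hγk]; nlinarith
  have hγD0 : 0 ≤ γ * D := by positivity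
  have hγs : γ ≤ 1 / 1000 := by
    have : γ * D ≤ 1 / 1000 * D := by linarith
    exact le_of_mul_le_mul_right this hD0
  have h4 : 4 * (D / 13992 - γ * D - 2 * γ) / D ≤ 1 := by
    rw [div_le_one hD0]; linarith
  have m1 : (1 - x) * (18 * (D / 13992) + 17 * (γ * D)) ≤
      (1 - x) * ((18 + 17 * (55 / 100)) * (D / 13992)) :=
    mul_le_mul_of_nonneg_left (by linarith) (by linarith)
  have m2 : (1 - x) * (D / 13992 + 2 * γ + 2 * (γ * D)) ≤
      (1 - x) * ((1 + 2 * (55 / 100)) * (D / 13992) + 1) :=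
    mul_le_mul_of_nonneg_left (by linarith) (by linarith)
  have m3 : x * (45 / 100 * (D / 13992) - 1) ≤ x * (D / 13992 - γ * D - 2 * γ) :=
    mul_le_mul_of_nonneg_left (by linarith) hx0
  have m4 : 0 ≤ (1 - x) * D := mul_nonneg (by linarith) hD0.le
  linarith

end Total

end FlipDynamics

theorem mainTheorem3 :
    ∃ Δ₀ : ℕ, ∀ (V : Type*) [Fintype V] [LinearOrder V]
      (G : SimpleGraph V) [DecidableRel G.Adj] (k : ℕ),
      Δ₀ ≤ G.maxDegree →
      (11 / 6 - 1 / 84000 : ℝ) * G.maxDegree ≤ k →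
      ∀ (σ τ : V → Fin k) (v : V), (FlipDynamics.colorGraph V k).Adj σ τ → σ v ≠ τ v →
      ∀ ia ib : Fin k → V,
        (∀ c, c ≠ σ v → c ≠ τ v → (FlipDynamics.colorNbrs G σ v c).Nonempty →
          FlipDynamics.IsArgmax (FlipDynamics.colorNbrs G σ v c)
              (FlipDynamics.aEntry G σ τ v c) (ia c) ∧
            FlipDynamics.IsArgmax (FlipDynamics.colorNbrs G σ v c)
              (FlipDynamics.bEntry G σ τ v c) (ib c)) →
        (∃ P, FlipDynamics.IsVigodaCoupling G FlipDynamics.pStar σ τ v ia ib P) ∧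
        ∀ P, FlipDynamics.IsVigodaCoupling G FlipDynamics.pStar σ τ v ia ib P →
          FlipDynamics.nabla G (FlipDynamics.gammaConst G.maxDegree k) σ τ P ≤ -1 := by
  -- The smallest margin, about `Δ / 50000` at `β = 1`, then exceeds the additive constants.
  refine ⟨1000000, ?_⟩
  intro V _ _ G _ k hΔ hk σ τ v hadj hv ia ib hi
  have h : FlipDynamics.DiffAt σ τ v := FlipDynamics.DiffAt.of_hammingDist hadj hv
  refine ⟨FlipDynamics.exists_vigodaCoupling h hi, fun P hP => ?_⟩
  have hD : (1000000 : ℝ) ≤ G.maxDegree := by exact_mod_cast hΔ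
  have hk0 : (0 : ℝ) < k := by nlinarith
  have hγ0 : 0 ≤ FlipDynamics.gammaConst G.maxDegree k := by
    unfold FlipDynamics.gammaConst; positivity
  have hγ1 : FlipDynamics.gammaConst G.maxDegree k ≤ 1 / 2 := by
    unfold FlipDynamics.gammaConst
    rw [div_le_iff₀ (by positivity)]
    nlinarith
  have hk2 : (0 : ℝ) ≤ k - G.maxDegree - 2 := by nlinarith
  refine (FlipDynamics.nabla_le h hi hP hγ0 hγ1 hk2).trans ?_
  rw [FlipDynamics.beta_eq]
  exact FlipDynamics.final_arithmetic hD hk (by positivity)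
    (by exact_mod_cast FlipDynamics.card_extNbrs_le) rfl
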